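/- Let $m\ge 2$ and let $G\le \mathrm{SU}(m-1)$ be a compact connected subgroup with Lie algebra $\mathfrak g$, acting on $\mathbb C^{m-1}$ in the standard way and on $\mathbb C^m=\mathbb C^{m-1}\times\mathbb C$ trivially on the last factor. Let $\mu_G(z)=-\tfrac12\pi_{\mathfrak g}(iz\bar z^T)$ be its standard moment map on $\mathbb C^{m-1}$, and let $Z$ be a connected component of $\mu_G^{-1}(0)$ which contains a (non-empty) cohomogeneity-one Lagrangian submanifold, i.e. a $G$-invariant Lagrangian submanifold of $\mathbb C^{m-1}$ whose points have mutually conjugate stabilisers and $(m-2)$-dimensional orbits. Let $z'\in Z\setminus\{0\}$, let $P=\mathbb C z'$, and let $C_k=\mathrm{Stab}(P)/\mathrm{Stab}(z')$, of order $k$. Let $\Phi:P\to\mathbb C$ be a complex linear isomorphism such that $V:=\Phi^{-1}(1)$ satisfies $\{\Omega(\pm\nu,V,e_m)\}=\{\pm1\}$, where $\pm\nu$ are the unit elements of $\Lambda^{m-2}T_V(G\cdot V)$ and $\Omega=dz_1\wedge\dots\wedge dz_m$. For curves $\gamma:I_1\to\mathbb C$, $\xi:I_2\to\mathbb C$ put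 $\beta_\gamma(s)=-\int_0^s\langle\gamma(t),i\gamma'(t)\rangle\,dt$, $$\check F(x,y)=\Big(\gamma(x)\xi(y),\ \tfrac12\big(|\xi(y)|^2-|\gamma(x)|^2\big)+i\big(\beta_\xi(y)-\beta_\gamma(x)\big)\Big),\qquad F(g,x,y)=g\cdot(\Phi\oplus\mathrm{Id})^{-1}\check F(x,y)$$ for $(g,x,y)\in G\times I_1\times I_2$. As $F(g,x,y)$ depends on $g$ only through $g\cdot V$, $F$ induces a map $\hat F:(G\cdot V)\times I_1\times I_2\to\mathbb C^m$, where $G\cdot V\cong G/\mathrm{Stab}(V)$, with the same image as $F$. Let $\tilde l(s)=\cos((m-1)s)^{-1/(m-1)}e^{is}$ for $s\in I:=\left(-\tfrac{\pi}{2(m-1)},\tfrac{\pi}{2(m-1)}\right)$ be the Lawlor neck profile and $\tilde c(s)=s$, $s\in\mathbb R$, the line. For $\phi\in\mathbb R$ and $\mu,\mu_1,\mu_2>0$, let $L_{(b)}$ be the image of $F$ for $\gamma=\mu\tilde l$, $\xi=e^{i\phi}\tilde c$ on $I\times\mathbb R$, and let $L_{(c)}$ be the image of $F$ for $\gamma=e^{i\phi}\mu_1\tilde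 l$, $\xi=\mu_2\tilde l$ on $I\times I$. A smooth map $f$ from an $m$-manifold to $\mathbb C^m$ is called exact special Lagrangian if $f^*\omega=0$, if $f^*\lambda$ is exact, where $\lambda=\frac1{2i}\sum_j(\bar z_j\,dz_j-z_j\,d\bar z_j)$, and if $f^*\operatorname{Im}(e^{-i\theta}\Omega)=0$ for some constant $\theta\in\mathbb R$; an embedded submanifold is so called if its inclusion is. Then: - (b) The map $\hat F$ of $L_{(b)}$ is exact special Lagrangian, and is an immersion on $\{y\neq0\}$. If $G=\mathrm{SO}(m-1)$, then $L_{(b)}$ is an embedded exact special Lagrangian submanifold of $\mathbb C^m$. For every $G$, let $S$ be the image of $\{y=0\}$ under $F$. Then $S=L_{(b)}\cap(\{0\}\times\mathbb C)$, $S$ is a one-dimensional submanifold, and $L_{(b)}\setminus S$ is an embedded exact special Lagrangian submanifold. - (c) The map $\hat F$ of $L_{(c)}$ is an exact special Lagrangian immersion for every $G$. If $k\le m-1$, then $\hat F$ is an embedding, and so $L_{(c)}$ is an embedded exact special Lagrangian submanifold. -/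

import Mathlib

open scoped ContDiff

noncomputable section

/-! Throughout, the ambient space is `ℂ^m = ℂ^n × ℂ` with `n = m - 1`. -/

/-- Complex Euclidean space `ℂ^d`. -/
abbrev CSpace (d : ℕ) : Type := EuclideanSpace ℂ (Fin d)

/-! ### Submanifolds and immersions through local parametrisations -/

section Submanifolds

variable {E : Type*} [NormedAddCommGroup E] [NormedSpace ℝ E]

/-- `φ`, restricted to the open set `U ⊆ ℝ^d`, is a smooth local parametrisation of `M`: an
immersion and a homeomorphism onto a relatively open subset of `M`. -/
structure IsLocalParam (d : ℕ) (M : Set E) (U : Set (EuclideanSpace ℝ (Fin d)))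
    (φ : EuclideanSpace ℝ (Fin d) → E) : Prop where
  isOpen_dom : IsOpen U
  smooth : ContDiffOn ℝ ∞ φ U
  immersive : ∀ u ∈ U, Function.Injective (fderiv ℝ φ u)
  isEmbedding : Topology.IsEmbedding (U.domRestrict φ)
  isOpen_image : ∃ W : Set E, IsOpen W ∧ φ '' U = M ∩ W

/-- `M` is a smooth embedded `d`-dimensional submanifold of `E`. -/
def IsSubmanifold (d : ℕ) (M : Set E) : Prop :=
  ∀ p ∈ M, ∃ U φ, IsLocalParam d M U φ ∧ p ∈ φ '' U

/-- `f` restricts to a smooth map on the `d`-dimensional submanifold `M`. -/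
def SmoothOnSubmanifold {E' : Type*} [NormedAddCommGroup E'] [NormedSpace ℝ E']
    (d : ℕ) (M : Set E) (f : E → E') : Prop :=
  ∀ U φ, IsLocalParam d M U φ → ContDiffOn ℝ ∞ (f ∘ φ) U

/-- `M` is a `d`-dimensional submanifold and `f` restricts to a smooth immersion of `M`. -/
structure IsImmersionOn {E' : Type*} [NormedAddCommGroup E'] [NormedSpace ℝ E']
    (d : ℕ) (M : Set E) (f : E → E') : Prop where
  submanifold : IsSubmanifold d M
  smooth : SmoothOnSubmanifold d M f
  immersive : ∀ U φ, IsLocalParam d M U φ →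
    ∀ u ∈ U, Function.Injective (fderiv ℝ (f ∘ φ) u)

/-- `f` restricts to a smooth embedding of the `d`-dimensional submanifold `M`. -/
def IsSmoothEmbeddingOn {E' : Type*} [NormedAddCommGroup E'] [NormedSpace ℝ E']
    (d : ℕ) (M : Set E) (f : E → E') : Prop :=
  IsImmersionOn d M f ∧ Topology.IsEmbedding (M.domRestrict f)

/-! ### The Calabi-Yau structure of `ℂ^d` and special Lagrangians -/

/-- The Kähler form `∑ dx_i ∧ dy_i`. -/
def kahlerForm {d : ℕ} (v w : CSpace d) : ℝ :=
  ∑ i, ((v i).re * (w i).im - (v i).im * (w i).re)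

/-- The Liouville form `(1 / 2i) ∑ (conj z_i dz_i - z_i d(conj z_i))` at `z`, evaluated on `v`. -/
def liouvilleForm {d : ℕ} (z v : CSpace d) : ℝ :=
  ∑ i, (starRingEnd ℂ (z i) * v i).im

/-- The holomorphic volume form `dz_1 ∧ ⋯ ∧ dz_d`. -/
def holVolForm {d : ℕ} (v : Fin d → CSpace d) : ℂ :=
  Matrix.det (Matrix.of fun i j => v j i)

/-- The Kähler form of `ℂ^d` pulls back to zero under `f : M → ℂ^d`. -/
def PullsBackKahlerToZero {d : ℕ} (M : Set E) (f : E → CSpace d) : Prop :=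
  ∀ U φ, IsLocalParam d M U φ → ∀ u ∈ U, ∀ v w,
    kahlerForm (fderiv ℝ (f ∘ φ) u v) (fderiv ℝ (f ∘ φ) u w) = 0

/-- The smooth map `f : M → ℂ^d` from a `d`-dimensional submanifold is Lagrangian (`f^* ω = 0`),
exact (`f^* λ = dh` for a smooth `h : M → ℝ`), and special of some constant phase `θ`
(`f^* Im (e^{-iθ} Ω) = 0`). Where `f` is an immersion, the last condition says that
`f^* Ω = ± e^{iθ} vol`, i.e. that the Lagrangian angle is constant for a suitable orientation. -/
structure IsExactSpecialLagrangianMap {d : ℕ} (M : Set E) (f : E → CSpace d) : Prop where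
  submanifold : IsSubmanifold d M
  smooth : SmoothOnSubmanifold d M f
  lagrangian : PullsBackKahlerToZero M f
  exact : ∃ h : E → ℝ, SmoothOnSubmanifold d M h ∧
    ∀ U φ, IsLocalParam d M U φ → ∀ u ∈ U, ∀ v,
      fderiv ℝ (h ∘ φ) u v = liouvilleForm (f (φ u)) (fderiv ℝ (f ∘ φ) u v)
  special : ∃ θ : ℝ, ∀ U φ, IsLocalParam d M U φ →
    ∀ u ∈ U, ∀ v : Fin d → EuclideanSpace ℝ (Fin d),
      (Complex.exp (-(θ : ℂ) * Complex.I) *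
        holVolForm fun j => fderiv ℝ (f ∘ φ) u (v j)).im = 0

/-- `f` restricts to an immersion of `M` whose image is an (immersed) exact special Lagrangian. -/
def IsExactSpecialLagrangianImmersion {d : ℕ} (M : Set E) (f : E → CSpace d) : Prop :=
  IsImmersionOn d M f ∧ IsExactSpecialLagrangianMap M f

end Submanifolds

/-- `L ⊆ ℂ^d` is an embedded exact special Lagrangian submanifold. -/
def IsEmbeddedExactSpecialLagrangian {d : ℕ} (L : Set (CSpace d)) : Prop :=
  IsExactSpecialLagrangianMap L (id : CSpace d → CSpace d)

/-- `L ⊆ ℂ^d` is an embedded Lagrangian submanifold. -/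
def IsEmbeddedLagrangian {d : ℕ} (L : Set (CSpace d)) : Prop :=
  IsSubmanifold d L ∧ PullsBackKahlerToZero L (id : CSpace d → CSpace d)

/-! ### Subgroups of `SU(n)`, their Lie algebras, moment maps and stabilisers -/

/-- The special unitary group `SU(n)`. -/
abbrev SUGroup (n : ℕ) : Type := Matrix.specialUnitaryGroup (Fin n) ℂ

/-- The action of `SU(n)` on `ℂ^n`. -/
def act {n : ℕ} (g : SUGroup n) (z : CSpace n) : CSpace n :=
  WithLp.toLp 2 (Matrix.mulVec (g : Matrix (Fin n) (Fin n) ℂ) z)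

theorem act_one {n : ℕ} (z : CSpace n) : act (1 : SUGroup n) z = z := by
  ext i; simp [act]

theorem act_mul {n : ℕ} (g h : SUGroup n) (z : CSpace n) :
    act (g * h) z = act g (act h z) := by
  simp [act, Matrix.mulVec_mulVec]

theorem act_smul {n : ℕ} (g : SUGroup n) (c : ℂ) (z : CSpace n) :
    act g (c • z) = c • act g z := by
  ext i; simp [act, Matrix.mulVec_smul]

theorem act_inv_act {n : ℕ} (g : SUGroup n) (z : CSpace n) : act g⁻¹ (act g z) = z := by
  rw [← act_mul, inv_mul_cancel, act_one]

/-- The Lie algebra of a closed subgroup of `SU(n)`: the matrices `X` with `exp (tX) ∈ G` for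
all real `t`. (These already form a real subspace, the span only bundles it.) -/
def lieAlg {n : ℕ} (G : Subgroup (SUGroup n)) : Submodule ℝ (Matrix (Fin n) (Fin n) ℂ) :=
  Submodule.span ℝ {X | ∀ t : ℝ, ∃ g ∈ G,
    (g : Matrix (Fin n) (Fin n) ℂ) = NormedSpace.exp (t • X)}

/-- The real inner product `Re tr (X^* Y)` on complex matrices, as a linear form in `X`. -/
def traceForm {n : ℕ} (Y : Matrix (Fin n) (Fin n) ℂ) :
    Matrix (Fin n) (Fin n) ℂ →ₗ[ℝ] ℝ where
  toFun X := (Matrix.trace (X.conjTranspose * Y)).re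
  map_add' X X' := by simp [Matrix.add_mul]
  map_smul' c X := by simp [Matrix.trace_smul]

/-- The standard moment map `μ(z) = - 1/2 π_𝔤 (i z z^*)` of `G`, with values in the dual of `𝔤`;
`𝔤` and its dual are identified by the inner product `Re tr (X^* Y)`. -/
def momentMap {n : ℕ} (G : Subgroup (SUGroup n)) (z : CSpace n) : lieAlg G →ₗ[ℝ] ℝ :=
  (-(1 / 2 : ℝ)) • (traceForm (Complex.I • Matrix.vecMulVec z (star (z : Fin n → ℂ)))).comp
    (lieAlg G).subtype

/-- The orbit `G · z`. -/
def orbit {n : ℕ} (G : Subgroup (SUGroup n)) (z : CSpace n) : Set (CSpace n) :=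
  {w | ∃ g ∈ G, w = act g z}

/-- The tangent space `{X z : X ∈ 𝔤}` at `z` of the orbit `G · z`; its dimension is that of
`G / Stab z`. -/
def orbitTangent {n : ℕ} (G : Subgroup (SUGroup n)) (z : CSpace n) : Submodule ℝ (CSpace n) :=
  Submodule.span ℝ {v | ∃ X ∈ lieAlg G, v = WithLp.toLp 2 (Matrix.mulVec X z)}

/-- The stabiliser of the vector `z` in `G`. -/
def vecStab {n : ℕ} (G : Subgroup (SUGroup n)) (z : CSpace n) : Subgroup (SUGroup n) where
  carrier := {g | g ∈ G ∧ act g z = z}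
  one_mem' := ⟨G.one_mem, act_one z⟩
  mul_mem' := by
    rintro a b ⟨ha, ha'⟩ ⟨hb, hb'⟩
    exact ⟨G.mul_mem ha hb, by rw [act_mul, hb', ha']⟩
  inv_mem' := by
    rintro a ⟨ha, ha'⟩
    refine ⟨G.inv_mem ha, ?_⟩
    have h := act_inv_act a z
    rwa [ha'] at h

/-- The stabiliser in `G` of the complex line `P_z` through `z`. -/
def lineStab {n : ℕ} (G : Subgroup (SUGroup n)) (z : CSpace n) : Subgroup (SUGroup n) where
  carrier := {g | g ∈ G ∧ ∃ c : ℂ, c ≠ 0 ∧ act g z = c • z}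
  one_mem' := ⟨G.one_mem, 1, one_ne_zero, by rw [act_one, one_smul]⟩
  mul_mem' := by
    rintro a b ⟨ha, c, hc, ha'⟩ ⟨hb, e, he, hb'⟩
    exact ⟨G.mul_mem ha hb, e * c, mul_ne_zero he hc, by
      rw [act_mul, hb', act_smul, ha', smul_smul]⟩
  inv_mem' := by
    rintro a ⟨ha, c, hc, ha'⟩
    refine ⟨G.inv_mem ha, c⁻¹, inv_ne_zero hc, ?_⟩
    have h := act_inv_act a z
    rw [ha', act_smul] at h
    rw [← h, smul_smul, inv_mul_cancel₀ hc, one_smul, h]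

/-- The group `C_k = Stab(P_z) / Stab(z)`. -/
abbrev CyclicQuotient {n : ℕ} (G : Subgroup (SUGroup n)) (z : CSpace n) : Type :=
  lineStab G z ⧸ (vecStab G z).subgroupOf (lineStab G z)

/-- `G` is the group `SO(n)` of real matrices in `SU(n)`. -/
def IsSO {n : ℕ} (G : Subgroup (SUGroup n)) : Prop :=
  ∀ g : SUGroup n, g ∈ G ↔ ∃ A ∈ Matrix.specialOrthogonalGroup (Fin n) ℝ,
    (g : Matrix (Fin n) (Fin n) ℂ) = A.map Complex.ofReal

/-- `L ⊆ ℂ^n` is a (non-empty, embedded) `G`-invariant Lagrangian submanifold of cohomogeneity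
one: all stabilisers are conjugate in `G`, and all orbits have dimension `n - 1`. -/
structure IsCohomogeneityOneLagrangian {n : ℕ} (G : Subgroup (SUGroup n))
    (L : Set (CSpace n)) : Prop where
  nonempty : L.Nonempty
  lagrangian : IsEmbeddedLagrangian L
  invariant : ∀ g ∈ G, ∀ z ∈ L, act g z ∈ L
  isotropy : ∀ z ∈ L, ∀ w ∈ L, ∃ g ∈ G, ∀ h, h ∈ vecStab G w ↔ g⁻¹ * h * g ∈ vecStab G z
  orbit_dim : ∀ z ∈ L, Module.finrank ℝ (orbitTangent G z) + 1 = n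

/-- `Z` is a connected component of `μ⁻¹(0)` that contains a cohomogeneity-one Lagrangian. -/
structure IsAdmissibleComponent {n : ℕ} (G : Subgroup (SUGroup n)) (Z : Set (CSpace n)) :
    Prop where
  component : ∃ z, momentMap G z = 0 ∧ Z = connectedComponentIn {w | momentMap G w = 0} z
  lagrangian : ∃ L ⊆ Z, IsCohomogeneityOneLagrangian G L

/-- `Φ : P → ℂ` is an isomorphism adapted to Lagrangian angles: `V = Φ⁻¹(1)` satisfies
`Ω(± ν, V, e_m) = ± 1`, where `± ν` are the unit elements of the top exterior power of the
`(n - 1)`-dimensional tangent space at `V` of the orbit `G · V`. Here `ν = τ_1 ∧ ⋯ ∧ τ_{n-1}` for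
an orthonormal basis `τ`, and `Ω(ν, V, e_m)` is the value on `(τ, V)` of the holomorphic
volume form of `ℂ^n`. -/
def IsAngleAdapted {n : ℕ} (G : Subgroup (SUGroup n)) {z : CSpace n}
    (Φ : Submodule.span ℂ {z} ≃ₗ[ℂ] ℂ) : Prop :=
  ∃ τ : Fin (n - 1) → CSpace n,
    Orthonormal ℝ τ ∧ Submodule.span ℝ (Set.range τ) = orbitTangent G (Φ.symm 1 : CSpace n) ∧
    ∃ ε : ℂ, (ε = 1 ∨ ε = -1) ∧
      holVolForm (fun j : Fin n =>
        if h : (j : ℕ) < n - 1 then τ ⟨j, h⟩ else (Φ.symm 1 : CSpace n)) = ε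

/-! ### The ansatz -/

/-- `β_γ(s) = - ∫_0^s ⟨γ(t), i γ'(t)⟩ dt`, with the real inner product of `ℂ`. -/
def betaFun (γ : ℝ → ℂ) (s : ℝ) : ℝ :=
  -∫ t in (0 : ℝ)..s, (starRingEnd ℂ (γ t) * (Complex.I * deriv γ t)).re

/-- First component of the profile map: `γ(x) ξ(y)`. -/
def profileFst (γ ξ : ℝ → ℂ) (x y : ℝ) : ℂ := γ x * ξ y

/-- Second component of the profile map:
`1/2 (|ξ(y)|² - |γ(x)|²) + i (β_ξ(y) - β_γ(x))`. -/
def profileSnd (γ ξ : ℝ → ℂ) (x y : ℝ) : ℂ :=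
  ((1 / 2 * (‖ξ y‖ ^ 2 - ‖γ x‖ ^ 2) : ℝ) : ℂ)
    + Complex.I * ((betaFun ξ y - betaFun γ x : ℝ) : ℂ)

/-- The point `(z', w)` of `ℂ^n × ℂ = ℂ^(n+1)`. -/
def joinC {n : ℕ} (z' : CSpace n) (w : ℂ) : CSpace (n + 1) :=
  WithLp.toLp 2 (Fin.snoc (α := fun _ => ℂ) (z' : Fin n → ℂ) w)

/-- `F(g, x, y) = g · (Φ ⊕ Id)⁻¹ (γ(x) ξ(y), …)`, where `G` acts trivially on the last
coordinate. -/
def ansatzMap {n : ℕ} {z : CSpace n} (Φ : Submodule.span ℂ {z} ≃ₗ[ℂ] ℂ) (γ ξ : ℝ → ℂ)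
    (g : SUGroup n) (x y : ℝ) : CSpace (n + 1) :=
  joinC (act g (Φ.symm (profileFst γ ξ x y) : CSpace n)) (profileSnd γ ξ x y)

/-- The image of `F` on `G × I₁ × I₂`. -/
def ansatzImage {n : ℕ} (G : Subgroup (SUGroup n)) {z : CSpace n}
    (Φ : Submodule.span ℂ {z} ≃ₗ[ℂ] ℂ) (γ ξ : ℝ → ℂ) (I₁ I₂ : Set ℝ) : Set (CSpace (n + 1)) :=
  {w | ∃ g ∈ G, ∃ x ∈ I₁, ∃ y ∈ I₂, w = ansatzMap Φ γ ξ g x y}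

/-- With `V = Φ⁻¹(1)`, `F(g, x, y)` depends on `g` only through `p = g · V`; this is the
induced map on `(G · V) × I₁ × I₂`, which is `(G / Stab V) × I₁ × I₂`. -/
def ansatzQuotMap {n : ℕ} (γ ξ : ℝ → ℂ) (q : CSpace n × ℝ × ℝ) : CSpace (n + 1) :=
  joinC (profileFst γ ξ q.2.1 q.2.2 • q.1) (profileSnd γ ξ q.2.1 q.2.2)

/-- The domain `(G · V) × I₁ × I₂`, `V = Φ⁻¹(1)`. -/
def ansatzDomain {n : ℕ} (G : Subgroup (SUGroup n)) {z : CSpace n}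
    (Φ : Submodule.span ℂ {z} ≃ₗ[ℂ] ℂ) (I₁ I₂ : Set ℝ) : Set (CSpace n × ℝ × ℝ) :=
  orbit G (Φ.symm 1 : CSpace n) ×ˢ I₁ ×ˢ I₂

theorem ansatzMap_eq_ansatzQuotMap {n : ℕ} {z : CSpace n} (Φ : Submodule.span ℂ {z} ≃ₗ[ℂ] ℂ)
    (γ ξ : ℝ → ℂ) (g : SUGroup n) (x y : ℝ) :
    ansatzMap Φ γ ξ g x y = ansatzQuotMap γ ξ (act g (Φ.symm 1 : CSpace n), x, y) := by
  have h : (Φ.symm (profileFst γ ξ x y) : CSpace n)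
      = profileFst γ ξ x y • (Φ.symm 1 : CSpace n) := by
    rw [← Submodule.coe_smul, ← map_smul, smul_eq_mul, mul_one]
  simp only [ansatzMap, ansatzQuotMap, h, act_smul]

theorem ansatzImage_eq {n : ℕ} (G : Subgroup (SUGroup n)) {z : CSpace n}
    (Φ : Submodule.span ℂ {z} ≃ₗ[ℂ] ℂ) (γ ξ : ℝ → ℂ) (I₁ I₂ : Set ℝ) :
    ansatzImage G Φ γ ξ I₁ I₂ = ansatzQuotMap γ ξ '' ansatzDomain G Φ I₁ I₂ := by
  ext w
  constructor
  · rintro ⟨g, hg, x, hx, y, hy, rfl⟩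
    exact ⟨(act g (Φ.symm 1 : CSpace n), x, y), ⟨⟨g, hg, rfl⟩, hx, hy⟩,
      (ansatzMap_eq_ansatzQuotMap Φ γ ξ g x y).symm⟩
  · rintro ⟨⟨p, x, y⟩, ⟨⟨g, hg, hp⟩, hx, hy⟩, rfl⟩
    refine ⟨g, hg, x, hx, y, hy, ?_⟩
    rw [ansatzMap_eq_ansatzQuotMap, ← hp]

/-! ### The profile curves -/

/-- The Lawlor neck profile `(cos (n s))^(-1/n) e^{is}`. -/
def lawlor (n : ℕ) (s : ℝ) : ℂ :=
  ((Real.cos (n * s) ^ (-(1 / (n : ℝ))) : ℝ) : ℂ) * Complex.exp (s * Complex.I)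

/-- The interval `(-π/(2n), π/(2n))` on which the Lawlor neck profile lives. -/
def lawlorInterval (n : ℕ) : Set ℝ := Set.Ioo (-(Real.pi / (2 * n))) (Real.pi / (2 * n))

/-- The rotated and scaled Lawlor neck profile `e^{iφ} μ l`. -/
def lawlorCurve (n : ℕ) (φ μ : ℝ) (s : ℝ) : ℂ :=
  Complex.exp (φ * Complex.I) * (μ : ℂ) * lawlor n s

/-- The rotated line `s ↦ e^{iφ} s`. -/
def lineCurve (φ : ℝ) (s : ℝ) : ℂ := Complex.exp (φ * Complex.I) * (s : ℂ)

/-- The subset `{0} × ℂ` of `ℂ^n × ℂ`. -/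
def singularAxis (n : ℕ) : Set (CSpace (n + 1)) := {w | ∃ c : ℂ, w = joinC 0 c}

end

/-! Write n = m - 1 = k + 1 and V = Φ⁻¹(1). The group enters mainly through the orbit Q = G · V.
Since V is a multiple of z', the moment map vanishes at V. This makes X V Hermitian-orthogonal to V
for X in the Lie algebra, and the orbit isotropic. Angle adaptedness then forces ‖V‖ = 1 by a Gram
determinant, and elements of SU(n) carry the picture to all of Q. So Q is a compact special
Legendrian in the unit sphere (`isSpecialLegendrian_orbit`). That Q is a submanifold with tangent
space 𝔤 · V is proved by hand from compactness of G (`tangentConeAt_orbit_subset`,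
`exists_germ_orbit`).

The second ingredient is that γ^k γ' has constant phase for the line and for the Lawlor neck
(`IsProfileCurve`). Differentiating the ansatz, the last component contributes only conj(γ) γ' and
conj(ξ) ξ'. The mixed terms of the pulled-back Hermitian form cancel, which gives the Lagrangian
condition. The Liouville form has an explicit primitive, and the holomorphic volume is a real
multiple of (|γ|² + |ξ|²) γ^k γ' ξ^k ξ', whose phase is constant up to sign
(`isExactSpecialLagrangianMap_ansatz`). The map is an immersion wherever γ, γ', ξ, ξ' do not vanish.

Embeddedness is injectivity plus local properness (`isEmbedding_domRestrict_of_locally_proper`). For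
two necks the image point determines |γ| and |ξ|, hence |x| and |y|. As β is odd and strictly
increasing, the only possible coincidence flips both signs, with x and y on the same side of 0, and
rotates Q into itself by an angle of size less than 2π/n. If C_k has at most n elements, that angle
is zero (`eq_zero_of_exp_smul_mem_orbit`), which is a contradiction.

For a neck and a line, (p, x, y) and (-p, x, -y) have the same image, so off y = 0 the image is that
of (Q ∪ -Q) × I × (0, ∞), on which the map is an embedding. At y = 0 it collapses to a curve in {0}
× ℂ. For SO(n), Q lies in a rotated real sphere and u = y p is a smooth coordinate in ℝⁿ; in it the
map extends as an embedding across u = 0 (`sphereAnsatz`). -/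

/-! ### Germs of parametrisations, tangent cones and maps between submanifolds. -/

section SubmanifoldGerms

open Set Filter Topology

variable {E : Type*} [NormedAddCommGroup E] [NormedSpace ℝ E]
  {W : Type*} [NormedAddCommGroup W] [NormedSpace ℝ W]
  {E' : Type*} [NormedAddCommGroup E'] [NormedSpace ℝ E']

/-- The germ of `φ` at `u` is a smooth immersion that identifies a neighbourhood of `u` with a
neighbourhood of `φ u` in `M`. -/
structure IsGermParam (M : Set E) (φ : W → E) (u : W) : Prop where
  smooth : ∀ᶠ x in 𝓝 u, ContDiffAt ℝ ∞ φ x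
  immersive : Function.Injective (fderiv ℝ φ u)
  map_nhds : map φ (𝓝 u) = 𝓝[M] (φ u)

/-- A smooth immersion has a local left inverse that is smooth on the ambient space. -/
theorem exists_local_leftInverse [FiniteDimensional ℝ W] [FiniteDimensional ℝ E] {f : W → E}
    {u : W} (hf : ContDiffAt ℝ ∞ f u) (hinj : Function.Injective (fderiv ℝ f u)) :
    ∃ g : E → W, ContDiffAt ℝ ∞ g (f u) ∧ ∀ᶠ x in 𝓝 u, g (f x) = x := by
  -- With a linear left inverse P of the derivative, P ∘ f has derivative the identity, so the
  -- inverse function theorem applies inside W.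
  obtain ⟨P, hP⟩ := (fderiv ℝ f u).toLinearMap.exists_leftInverse_of_injective
    (LinearMap.ker_eq_bot.2 hinj)
  have hcomp : HasFDerivAt (fun x => LinearMap.toContinuousLinearMap P (f x))
      ((ContinuousLinearEquiv.refl ℝ W : W ≃L[ℝ] W) : W →L[ℝ] W) u := by
    have h := (LinearMap.toContinuousLinearMap P).hasFDerivAt.comp u
      (hf.differentiableAt (by simp)).hasFDerivAt
    have e : (LinearMap.toContinuousLinearMap P).comp (fderiv ℝ f u)
        = ((ContinuousLinearEquiv.refl ℝ W : W ≃L[ℝ] W) : W →L[ℝ] W) :=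
      ContinuousLinearMap.ext fun w => LinearMap.congr_fun hP w
    rwa [e] at h
  have hs : ContDiffAt ℝ ∞ (fun x => LinearMap.toContinuousLinearMap P (f x)) u :=
    (LinearMap.toContinuousLinearMap P).contDiff.contDiffAt.comp u hf
  have hn : (∞ : WithTop ℕ∞) ≠ 0 := by simp
  refine ⟨fun y => hs.localInverse hcomp hn (LinearMap.toContinuousLinearMap P y), ?_, ?_⟩
  · exact (hs.to_localInverse hcomp hn).comp (f u)
      (LinearMap.toContinuousLinearMap P).contDiff.contDiffAt
  · exact (hs.hasStrictFDerivAt' hcomp hn).eventually_left_inverse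

theorem IsGermParam.eventually_mem {M : Set E} {φ : W → E} {u : W} (h : IsGermParam M φ u) :
    ∀ᶠ x in 𝓝 u, φ x ∈ M := by
  have := h.map_nhds.le (self_mem_nhdsWithin (s := M) (a := φ u))
  exact this

theorem IsGermParam.contDiffAt {M : Set E} {φ : W → E} {u : W} (h : IsGermParam M φ u) :
    ContDiffAt ℝ ∞ φ u := h.smooth.self_of_nhds

theorem IsGermParam.hasFDerivAt {M : Set E} {φ : W → E} {u : W} (h : IsGermParam M φ u) :
    HasFDerivAt φ (fderiv ℝ φ u) u :=
  (h.contDiffAt.differentiableAt (by simp)).hasFDerivAt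

theorem IsLocalParam.isGermParam {d : ℕ} {M : Set E} {U : Set (EuclideanSpace ℝ (Fin d))}
    {φ : EuclideanSpace ℝ (Fin d) → E} (h : IsLocalParam d M U φ) {u} (hu : u ∈ U) :
    IsGermParam M φ u where
  smooth := by
    filter_upwards [h.isOpen_dom.mem_nhds hu] with x hx
    exact h.smooth.contDiffAt (h.isOpen_dom.mem_nhds hx)
  immersive := h.immersive u hu
  map_nhds := by
    obtain ⟨O, hO, hOM⟩ := h.isOpen_image
    have h1 := h.isEmbedding.map_nhds_eq ⟨u, hu⟩
    rw [Set.range_domRestrict, hOM] at h1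
    have h2 : map (U.domRestrict φ) (𝓝 ⟨u, hu⟩) = map φ (𝓝 u) := by
      have : U.domRestrict φ = φ ∘ Subtype.val := rfl
      rw [this, ← Filter.map_map, map_nhds_subtype_coe_eq_nhds hu (h.isOpen_dom.mem_nhds hu)]
    rw [← h2, h1]
    have : φ u ∈ O := (hOM ▸ mem_image_of_mem φ hu : φ u ∈ M ∩ O).2
    exact (nhdsWithin_inter_of_mem' (mem_nhdsWithin_of_mem_nhds (hO.mem_nhds this)))

/-- A smooth local left inverse g forces φ to be injective, immersive and inducing on a small
neighbourhood. The condition on neighbourhood filters supplies relative openness of the image. -/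
theorem IsGermParam.exists_isLocalParam [FiniteDimensional ℝ E] {d : ℕ} {M : Set E}
    {φ : EuclideanSpace ℝ (Fin d) → E} {u} (h : IsGermParam M φ u) :
    ∃ U, IsLocalParam d M U φ ∧ u ∈ U := by
  obtain ⟨g, hg, hgφ⟩ := exists_local_leftInverse h.contDiffAt h.immersive
  have hg1 : ∀ᶠ y in 𝓝 (φ u), ContDiffAt ℝ 1 g y :=
    (hg.of_le (by exact_mod_cast le_top)).eventually (by simp)
  have hev := ((h.smooth.and hgφ.eventually_nhds).and h.eventually_mem).and
    (h.contDiffAt.continuousAt.eventually hg1)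
  obtain ⟨U₀, hU₀, hU₀o, huU₀⟩ := eventually_nhds_iff.1 hev
  have himg : φ '' U₀ ∈ 𝓝[M] (φ u) := by
    rw [← h.map_nhds]; exact image_mem_map (hU₀o.mem_nhds huU₀)
  -- The image of U₀ is only known to contain M ∩ O near φ u; cutting U₀ down to the preimage of O
  -- makes the image equal to M ∩ O.
  obtain ⟨O, hO, huO, hOM⟩ := mem_nhdsWithin.1 himg
  have hcont : ContinuousOn φ U₀ := fun x hx => (hU₀ x hx).1.1.1.continuousAt.continuousWithinAt
  have hUo : IsOpen (U₀ ∩ φ ⁻¹' O) := hcont.isOpen_inter_preimage hU₀o hO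
  refine ⟨U₀ ∩ φ ⁻¹' O, ⟨hUo, fun x hx => (hU₀ x hx.1).1.1.1.contDiffWithinAt, ?_, ?_, O, hO, ?_⟩,
    huU₀, huO⟩
  · intro x hx
    obtain ⟨⟨⟨hφx, hgx⟩, -⟩, hgd⟩ := hU₀ x hx.1
    have h1 : HasFDerivAt (g ∘ φ) ((fderiv ℝ g (φ x)).comp (fderiv ℝ φ x)) x :=
      (hgd.differentiableAt (by simp)).hasFDerivAt.comp x
        (hφx.differentiableAt (by simp)).hasFDerivAt
    have h2 : HasFDerivAt (g ∘ φ) (ContinuousLinearMap.id ℝ _) x :=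
      (hasFDerivAt_id x).congr_of_eventuallyEq hgx
    have h3 := h1.unique h2
    exact Function.LeftInverse.injective (g := fderiv ℝ g (φ x))
      (fun v => by simpa using congrArg (fun L => L v) h3)
  · refine ⟨isInducing_iff_nhds.2 fun x => ?_, fun x y hxy => ?_⟩
    · refine le_antisymm ((continuousOn_iff_continuous_domRestrict.1
        (hcont.mono inter_subset_left)).tendsto x).le_comap ?_
      have h1 : Tendsto g (𝓝 (φ x)) (𝓝 x) := by
        have := (hU₀ x x.2.1).2.continuousAt.tendsto
        rwa [(hU₀ x x.2.1).1.1.2.self_of_nhds] at this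
      rw [nhds_subtype_eq_comap]
      refine (comap_mono h1.le_comap).trans ?_
      rw [comap_comap]
      refine le_of_eq (congrArg (fun F => comap F (𝓝 (x : EuclideanSpace ℝ (Fin d)))) ?_)
      funext y
      exact (hU₀ y y.2.1).1.1.2.self_of_nhds
    · have hx := (hU₀ x x.2.1).1.1.2.self_of_nhds
      have hy := (hU₀ y y.2.1).1.1.2.self_of_nhds
      have hxy' : φ x = φ y := hxy
      exact Subtype.ext (by rw [← hx, ← hy, hxy'])
  · ext y
    constructor
    · rintro ⟨x, hx, rfl⟩
      exact ⟨(hU₀ x hx.1).1.2, hx.2⟩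
    · rintro ⟨hyM, hyO⟩
      obtain ⟨x, hx, rfl⟩ := hOM ⟨hyO, hyM⟩
      exact ⟨x, ⟨hx, hyO⟩, rfl⟩

/-- The parameter space may be any space of the right dimension, such as a product or the tangent
space of an orbit. -/
theorem isSubmanifold_of_germs [FiniteDimensional ℝ E] [FiniteDimensional ℝ W] {d : ℕ}
    (hd : Module.finrank ℝ W = d) {M : Set E}
    (h : ∀ p ∈ M, ∃ (φ : W → E) (u : W), IsGermParam M φ u ∧ φ u = p) : IsSubmanifold d M := by
  intro p hp
  obtain ⟨φ, u, hφ, rfl⟩ := h p hp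
  let e : EuclideanSpace ℝ (Fin d) ≃L[ℝ] W := ContinuousLinearEquiv.ofFinrankEq (by simp [hd])
  have hg : IsGermParam M (φ ∘ e) (e.symm u) := by
    have hu : e (e.symm u) = u := e.apply_symm_apply u
    refine ⟨?_, ?_, ?_⟩
    · have := (e.continuous.continuousAt (x := e.symm u)).tendsto
      rw [hu] at this
      replace this := this.eventually hφ.smooth
      filter_upwards [this] with x hx
      exact hx.comp x e.contDiff.contDiffAt
    · rw [e.comp_right_fderiv, hu]
      exact hφ.immersive.comp e.injective
    · rw [← Filter.map_map]
      have : map e (𝓝 (e.symm u)) = 𝓝 u := by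
        rw [← hu]; simpa using e.toHomeomorph.map_nhds_eq (e.symm u)
      rw [this, hφ.map_nhds]; simp
  obtain ⟨U, hU, huU⟩ := hg.exists_isLocalParam
  exact ⟨U, φ ∘ e, hU, _, huU, by simp⟩

theorem IsSubmanifold.exists_germ {d : ℕ} {M : Set E} (h : IsSubmanifold d M) {p : E}
    (hp : p ∈ M) :
    ∃ (U : Set (EuclideanSpace ℝ (Fin d))) (φ : EuclideanSpace ℝ (Fin d) → E) (u : _),
      IsLocalParam d M U φ ∧ u ∈ U ∧ IsGermParam M φ u ∧ φ u = p := by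
  obtain ⟨U, φ, hφ, u, hu, rfl⟩ := h p hp
  exact ⟨U, φ, u, hφ, hu, hφ.isGermParam hu, rfl⟩

theorem IsSubmanifold.prod [FiniteDimensional ℝ E] [FiniteDimensional ℝ E'] {d d' : ℕ}
    {M : Set E} {M' : Set E'} (h : IsSubmanifold d M) (h' : IsSubmanifold d' M') :
    IsSubmanifold (d + d') (M ×ˢ M') := by
  refine isSubmanifold_of_germs (W := EuclideanSpace ℝ (Fin d) × EuclideanSpace ℝ (Fin d'))
    (by simp) ?_
  rintro ⟨p, p'⟩ ⟨hp, hp'⟩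
  obtain ⟨-, φ, u, -, -, hφ, rfl⟩ := h.exists_germ hp
  obtain ⟨-, φ', u', -, -, hφ', rfl⟩ := h'.exists_germ hp'
  refine ⟨Prod.map φ φ', (u, u'), ⟨?_, ?_, ?_⟩, rfl⟩
  · rw [nhds_prod_eq]
    filter_upwards [hφ.smooth.prod_mk hφ'.smooth] with x hx
    exact hx.1.prodMap' hx.2
  · have := (hφ.hasFDerivAt.prodMap (u, u') hφ'.hasFDerivAt).fderiv
    rw [this]
    exact hφ.immersive.prodMap hφ'.immersive
  · rw [nhds_prod_eq, ← Filter.prod_map_map_eq', hφ.map_nhds, hφ'.map_nhds]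
    exact (nhdsWithin_prod_eq _ _ _ _).symm

theorem IsOpen.isSubmanifold [FiniteDimensional ℝ E] {d : ℕ} (hd : Module.finrank ℝ E = d)
    {M : Set E} (hM : IsOpen M) : IsSubmanifold d M := by
  refine isSubmanifold_of_germs hd fun p hp => ⟨id, p, ⟨?_, ?_, ?_⟩, rfl⟩
  · exact Eventually.of_forall fun x => contDiff_id.contDiffAt
  · simp [Function.injective_id]
  · rw [Filter.map_id]; exact (hM.nhdsWithin_eq hp).symm

/-! ### Tangent cones -/

/-- Conditions quantified over all parametrisations reduce, through this inclusion, to conditions on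
tangent cone vectors. -/
theorem IsLocalParam.fderiv_mem_tangentConeAt {d : ℕ} {M : Set E}
    {U : Set (EuclideanSpace ℝ (Fin d))} {φ : EuclideanSpace ℝ (Fin d) → E}
    (h : IsLocalParam d M U φ) {u} (hu : u ∈ U) (v : EuclideanSpace ℝ (Fin d)) :
    fderiv ℝ φ u v ∈ tangentConeAt ℝ M (φ u) := by
  have h1 := ((h.isGermParam hu).hasFDerivAt.hasFDerivWithinAt (s := U)).mapsTo_tangent_cone
  obtain ⟨O, -, hO⟩ := h.isOpen_image
  refine tangentConeAt_mono (hO ▸ inter_subset_left) (h1 ?_)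
  rw [tangentConeAt_of_mem_nhds (h.isOpen_dom.mem_nhds hu)]
  trivial

/-- On M near φ u the map φ ∘ g is the identity, and derivatives within M are unique along tangent
directions. Hence every tangent cone vector is hit by the derivative of φ. -/
theorem IsGermParam.exists_leftInverse [FiniteDimensional ℝ W] [FiniteDimensional ℝ E]
    {M : Set E} {φ : W → E} {u : W} (h : IsGermParam M φ u) :
    ∃ g : E → W, ContDiffAt ℝ ∞ g (φ u) ∧ g (φ u) = u ∧ (∀ᶠ x in 𝓝 u, g (φ x) = x) ∧
      (∀ᶠ y in 𝓝[M] (φ u), φ (g y) = y) ∧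
      (∀ v ∈ tangentConeAt ℝ M (φ u), fderiv ℝ φ u (fderiv ℝ g (φ u) v) = v) := by
  obtain ⟨g, hg, hgφ⟩ := exists_local_leftInverse h.contDiffAt h.immersive
  have h2 : ∀ᶠ y in 𝓝[M] (φ u), φ (g y) = y := by
    rw [← h.map_nhds, eventually_map]
    filter_upwards [hgφ] with x hx
    rw [hx]
  have hgu : g (φ u) = u := hgφ.self_of_nhds
  refine ⟨g, hg, hgu, hgφ, h2, fun v hv => ?_⟩
  have hφ' : HasFDerivAt φ (fderiv ℝ φ u) (g (φ u)) := by rw [hgu]; exact h.hasFDerivAt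
  have e1 : HasFDerivWithinAt (φ ∘ g) ((fderiv ℝ φ u).comp (fderiv ℝ g (φ u))) M (φ u) :=
    (hφ'.comp (φ u) (hg.differentiableAt (by simp)).hasFDerivAt).hasFDerivWithinAt
  have e2 : HasFDerivWithinAt (φ ∘ g) (ContinuousLinearMap.id ℝ E) M (φ u) :=
    (hasFDerivWithinAt_id (φ u) M).congr_of_eventuallyEq h2 (by simp [hgu])
  exact e1.unique_on e2 hv

theorem tangentConeAt_prod_subset {M : Set E} {M' : Set E'} {p : E × E'} {v : E × E'}
    (hv : v ∈ tangentConeAt ℝ (M ×ˢ M') p) :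
    v.1 ∈ tangentConeAt ℝ M p.1 ∧ v.2 ∈ tangentConeAt ℝ M' p.2 :=
  ⟨tangentConeAt_mono (fst_image_prod_subset M M')
    ((hasFDerivWithinAt_fst (𝕜 := ℝ) (s := M ×ˢ M') (p := p)).mapsTo_tangent_cone hv),
   tangentConeAt_mono (snd_image_prod_subset M M')
    ((hasFDerivWithinAt_snd (𝕜 := ℝ) (s := M ×ˢ M') (p := p)).mapsTo_tangent_cone hv)⟩

/-! ### Maps between submanifolds -/

theorem SmoothOnSubmanifold.of_contDiffOn {d : ℕ} {M : Set E} {f : E → E'}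
    (hf : ContDiffOn ℝ ∞ f M) : SmoothOnSubmanifold d M f := by
  intro U φ h
  obtain ⟨O, -, hO⟩ := h.isOpen_image
  exact hf.comp h.smooth fun u hu => (hO ▸ mem_image_of_mem φ hu : φ u ∈ M ∩ O).1

theorem IsLocalParam.mem {d : ℕ} {M : Set E}
    {U : Set (EuclideanSpace ℝ (Fin d))} {φ : EuclideanSpace ℝ (Fin d) → E}
    (h : IsLocalParam d M U φ) {u} (hu : u ∈ U) : φ u ∈ M := by
  obtain ⟨O, -, hO⟩ := h.isOpen_image
  exact (hO ▸ mem_image_of_mem φ hu : φ u ∈ M ∩ O).1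

theorem IsLocalParam.fderiv_comp {d : ℕ} {M : Set E}
    {U : Set (EuclideanSpace ℝ (Fin d))} {φ : EuclideanSpace ℝ (Fin d) → E}
    (h : IsLocalParam d M U φ) {u} (hu : u ∈ U) {f : E → E'} {f' : E →L[ℝ] E'}
    (hf : HasFDerivWithinAt f f' M (φ u)) :
    fderiv ℝ (f ∘ φ) u = f'.comp (fderiv ℝ φ u) := by
  have h1 : HasFDerivWithinAt (f ∘ φ) (f'.comp (fderiv ℝ φ u)) U u :=
    hf.comp u (h.isGermParam hu).hasFDerivAt.hasFDerivWithinAt fun x hx => h.mem hx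
  exact (h1.hasFDerivAt (h.isOpen_dom.mem_nhds hu)).fderiv

theorem IsImmersionOn.of_tangent {d : ℕ} {M : Set E} (hM : IsSubmanifold d M) {f : E → E'}
    (hf : ContDiffOn ℝ ∞ f M) {f' : E → E →L[ℝ] E'}
    (hf' : ∀ p ∈ M, HasFDerivWithinAt f (f' p) M p)
    (hinj : ∀ p ∈ M, ∀ v w, v ∈ tangentConeAt ℝ M p → w ∈ tangentConeAt ℝ M p →
      f' p v = f' p w → v = w) : IsImmersionOn d M f where
  submanifold := hM
  smooth := .of_contDiffOn hf
  immersive := by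
    intro U φ h u hu v w hvw
    rw [h.fderiv_comp hu (hf' _ (h.mem hu))] at hvw
    exact h.immersive u hu (hinj _ (h.mem hu) _ _ (h.fderiv_mem_tangentConeAt hu v)
      (h.fderiv_mem_tangentConeAt hu w) hvw)

/-- By the chain rule, the derivative of f ∘ φ is the derivative of f within M applied to tangent
cone vectors, so pointwise checks there suffice. -/
theorem IsExactSpecialLagrangianMap.of_tangent {d : ℕ} {M : Set E} (hM : IsSubmanifold d M)
    {f : E → CSpace d} (hf : ContDiffOn ℝ ∞ f M) {f' : E → E →L[ℝ] CSpace d}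
    (hf' : ∀ p ∈ M, HasFDerivWithinAt f (f' p) M p)
    {h : E → ℝ} (hh : ContDiffOn ℝ ∞ h M) {h' : E → E →L[ℝ] ℝ}
    (hh' : ∀ p ∈ M, HasFDerivWithinAt h (h' p) M p)
    (lagrangian : ∀ p ∈ M, ∀ v w, v ∈ tangentConeAt ℝ M p → w ∈ tangentConeAt ℝ M p →
      kahlerForm (f' p v) (f' p w) = 0)
    (exact : ∀ p ∈ M, ∀ v ∈ tangentConeAt ℝ M p, h' p v = liouvilleForm (f p) (f' p v))
    (θ : ℝ) (special : ∀ p ∈ M, ∀ v : Fin d → E, (∀ j, v j ∈ tangentConeAt ℝ M p) →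
      (Complex.exp (-(θ : ℂ) * Complex.I) * holVolForm fun j => f' p (v j)).im = 0) :
    IsExactSpecialLagrangianMap M f where
  submanifold := hM
  smooth := .of_contDiffOn hf
  lagrangian := by
    intro U φ hφ u hu v w
    rw [hφ.fderiv_comp hu (hf' _ (hφ.mem hu))]
    exact lagrangian _ (hφ.mem hu) _ _ (hφ.fderiv_mem_tangentConeAt hu v)
      (hφ.fderiv_mem_tangentConeAt hu w)
  exact := by
    refine ⟨h, .of_contDiffOn hh, fun U φ hφ u hu v => ?_⟩
    rw [hφ.fderiv_comp hu (hf' _ (hφ.mem hu)), hφ.fderiv_comp hu (hh' _ (hφ.mem hu))]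
    exact exact _ (hφ.mem hu) _ (hφ.fderiv_mem_tangentConeAt hu v)
  special := by
    refine ⟨θ, fun U φ hφ u hu v => ?_⟩
    rw [hφ.fderiv_comp hu (hf' _ (hφ.mem hu))]
    exact special _ (hφ.mem hu) _ fun j => hφ.fderiv_mem_tangentConeAt hu (v j)

/-- A param of `M` composed with an embedding that is an immersion. -/
theorem IsImmersionOn.isGermParam_comp {d : ℕ} {M : Set E} {f : E → E'}
    (hf : IsImmersionOn d M f) (he : IsEmbedding (M.domRestrict f))
    {U : Set (EuclideanSpace ℝ (Fin d))} {φ : EuclideanSpace ℝ (Fin d) → E}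
    (h : IsLocalParam d M U φ) {u} (hu : u ∈ U) : IsGermParam (f '' M) (f ∘ φ) u where
  smooth := by
    filter_upwards [h.isOpen_dom.mem_nhds hu] with x hx
    exact (hf.smooth U φ h).contDiffAt (h.isOpen_dom.mem_nhds hx)
  immersive := hf.immersive U φ h u hu
  map_nhds := by
    have h1 := he.map_nhds_eq ⟨φ u, h.mem hu⟩
    have h2 : map (M.domRestrict f) (𝓝 ⟨φ u, h.mem hu⟩) = map f (𝓝[M] (φ u)) := by
      have : M.domRestrict f = f ∘ Subtype.val := rfl
      rw [this, ← Filter.map_map, map_nhds_subtype_val]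
    rw [← Filter.map_map, (h.isGermParam hu).map_nhds, ← h2, h1, Set.range_domRestrict]
    rfl

theorem IsSmoothEmbeddingOn.isSubmanifold_image [FiniteDimensional ℝ E'] {d : ℕ} {M : Set E}
    {f : E → E'} (hf : IsSmoothEmbeddingOn d M f) : IsSubmanifold d (f '' M) := by
  refine isSubmanifold_of_germs (W := EuclideanSpace ℝ (Fin d)) (by simp) ?_
  rintro _ ⟨p, hp, rfl⟩
  obtain ⟨U, φ, u, hU, hu, -, rfl⟩ := hf.1.submanifold.exists_germ hp
  exact ⟨f ∘ φ, u, hf.1.isGermParam_comp hf.2 hU hu, rfl⟩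

/-- The potential on the image is h ∘ f⁻¹. Its smoothness, like the transfer of the other
conditions, comes from an ambient smooth left inverse of f ∘ φ. -/
theorem IsExactSpecialLagrangianMap.image {d : ℕ} {M : Set E} {f : E → CSpace d}
    (hf : IsExactSpecialLagrangianMap M f) (he : IsSmoothEmbeddingOn d M f) :
    IsEmbeddedExactSpecialLagrangian (f '' M) := by
  classical
  obtain ⟨h, hh, hexact⟩ := hf.exact
  obtain ⟨θ, hθ⟩ := hf.special
  have hinj : InjOn f M := injOn_iff_injective.2 he.2.injective
  have hinv : ∀ p ∈ M, Function.invFunOn f M (f p) = p := fun p hp => hinj.leftInvOn_invFunOn hp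
  -- Local data at q: a parametrisation φ of M, an ambient left inverse g of f ∘ φ, the local form
  -- (h ∘ φ) ∘ g of the potential, and a lift of every tangent vector at q.
  have key : ∀ q ∈ f '' M, ∃ (U : Set (EuclideanSpace ℝ (Fin d)))
      (φ : EuclideanSpace ℝ (Fin d) → E) (u : _) (g : CSpace d → EuclideanSpace ℝ (Fin d)),
      IsLocalParam d M U φ ∧ u ∈ U ∧ f (φ u) = q ∧ ContDiffAt ℝ ∞ g q ∧ g q = u ∧
      (h ∘ Function.invFunOn f M) =ᶠ[𝓝[f '' M] q] ((h ∘ φ) ∘ g) ∧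
      (∀ v ∈ tangentConeAt ℝ (f '' M) q, fderiv ℝ (f ∘ φ) u (fderiv ℝ g q v) = v) := by
    rintro _ ⟨p, hp, rfl⟩
    obtain ⟨U, φ, u, hU, hu, -, rfl⟩ := he.1.submanifold.exists_germ hp
    have hgerm := he.1.isGermParam_comp he.2 hU hu
    obtain ⟨g, hg, hgu, -, hfg, htan⟩ := hgerm.exists_leftInverse
    refine ⟨U, φ, u, g, hU, hu, rfl, hg, hgu, ?_, htan⟩
    have hgU : ∀ᶠ y in 𝓝[f '' M] (f (φ u)), g y ∈ U :=
      (hg.continuousAt.eventually (by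
        rw [hgu]; exact hU.isOpen_dom.mem_nhds hu)).filter_mono
        nhdsWithin_le_nhds
    filter_upwards [hfg, hgU] with y hy hyU
    have : Function.invFunOn f M y = φ (g y) := by
      conv_lhs => rw [← hy]
      exact hinv _ (hU.mem hyU)
    simp [this]
  have hhφ : ∀ {U φ u}, IsLocalParam d M U φ → u ∈ U → ContDiffAt ℝ ∞ (h ∘ φ) u :=
    fun hU hu => (hh _ _ hU).contDiffAt (hU.isOpen_dom.mem_nhds hu)
  refine .of_tangent (f := id) (f' := fun _ => ContinuousLinearMap.id ℝ _)
    (h := h ∘ Function.invFunOn f M)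
    (h' := fun q => fderivWithin ℝ (h ∘ Function.invFunOn f M) (f '' M) q) he.isSubmanifold_image
    contDiff_id.contDiffOn (fun q hq => hasFDerivWithinAt_id q _) ?_ ?_ ?_ ?_ θ ?_
  · intro q hq
    obtain ⟨U, φ, u, g, hU, hu, rfl, hg, hgu, heq, -⟩ := key q hq
    have : ContDiffAt ℝ ∞ ((h ∘ φ) ∘ g) (f (φ u)) :=
      ContDiffAt.comp _ (by rw [hgu]; exact hhφ hU hu) hg
    exact this.contDiffWithinAt.congr_of_eventuallyEq heq (heq.self_of_nhdsWithin hq)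
  · intro q hq
    obtain ⟨U, φ, u, g, hU, hu, rfl, hg, hgu, heq, -⟩ := key q hq
    have : ContDiffAt ℝ ∞ ((h ∘ φ) ∘ g) (f (φ u)) :=
      ContDiffAt.comp _ (by rw [hgu]; exact hhφ hU hu) hg
    exact ((this.differentiableAt (by simp)).differentiableWithinAt.congr_of_eventuallyEq heq
      (heq.self_of_nhdsWithin hq)).hasFDerivWithinAt
  · intro q hq v w hv hw
    obtain ⟨U, φ, u, g, hU, hu, rfl, hg, hgu, heq, htan⟩ := key q hq
    have := hf.lagrangian U φ hU u hu (fderiv ℝ g (f (φ u)) v) (fderiv ℝ g (f (φ u)) w)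
    rw [htan v hv, htan w hw] at this
    exact this
  · intro q hq v hv
    obtain ⟨U, φ, u, g, hU, hu, rfl, hg, hgu, heq, htan⟩ := key q hq
    have hc : ContDiffAt ℝ ∞ (h ∘ φ) (g (f (φ u))) := by rw [hgu]; exact hhφ hU hu
    have h1 : HasFDerivAt ((h ∘ φ) ∘ g)
        ((fderiv ℝ (h ∘ φ) (g (f (φ u)))).comp (fderiv ℝ g (f (φ u)))) (f (φ u)) :=
      (hc.differentiableAt (by simp)).hasFDerivAt.comp _
        (hg.differentiableAt (by simp)).hasFDerivAt
    have h2 := (h1.hasFDerivWithinAt (s := f '' M)).congr_of_eventuallyEq heq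
      (heq.self_of_nhdsWithin hq)
    rw [h2.differentiableWithinAt.hasFDerivWithinAt.unique_on h2 hv, hgu]
    have := hexact U φ hU u hu (fderiv ℝ g (f (φ u)) v)
    rw [htan v hv] at this
    exact this
  · intro q hq v hv
    obtain ⟨U, φ, u, g, hU, hu, rfl, hg, hgu, heq, htan⟩ := key q hq
    have := hθ U φ hU u hu fun j => fderiv ℝ g (f (φ u)) (v j)
    simp only [fun j => htan _ (hv j)] at this
    exact this

/-- A continuous injective map that is locally proper onto its image is an embedding. -/
theorem isEmbedding_domRestrict_of_locally_proper {X Y : Type*} [TopologicalSpace X]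
    [TopologicalSpace Y] [T2Space Y] {M : Set X} {f : X → Y} (hf : ContinuousOn f M)
    (hinj : InjOn f M)
    (h : ∀ p ∈ M, ∃ V ∈ 𝓝 (f p), ∃ C ⊆ M, IsCompact C ∧ ∀ q ∈ M, f q ∈ V → q ∈ C) :
    IsEmbedding (M.domRestrict f) := by
  refine ⟨isInducing_iff_nhds.2 fun p => ?_, injOn_iff_injective.1 hinj⟩
  refine le_antisymm ((continuousOn_iff_continuous_domRestrict.1 hf).tendsto p).le_comap ?_
  obtain ⟨V, hV, C, hCM, hC, hVC⟩ := h p p.2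
  intro N hN
  rw [nhds_subtype_eq_comap] at hN
  obtain ⟨N', hN', hN'N⟩ := hN
  obtain ⟨O, hON', hO, hpO⟩ := mem_nhds_iff.1 hN'
  -- Points of M outside O whose image lies in V have their image in this closed set, which misses f
  -- p by injectivity.
  have hK : IsClosed (f '' (C \ O)) :=
    ((hC.diff hO).image_of_continuousOn (hf.mono (sdiff_subset.trans hCM))).isClosed
  have hp : f p ∉ f '' (C \ O) := by
    rintro ⟨q, hq, hqp⟩
    exact hq.2 (hinj (hCM hq.1) p.2 hqp ▸ hpO)
  refine ⟨V ∩ (f '' (C \ O))ᶜ, inter_mem hV (hK.isOpen_compl.mem_nhds hp), fun q hq => hN'N ?_⟩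
  refine hON' (by_contra fun hqO => hq.2 ⟨q, ⟨hVC q q.2 hq.1, hqO⟩, rfl⟩)

end SubmanifoldGerms

/-! ### The Lie algebra of a compact group and the tangent cone of an orbit. -/

section MatrixGroups

open Set Filter Topology

open scoped Matrix.Norms.L2Operator

noncomputable section

variable {n : ℕ}

/-- Complex matrices. -/
local notation "𝕄" n => Matrix (Fin n) (Fin n) ℂ

/-- Matrices acting on `ℂ^n`, as a continuous bilinear map. -/
def matActL (n : ℕ) : (𝕄 n) →L[ℝ] CSpace n →L[ℝ] CSpace n :=
  LinearMap.toContinuousLinearMap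
    { toFun := fun A => (Matrix.toEuclideanCLM (n := Fin n) (𝕜 := ℂ) A).restrictScalars ℝ
      map_add' := fun A B => by ext; simp
      map_smul' := fun c A => by
        ext x i
        have : c • A = (c : ℂ) • A := by ext; simp
        rw [this, map_smul]
        simp }

theorem matActL_apply (A : 𝕄 n) (z : CSpace n) :
    matActL n A z = WithLp.toLp 2 (Matrix.mulVec A z) := rfl

theorem act_eq_matActL (g : SUGroup n) (z : CSpace n) : act g z = matActL n g z := rfl

attribute [irreducible] matActL

theorem matActL_one (z : CSpace n) : matActL n 1 z = z := by
  ext i; simp [matActL_apply]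

theorem matActL_mul (A B : 𝕄 n) (z : CSpace n) :
    matActL n (A * B) z = matActL n A (matActL n B z) := by
  ext i; simp [matActL_apply, Matrix.mulVec_mulVec]

theorem norm_su_le (g : SUGroup n) : ‖(g : 𝕄 n)‖ ≤ 1 := by
  rcases subsingleton_or_nontrivial (𝕄 n) with h | h
  · rw [Subsingleton.elim (g : 𝕄 n) 0, norm_zero]; exact zero_le_one
  · exact (CStarRing.norm_of_mem_unitary g.2.1).le

theorem act_inv_act' (g : SUGroup n) (z : CSpace n) : act g (act g⁻¹ z) = z := by
  rw [← act_mul, mul_inv_cancel, act_one]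

/-- The generators of one-parameter subgroups of `G`. -/
def lieGen (G : Subgroup (SUGroup n)) : Set (𝕄 n) :=
  {X | ∀ t : ℝ, ∃ g ∈ G, (g : 𝕄 n) = NormedSpace.exp (t • X)}

/-- Telescoping: a is a contraction, so only the powers of b need a bound. It compares powers of a
group element near 1 with powers of an exponential. -/
theorem norm_pow_sub_pow_le {A : Type*} [NormedRing A] {a b : A} {C : ℝ}
    (ha : ‖a‖ ≤ 1) (N : ℕ) (hb : ∀ i ≤ N, ‖b ^ i‖ ≤ C) :
    ‖a ^ N - b ^ N‖ ≤ N * (‖a - b‖ * C) := by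
  induction N with
  | zero => simp
  | succ N ih =>
    have h1 := ih fun i hi => hb i (hi.trans N.le_succ)
    have h2 : a ^ (N + 1) - b ^ (N + 1) = a * (a ^ N - b ^ N) + (a - b) * b ^ N := by
      rw [pow_succ', pow_succ']; noncomm_ring
    have h3 := hb N N.le_succ
    calc ‖a ^ (N + 1) - b ^ (N + 1)‖ ≤ ‖a‖ * ‖a ^ N - b ^ N‖ + ‖a - b‖ * ‖b ^ N‖ := by
          rw [h2]; exact (norm_add_le _ _).trans (add_le_add (norm_mul_le _ _) (norm_mul_le _ _))
      _ ≤ 1 * (N * (‖a - b‖ * C)) + ‖a - b‖ * C := by gcongr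
      _ = _ := by push_cast; ring

theorem tendsto_inv_smul_exp_sub_one (A : 𝕄 n) {ι : Type*} {l : Filter ι} {m : ι → ℝ}
    (hm : Tendsto m l (𝓝 0)) (hm0 : ∀ᶠ j in l, m j ≠ 0) :
    Tendsto (fun j => (m j)⁻¹ • (NormedSpace.exp (m j • A) - 1)) l (𝓝 A) := by
  have h := (hasDerivAt_exp_smul_const A (0 : ℝ)).tendsto_slope_zero
  simp only [zero_add, zero_smul, NormedSpace.exp_zero, one_mul] at h
  exact h.comp (tendsto_nhdsWithin_iff.2 ⟨hm, hm0⟩)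

/-- Von Neumann's closed subgroup argument: if g_j is 1 + m_j A up to o(m_j), then g_j to the power
⌊t / m_j⌋ converges to exp(tA), and the limit stays in the compact group. -/
theorem mem_lieGen_of_tendsto {G : Subgroup (SUGroup n)} (hG : IsCompact (G : Set (SUGroup n)))
    {g : ℕ → SUGroup n} (hg : ∀ j, g j ∈ G) {m : ℕ → ℝ} (hm : Tendsto m atTop (𝓝 0))
    (hm0 : ∀ j, 0 < m j) {A : 𝕄 n}
    (hA : Tendsto (fun j => (m j)⁻¹ • ((g j : 𝕄 n) - 1)) atTop (𝓝 A)) : A ∈ lieGen G := by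
  have pos : ∀ t : ℝ, 0 ≤ t → ∃ g ∈ G, (g : 𝕄 n) = NormedSpace.exp (t • A) := by
    intro t ht
    let N : ℕ → ℕ := fun j => ⌊t / m j⌋₊
    have hN1 : ∀ j, N j * m j ≤ t := fun j => by
      have := Nat.floor_le (div_nonneg ht (hm0 j).le)
      rwa [le_div_iff₀ (hm0 j)] at this
    have hN2 : ∀ j, t - m j ≤ N j * m j := fun j => by
      have := (Nat.lt_floor_add_one (t / m j)).le
      rw [div_le_iff₀ (hm0 j)] at this
      linarith
    have hNt : Tendsto (fun j => (N j : ℝ) * m j) atTop (𝓝 t) :=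
      tendsto_of_tendsto_of_tendsto_of_le_of_le (by simpa using tendsto_const_nhds.sub hm)
        tendsto_const_nhds hN2 hN1
    let b : ℕ → 𝕄 n := fun j => NormedSpace.exp (m j • A)
    have hbpow : ∀ (j i : ℕ), b j ^ i = NormedSpace.exp (((i : ℝ) * m j) • A) := fun j i => by
      rw [← Matrix.exp_nsmul, mul_smul, Nat.cast_smul_eq_nsmul]
    have hc : Continuous fun s : ℝ => NormedSpace.exp (s • A) :=
      continuous_iff_continuousAt.2 fun s => (hasDerivAt_exp_smul_const A s).continuousAt
    have hb : Tendsto (fun j => b j ^ N j) atTop (𝓝 (NormedSpace.exp (t • A))) := by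
      simp only [hbpow]
      exact (hc.tendsto t).comp hNt
    obtain ⟨C, hC⟩ := isCompact_Icc.exists_bound_of_continuousOn (hc.continuousOn (s := Icc 0 t))
    have hbd : ∀ (j : ℕ), ∀ i ≤ N j, ‖b j ^ i‖ ≤ C := fun j i hi => by
      rw [hbpow]
      refine hC _ ⟨mul_nonneg i.cast_nonneg (hm0 j).le, le_trans ?_ (hN1 j)⟩
      have := (hm0 j).le
      gcongr
    have hC0 : 0 ≤ C := (norm_nonneg _).trans (hbd 0 0 (Nat.zero_le _))
    -- The error is at most N_j ‖g_j - b_j‖ C, and N_j ≤ t / m_j turns this into t C times a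
    -- difference quotient that tends to zero.
    have hdiff : Tendsto (fun j => (g j : 𝕄 n) ^ N j - b j ^ N j) atTop (𝓝 0) := by
      have h0 : Tendsto (fun j => (m j)⁻¹ • ((g j : 𝕄 n) - b j)) atTop (𝓝 0) := by
        have := hA.sub (tendsto_inv_smul_exp_sub_one A hm (.of_forall fun j => (hm0 j).ne'))
        rw [sub_self] at this
        refine this.congr fun j => ?_
        rw [← smul_sub]; congr 1; abel
      refine squeeze_zero_norm (a := fun j => t * (‖(m j)⁻¹ • ((g j : 𝕄 n) - b j)‖ *
        C)) (fun j => ?_) ?_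
      · refine (norm_pow_sub_pow_le (norm_su_le (g j)) (N j) (hbd j)).trans ?_
        rw [norm_smul, norm_inv, Real.norm_of_nonneg (hm0 j).le, mul_assoc, ← mul_assoc t,
          ← div_eq_mul_inv]
        gcongr
        exact Nat.floor_le (div_nonneg ht (hm0 j).le)
      · have := (h0.norm.mul_const C).const_mul t
        simpa using this
    have hlim : Tendsto (fun j => ((g j ^ N j : SUGroup n) : 𝕄 n)) atTop
        (𝓝 (NormedSpace.exp (t • A))) := by
      have := hdiff.add hb
      simpa using this
    have hcl : IsClosed ((fun g : SUGroup n => (g : 𝕄 n)) '' (G : Set (SUGroup n))) :=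
      (hG.image continuous_subtype_val).isClosed
    obtain ⟨x, hx, hx'⟩ := hcl.mem_of_tendsto hlim
      (.of_forall fun j => ⟨g j ^ N j, G.pow_mem (hg j) _, rfl⟩)
    exact ⟨x, hx, hx'⟩
  intro t
  rcases le_total 0 t with ht | ht
  · exact pos t ht
  · obtain ⟨x, hx, hx'⟩ := pos (-t) (by linarith)
    refine ⟨x⁻¹, G.inv_mem hx, ?_⟩
    have h1 : ((x⁻¹ : SUGroup n) : 𝕄 n) * (x : 𝕄 n) = 1 := by
      rw [← Submonoid.coe_mul, inv_mul_cancel, Submonoid.coe_one]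
    have h2 : (x : 𝕄 n) * NormedSpace.exp (t • A) = 1 := by
      rw [hx', ← Matrix.exp_add_of_commute _ _ (((Commute.refl A).smul_left _).smul_right _), ← add_smul]
      simp
    calc ((x⁻¹ : SUGroup n) : 𝕄 n) = (x⁻¹ : SUGroup n) * ((x : 𝕄 n) * NormedSpace.exp (t • A)) := by
          rw [h2, mul_one]
      _ = _ := by rw [← mul_assoc, h1, one_mul]

theorem smul_mem_lieGen {G : Subgroup (SUGroup n)} {X : 𝕄 n} (hX : X ∈ lieGen G) (c : ℝ) :
    c • X ∈ lieGen G := fun t => by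
  rw [smul_smul]; exact hX (t * c)

/-- The product exp(mX) exp(mY) lies in G and has derivative X + Y at m = 0. -/
theorem add_mem_lieGen {G : Subgroup (SUGroup n)} (hG : IsCompact (G : Set (SUGroup n)))
    {X Y : 𝕄 n} (hX : X ∈ lieGen G) (hY : Y ∈ lieGen G) : X + Y ∈ lieGen G := by
  choose gX hgX hgX' using hX
  choose gY hgY hgY' using hY
  let m : ℕ → ℝ := fun j => 1 / ((j : ℝ) + 1)
  have hm0 : ∀ j, 0 < m j := fun j => by positivity
  have hm : Tendsto m atTop (𝓝 0) := tendsto_one_div_add_atTop_nhds_zero_nat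
  refine mem_lieGen_of_tendsto hG (g := fun j => gX (m j) * gY (m j))
    (fun j => G.mul_mem (hgX _) (hgY _)) hm hm0 ?_
  have h := ((hasDerivAt_exp_smul_const X (0 : ℝ)).mul
    (hasDerivAt_exp_smul_const Y (0 : ℝ))).tendsto_slope_zero
  simp only [zero_add, zero_smul, NormedSpace.exp_zero, one_mul, mul_one, Pi.mul_apply] at h
  refine (h.comp (tendsto_nhdsWithin_iff.2 ⟨hm, .of_forall fun j => (hm0 j).ne'⟩)).congr fun j => ?_
  simp [hgX', hgY']

theorem mem_lieAlg_iff {G : Subgroup (SUGroup n)} (hG : IsCompact (G : Set (SUGroup n)))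
    {X : 𝕄 n} : X ∈ lieAlg G ↔ X ∈ lieGen G := by
  refine ⟨fun h => ?_, fun h => Submodule.subset_span h⟩
  refine Submodule.span_induction (fun x hx => hx) (fun t => ⟨1, G.one_mem, by simp⟩)
    (fun x y _ _ hx hy => add_mem_lieGen hG hx hy) (fun c x _ hx => smul_mem_lieGen hx c) h

theorem mem_orbitTangent_iff {G : Subgroup (SUGroup n)} (hG : IsCompact (G : Set (SUGroup n)))
    {z v : CSpace n} : v ∈ orbitTangent G z ↔ ∃ X ∈ lieGen G, v = matActL n X z := by
  constructor
  · intro h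
    refine Submodule.span_induction ?_ ?_ ?_ ?_ h
    · rintro _ ⟨X, hX, rfl⟩
      exact ⟨X, (mem_lieAlg_iff hG).1 hX, (matActL_apply X z).symm⟩
    · exact ⟨0, (mem_lieAlg_iff hG).1 (zero_mem _), by simp⟩
    · rintro _ _ _ _ ⟨X, hX, rfl⟩ ⟨Y, hY, rfl⟩
      exact ⟨X + Y, add_mem_lieGen hG hX hY, by simp⟩
    · rintro c _ _ ⟨X, hX, rfl⟩
      exact ⟨c • X, smul_mem_lieGen hX c, by simp⟩
  · rintro ⟨X, hX, rfl⟩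
    exact Submodule.subset_span ⟨X, (mem_lieAlg_iff hG).2 hX, matActL_apply X z⟩

theorem matActL_exp_eq_self {A : 𝕄 n} {z : CSpace n} (h : matActL n A z = 0) (t : ℝ) :
    matActL n (NormedSpace.exp (t • A)) z = z := by
  have hd : ∀ s : ℝ, HasDerivAt (fun s : ℝ => matActL n (NormedSpace.exp (s • A)) z) 0 s := by
    intro s
    have := (((matActL n).flip z).hasFDerivAt).comp_hasDerivAt s (hasDerivAt_exp_smul_const A s)
    simpa [Function.comp_def, matActL_mul, h] using this
  have := is_const_of_deriv_eq_zero (fun s => (hd s).differentiableAt) (fun s => (hd s).deriv) t 0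
  simpa [matActL_one] using this

theorem continuous_matActL_left (z : CSpace n) : Continuous fun A : 𝕄 n => matActL n A z := by
  fun_prop

theorem continuous_act_left (z : CSpace n) : Continuous fun g : SUGroup n => act g z := by
  simpa only [act_eq_matActL, Function.comp_def] using (continuous_matActL_left z).comp continuous_subtype_val

/-- Here m_j bounds from below the distance to 1 of the elements that move z to z + d_j. Since (g_j
- 1) / m_j tends to A, d_j / m_j tends to A z. If A z ≠ 0, the directions d_j align with A z; the
case A z = 0 contradicts the lower bound. -/
theorem mem_orbitTangent_of_tendsto {G : Subgroup (SUGroup n)}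
    (hG : IsCompact (G : Set (SUGroup n))) {z v : CSpace n} {g : ℕ → SUGroup n} {m c : ℕ → ℝ}
    {d : ℕ → CSpace n} {A : 𝕄 n} (hgG : ∀ j, g j ∈ G) (hgz : ∀ j, act (g j) z = z + d j)
    (hgm : ∀ j, ∀ g' ∈ G, act g' z = z + d j → m j ≤ ‖(g' : 𝕄 n) - 1‖) (hm0 : ∀ j, 0 < m j)
    (hm : Tendsto m atTop (𝓝 0))
    (hA : Tendsto (fun j => (m j)⁻¹ • ((g j : 𝕄 n) - 1)) atTop (𝓝 A))
    (hcd : Tendsto (fun j => c j • d j) atTop (𝓝 v)) : v ∈ orbitTangent G z := by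
  have hAG : A ∈ lieGen G := mem_lieGen_of_tendsto hG hgG hm hm0 hA
  have hw : Tendsto (fun j => matActL n ((m j)⁻¹ • ((g j : 𝕄 n) - 1)) z) atTop
      (𝓝 (matActL n A z)) := ((continuous_matActL_left z).tendsto A).comp hA
  have hwd : ∀ j, matActL n ((m j)⁻¹ • ((g j : 𝕄 n) - 1)) z = (m j)⁻¹ • d j := fun j => by
    have := hgz j
    rw [act_eq_matActL] at this
    simp [this, matActL_one]
  rcases eq_or_ne (matActL n A z) 0 with hAz | hAz
  -- If A kills z, then g_j exp(-m_j A) moves z in the same way as g_j but differs from 1 by o(m_j).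
  · exfalso
    have hexp : ∀ t : ℝ, ∃ k ∈ G, (k : 𝕄 n) = NormedSpace.exp (t • A) := hAG
    have hle : ∀ j, 1 ≤ ‖(m j)⁻¹ • ((g j : 𝕄 n) * NormedSpace.exp (m j • (-A)) - 1)‖ := by
      intro j
      obtain ⟨k, hk, hk'⟩ := hexp (-m j)
      have h1 := hgm j (g j * k) (G.mul_mem (hgG j) hk) (by
        rw [act_mul, act_eq_matActL k, hk', matActL_exp_eq_self hAz, hgz])
      rw [Submonoid.coe_mul, hk', neg_smul, ← smul_neg] at h1
      rw [norm_smul, norm_inv, Real.norm_of_nonneg (hm0 j).le, ← div_eq_inv_mul,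
        le_div_iff₀ (hm0 j), one_mul]
      exact h1
    have hm1 : ∀ᶠ j in atTop, m j ≠ 0 := .of_forall fun j => (hm0 j).ne'
    have he : Tendsto (fun j => NormedSpace.exp (m j • (-A))) atTop (𝓝 (1 : 𝕄 n)) := by
      have hcont : Continuous fun s : ℝ => NormedSpace.exp (s • (-A)) :=
        continuous_iff_continuousAt.2 fun s => (hasDerivAt_exp_smul_const (-A) s).continuousAt
      have := (hcont.tendsto 0).comp hm
      simpa [Function.comp_def] using this
    have hlim := ((hA.mul he).add (tendsto_inv_smul_exp_sub_one (-A) hm hm1)).norm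
    rw [mul_one, add_neg_cancel, norm_zero] at hlim
    refine absurd (ge_of_tendsto' hlim (b := 1) fun j => ?_) (by norm_num)
    refine (hle j).trans (le_of_eq (congrArg _ ?_))
    rw [smul_mul_assoc, ← smul_add]
    congr 1
    noncomm_ring
  · rw [mem_orbitTangent_iff hG]
    -- The coefficient of the projection of v to the line of A z: each c_j d_j is its own projection
    -- to the line of d_j / m_j, and one passes to the limit.
    refine ⟨(inner ℝ (matActL n A z) v / ‖matActL n A z‖ ^ 2) • A, smul_mem_lieGen hAG _, ?_⟩
    refine tendsto_nhds_unique hcd ?_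
    have h1 := ((hw.inner (𝕜 := ℝ) hcd).div (hw.norm.pow 2)
      (pow_ne_zero 2 (norm_ne_zero_iff.2 hAz))).smul hw
    rw [map_smul, smul_apply]
    refine h1.congr' ?_
    filter_upwards [hw.eventually_ne hAz] with j hj
    rw [hwd] at hj
    rw [Pi.div_apply, hwd]
    have hdj : d j ≠ 0 := fun h => hj (by rw [h, smul_zero])
    have hdn : ‖d j‖ ≠ 0 := norm_ne_zero_iff.2 hdj
    rw [inner_smul_left, inner_smul_right, real_inner_self_eq_norm_sq, norm_smul, smul_smul]
    congr 1
    have := (hm0 j).ne'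
    simp only [conj_trivial, norm_inv, Real.norm_eq_abs, mul_pow, inv_pow, sq_abs]
    field_simp

/-- Points z + d_j of the orbit are reached by elements of G closest to the identity, which exist by
compactness. The displacements from 1, normalised, subconverge to a direction A in the Lie algebra.
-/
theorem tangentConeAt_orbit_subset {G : Subgroup (SUGroup n)}
    (hG : IsCompact (G : Set (SUGroup n))) (z : CSpace n) :
    tangentConeAt ℝ (orbit G z) z ⊆ orbitTangent G z := by
  intro v hv
  rcases eq_or_ne v 0 with rfl | hv0
  · exact zero_mem _
  obtain ⟨c₀, d₀, hd₀, hds₀, hcd₀⟩ := mem_tangentConeAt_iff_exists_seq.1 hv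
  obtain ⟨J, hJ⟩ := eventually_atTop.1 (hds₀.and (hcd₀.eventually_ne hv0))
  -- choose the group elements closest to the identity
  have hmin : ∀ j, ∃ g ∈ G, act g z = z + d₀ (j + J) ∧
      ∀ g' ∈ G, act g' z = z + d₀ (j + J) → ‖(g : 𝕄 n) - 1‖ ≤ ‖(g' : 𝕄 n) - 1‖ := by
    intro j
    obtain ⟨g₀, hg₀, hg₀z⟩ := (hJ (j + J) (Nat.le_add_left _ _)).1
    have hK : IsCompact ((G : Set (SUGroup n)) ∩ {g | act g z = z + d₀ (j + J)}) :=
      hG.inter_right (isClosed_eq (continuous_act_left z) continuous_const)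
    obtain ⟨g, hg, hgm⟩ := hK.exists_isMinOn ⟨g₀, hg₀, hg₀z.symm⟩
      (f := fun g : SUGroup n => ‖(g : 𝕄 n) - 1‖)
      ((continuous_subtype_val.sub continuous_const).norm.continuousOn)
    exact ⟨g, hg.1, hg.2, fun g' h1 h2 => hgm ⟨h1, h2⟩⟩
  choose g₁ hg₁ hg₁z hg₁m using hmin
  obtain ⟨h, hhG, φ, hφ, hgh⟩ := hG.tendsto_subseq hg₁
  have hdJ : Tendsto (fun j => d₀ (φ j + J)) atTop (𝓝 0) :=
    (hd₀.comp (tendsto_add_atTop_nat J)).comp hφ.tendsto_atTop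
  have hhz : act h z = z := by
    refine tendsto_nhds_unique (((continuous_act_left z).tendsto h).comp hgh) ?_
    simpa [Function.comp_def, hg₁z] using hdJ.const_add z
  have hgh' : Tendsto (fun j => (g₁ (φ j) : 𝕄 n)) atTop (𝓝 (h : 𝕄 n)) :=
    (continuous_subtype_val.tendsto h).comp hgh
  -- The limit h fixes z, so g h⁻¹ competes with g and tends to 1; by minimality g is at least as
  -- close to 1.
  have hm₁ : Tendsto (fun j => ‖(g₁ (φ j) : 𝕄 n) - 1‖) atTop (𝓝 0) := by
    have h1 : Tendsto (fun j => ‖(g₁ (φ j) : 𝕄 n) * (h⁻¹ : SUGroup n) - 1‖) atTop (𝓝 0) := by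
      have := ((hgh'.mul_const ((h⁻¹ : SUGroup n) : 𝕄 n)).sub_const 1).norm
      rwa [← Submonoid.coe_mul, mul_inv_cancel, Submonoid.coe_one, sub_self, norm_zero] at this
    refine squeeze_zero (fun j => norm_nonneg _) (fun j => ?_) h1
    refine hg₁m (φ j) (g₁ (φ j) * h⁻¹) (G.mul_mem (hg₁ _) (G.inv_mem hhG)) ?_
    have : act h⁻¹ z = z := by conv_lhs => rw [← hhz, act_inv_act]
    rw [act_mul, this, hg₁z]
  have hpos : ∀ j, 0 < ‖(g₁ j : 𝕄 n) - 1‖ := by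
    intro j
    rw [norm_pos_iff]
    intro h0
    have h1 : act (g₁ j) z = z := by
      rw [act_eq_matActL, sub_eq_zero.1 h0, matActL_one]
    have h2 : d₀ (j + J) = 0 := by rw [hg₁z] at h1; simpa using h1
    exact (hJ (j + J) (Nat.le_add_left _ _)).2 (by rw [h2, smul_zero])
  -- pass to a convergent subsequence of directions
  obtain ⟨A, hA1, ψ, hψ, hA⟩ := (isCompact_sphere (0 : 𝕄 n) 1).tendsto_subseq
    (x := fun j => ‖(g₁ (φ j) : 𝕄 n) - 1‖⁻¹ • ((g₁ (φ j) : 𝕄 n) - 1)) (fun j => by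
      rw [mem_sphere_zero_iff_norm, norm_smul, norm_inv, norm_norm,
        inv_mul_cancel₀ (hpos _).ne'])
  exact mem_orbitTangent_of_tendsto hG (g := fun j => g₁ (φ (ψ j)))
    (m := fun j => ‖(g₁ (φ (ψ j)) : 𝕄 n) - 1‖) (c := fun j => c₀ (φ (ψ j) + J))
    (d := fun j => d₀ (φ (ψ j) + J)) (fun j => hg₁ _) (fun j => hg₁z _) (fun j => hg₁m _)
    (fun j => hpos _) (hm₁.comp hψ.tendsto_atTop) hA
    ((hcd₀.comp (tendsto_add_atTop_nat J)).comp (hφ.tendsto_atTop.comp hψ.tendsto_atTop))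

end

end MatrixGroups

/-! ### Orbits are compact submanifolds. -/

section Orbits

open Set Filter Topology

open scoped Matrix.Norms.L2Operator

variable {n : ℕ}

theorem mem_orbit_self (G : Subgroup (SUGroup n)) (z : CSpace n) : z ∈ orbit G z :=
  ⟨1, G.one_mem, (act_one z).symm⟩

theorem act_mem_orbit_iff {G : Subgroup (SUGroup n)} {g : SUGroup n} (hg : g ∈ G)
    {z w : CSpace n} : act g w ∈ orbit G z ↔ w ∈ orbit G z := by
  constructor
  · rintro ⟨h, hh, hw⟩
    refine ⟨g⁻¹ * h, G.mul_mem (G.inv_mem hg) hh, ?_⟩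
    rw [act_mul, ← hw, act_inv_act]
  · rintro ⟨h, hh, rfl⟩
    exact ⟨g * h, G.mul_mem hg hh, (act_mul g h z).symm⟩

theorem contDiff_matExp {k : WithTop ℕ∞} :
    ContDiff ℝ k (NormedSpace.exp : Matrix (Fin n) (Fin n) ℂ → Matrix (Fin n) (Fin n) ℂ) :=
  contDiff_iff_contDiffAt.2 fun x => (NormedSpace.exp_analytic (𝕂 := ℝ) x).contDiffAt

/-- Otherwise z is an accumulation point of the part of the orbit in z + Tᗮ. A nonzero tangent
vector of that part lies in T, by the inclusion of the tangent cone, and is killed by the projection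
to T. -/
theorem eventually_orthogonal_orbit {G : Subgroup (SUGroup n)}
    (hG : IsCompact (G : Set (SUGroup n))) (z : CSpace n) :
    ∀ᶠ s in 𝓝 (0 : CSpace n), s ∈ (orbitTangent G z)ᗮ → z + s ∈ orbit G z → s = 0 := by
  by_contra h
  set T := orbitTangent G z
  let S : Set (CSpace n) := {y | y ∈ orbit G z ∧ y - z ∈ Tᗮ}
  have hacc : AccPt z (𝓟 S) := by
    rw [accPt_iff_frequently]
    have ht : Tendsto (fun s => z + s) (𝓝 (0 : CSpace n)) (𝓝 z) := by
      have : Continuous fun s => z + s := by fun_prop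
      simpa using this.tendsto 0
    refine ht.frequently ((not_eventually.1 h).mono fun s hs => ?_)
    push Not at hs
    exact ⟨by simpa using hs.2.2, hs.2.1, by simpa using hs.1⟩
  obtain ⟨v, hv, hv0⟩ := tangentConeAt_nonempty_of_properSpace (𝕜 := ℝ) hacc
  have hvT : v ∈ T := tangentConeAt_orbit_subset hG z
    (tangentConeAt_mono (fun y hy => hy.1) hv)
  have hvP : T.orthogonalProjectionOnto v = 0 := by
    have h1 : HasFDerivWithinAt (fun y => T.orthogonalProjectionOnto (y - z)) T.orthogonalProjectionOnto
        S z := (T.orthogonalProjectionOnto.hasFDerivAt.comp z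
          ((hasFDerivAt_id z).sub_const z)).hasFDerivWithinAt
    have h2 : HasFDerivWithinAt (fun y => T.orthogonalProjectionOnto (y - z)) 0 S z :=
      (hasFDerivWithinAt_const (𝕜 := ℝ) (0 : T) z S).congr
        (fun y hy => T.orthogonalProjectionOnto_eq_zero_iff.2 hy.2)
        (by simp)
    exact h1.unique_on h2 hv
  apply hv0
  have := T.orthogonalProjectionOnto_mem_subspace_eq_self ⟨v, hvT⟩
  rw [hvP] at this
  exact (congrArg Subtype.val this).symm

theorem exists_germ_orbit {G : Subgroup (SUGroup n)}
    (hG : IsCompact (G : Set (SUGroup n))) (z : CSpace n) :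
    ∃ ψ : orbitTangent G z → CSpace n, IsGermParam (orbit G z) ψ 0 ∧ ψ 0 = z := by
  set T := orbitTangent G z with hT
  let P := T.orthogonalProjectionOnto
  let ev : lieAlg G →ₗ[ℝ] T := LinearMap.codRestrict T
    (((matActL n).flip z).toLinearMap ∘ₗ (lieAlg G).subtype) fun X =>
      (mem_orbitTangent_iff hG).2 ⟨X, (mem_lieAlg_iff hG).1 X.2, rfl⟩
  have hev : LinearMap.range ev = ⊤ := by
    rw [LinearMap.range_eq_top]
    rintro ⟨v, hv⟩
    obtain ⟨X, hX, rfl⟩ := (mem_orbitTangent_iff hG).1 hv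
    exact ⟨⟨X, (mem_lieAlg_iff hG).2 hX⟩, rfl⟩
  -- A linear section of X ↦ X z; it selects a direction in 𝔤 for every tangent vector.
  obtain ⟨σ₀, hσ₀⟩ := ev.exists_rightInverse_of_surjective hev
  let σ : T →L[ℝ] Matrix (Fin n) (Fin n) ℂ :=
    LinearMap.toContinuousLinearMap ((lieAlg G).subtype ∘ₗ σ₀)
  have hσG : ∀ t, σ t ∈ lieGen G := fun t => (mem_lieAlg_iff hG).1 (σ₀ t).2
  have hσ : ∀ t, matActL n (σ t) z = t := fun t =>
    congrArg Subtype.val (LinearMap.congr_fun hσ₀ t)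
  have hexp : ∀ t, ∃ g ∈ G, (g : Matrix (Fin n) (Fin n) ℂ) = NormedSpace.exp (σ t) := fun t => by
    simpa using hσG t 1
  -- Slice coordinates: move z by the normal part of x, then by the exponential of the tangential
  -- part. The derivative at 0 is P x + (x - P x) = x, so Ψ is a local diffeomorphism.
  let Ψ : CSpace n → CSpace n := fun x =>
    matActL n (NormedSpace.exp (σ (P x))) (z + (x - P x))
  have hΨ : ContDiff ℝ ∞ Ψ := by
    have h1 : ContDiff ℝ ∞ fun x => matActL n (NormedSpace.exp (σ (P x))) :=
      (matActL n).contDiff.comp (contDiff_matExp.comp (σ.contDiff.comp P.contDiff))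
    exact h1.clm_apply (contDiff_const.add (contDiff_id.sub
      (T.subtypeL.contDiff.comp P.contDiff)))
  have hΨ0 : Ψ 0 = z := by simp [Ψ, matActL_one]
  have hΨ' : HasFDerivAt Ψ ((ContinuousLinearEquiv.refl ℝ (CSpace n) : CSpace n ≃L[ℝ] _) :
      CSpace n →L[ℝ] CSpace n) 0 := by
    have e0 : HasFDerivAt (NormedSpace.exp : Matrix (Fin n) (Fin n) ℂ → _)
        (1 : Matrix (Fin n) (Fin n) ℂ →L[ℝ] _) (σ (P 0)) := by
      simpa using (hasFDerivAt_exp_zero (𝕂 := ℝ) (𝔸 := Matrix (Fin n) (Fin n) ℂ))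
    have h1 : HasFDerivAt (fun x => matActL n (NormedSpace.exp (σ (P x))))
        ((matActL n).comp ((1 : Matrix (Fin n) (Fin n) ℂ →L[ℝ] _).comp (σ.comp P))) 0 :=
      (matActL n).hasFDerivAt.comp 0 (e0.comp 0 ((σ.comp P).hasFDerivAt))
    have h2 : HasFDerivAt (fun x : CSpace n => z + (x - P x))
        (ContinuousLinearMap.id ℝ _ - T.subtypeL.comp P) 0 :=
      ((hasFDerivAt_id (0 : CSpace n)).sub (T.subtypeL.comp P).hasFDerivAt).const_add z
    refine (h1.clm_apply h2).congr_fderiv ?_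
    ext1 x
    simp [matActL_one, hσ]
  have hmap : map Ψ (𝓝 0) = 𝓝 z := by
    rw [← hΨ0]
    exact (hΨ.contDiffAt.hasStrictFDerivAt' hΨ' (by simp)).map_nhds_eq_of_equiv
  let ψ : T → CSpace n := fun t => Ψ t
  have hψ : ∀ t : T, ψ t = matActL n (NormedSpace.exp (σ t)) z := fun t => by
    simp [ψ, Ψ, P]
  have hψO : ∀ t, ψ t ∈ orbit G z := fun t => by
    obtain ⟨g, hg, hg'⟩ := hexp t
    exact ⟨g, hg, by rw [hψ, act_eq_matActL, hg']⟩
  have hψs : ContDiff ℝ ∞ ψ := hΨ.comp T.subtypeL.contDiff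
  have hψ0 : ψ 0 = z := hΨ0
  refine ⟨ψ, ⟨.of_forall fun x => hψs.contDiffAt, ?_, ?_⟩, hψ0⟩
  · have : HasFDerivAt ψ T.subtypeL 0 := by
      have := HasFDerivAt.comp (0 : T) (f := T.subtypeL) (g := Ψ) (by simpa using hΨ')
        T.subtypeL.hasFDerivAt
      exact this
    rw [this.fderiv]
    exact Subtype.val_injective
  · rw [hψ0]
    refine le_antisymm (tendsto_nhdsWithin_iff.2 ⟨?_, .of_forall hψO⟩) fun N hN => ?_
    · simpa only [hψ0] using hψs.continuous.tendsto 0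
    · have hB : ∀ᶠ x in 𝓝 (0 : CSpace n), ψ (P x) ∈ N ∧
          (x - P x ∈ Tᗮ → z + (x - P x) ∈ orbit G z → x - P x = 0) := by
        refine Eventually.and ?_ ?_
        · have : Tendsto P (𝓝 0) (𝓝 0) := by simpa using P.continuous.tendsto 0
          exact this.eventually hN
        · have : Tendsto (fun x => x - (P x : CSpace n)) (𝓝 0) (𝓝 0) := by
            have : Continuous fun x => x - (P x : CSpace n) := by fun_prop
            simpa using this.tendsto 0
          exact this.eventually (eventually_orthogonal_orbit hG z)
      -- If Ψ x lies on the orbit, undoing the exponential puts z + (x - P x) there as well. The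
      -- slice then forces x = P x, so Ψ x lies in the image of ψ.
      have hN' : ∀ᶠ p in 𝓝 z, p ∈ orbit G z → p ∈ N := by
        rw [← hmap, eventually_map]
        filter_upwards [hB] with x hx hxO
        obtain ⟨g, hg, hg'⟩ := hexp (P x)
        have h1 : z + (x - P x) ∈ orbit G z := by
          rw [← act_mem_orbit_iff hg, act_eq_matActL, hg']
          exact hxO
        have h2 := hx.2 (T.sub_starProjection_mem_orthogonal x) h1
        have h3 : Ψ x = ψ (P x) := by
          rw [hψ]
          simp only [Ψ, h2, add_zero]
        rw [h3]
        exact hx.1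
      rw [mem_nhdsWithin_iff_eventually]
      exact hN'

theorem image_act_orbit {G : Subgroup (SUGroup n)} {g : SUGroup n} (hg : g ∈ G) (z : CSpace n) :
    act g '' orbit G z = orbit G z := by
  ext w
  constructor
  · rintro ⟨w, hw, rfl⟩
    exact (act_mem_orbit_iff hg).2 hw
  · intro hw
    exact ⟨act g⁻¹ w, (act_mem_orbit_iff (G.inv_mem hg)).2 hw, act_inv_act' g w⟩

theorem hasFDerivAt_act (g : SUGroup n) (z : CSpace n) :
    HasFDerivAt (act g) (matActL n (g : Matrix (Fin n) (Fin n) ℂ)) z := by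
  have : act g = matActL n (g : Matrix (Fin n) (Fin n) ℂ) := funext fun z => act_eq_matActL g z
  rw [this]
  exact (matActL n (g : Matrix (Fin n) (Fin n) ℂ)).hasFDerivAt

theorem contDiff_act (g : SUGroup n) : ContDiff ℝ ∞ (act g) := by
  have : act g = matActL n (g : Matrix (Fin n) (Fin n) ℂ) := funext fun z => act_eq_matActL g z
  rw [this]
  exact (matActL n (g : Matrix (Fin n) (Fin n) ℂ)).contDiff

/-- The homeomorphism of `ℂ^n` given by an element of `SU(n)`. -/
def actHomeomorph (g : SUGroup n) : CSpace n ≃ₜ CSpace n where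
  toFun := act g
  invFun := act g⁻¹
  left_inv := act_inv_act g
  right_inv := act_inv_act' g
  continuous_toFun := (contDiff_act g).continuous
  continuous_invFun := (contDiff_act g⁻¹).continuous

/-- The germ at z is translated along the orbit by the elements of G. -/
theorem isSubmanifold_orbit {G : Subgroup (SUGroup n)}
    (hG : IsCompact (G : Set (SUGroup n))) {z : CSpace n} {k : ℕ}
    (hk : Module.finrank ℝ (orbitTangent G z) = k) : IsSubmanifold k (orbit G z) := by
  refine isSubmanifold_of_germs hk ?_
  rintro _ ⟨g, hg, rfl⟩
  obtain ⟨ψ, hψ, hψ0⟩ := exists_germ_orbit hG z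
  refine ⟨act g ∘ ψ, 0, ⟨?_, ?_, ?_⟩, by simp [hψ0]⟩
  · filter_upwards [hψ.smooth] with x hx
    exact (contDiff_act g).contDiffAt.comp x hx
  · rw [((hasFDerivAt_act g (ψ 0)).comp 0 hψ.hasFDerivAt).fderiv]
    rw [ContinuousLinearMap.coe_comp]
    refine Function.Injective.comp ?_ hψ.immersive
    rw [show ⇑(matActL n (g : Matrix (Fin n) (Fin n) ℂ)) = act g from
      funext fun z => (act_eq_matActL g z).symm]
    exact (actHomeomorph g).injective
  · rw [← Filter.map_map, hψ.map_nhds]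
    have := (actHomeomorph g).isEmbedding.map_nhdsWithin_eq (orbit G z) (ψ 0)
    rw [show (⇑(actHomeomorph g)) = act g from rfl, image_act_orbit hg] at this
    exact this

theorem act_inv_mem_orbitTangent {G : Subgroup (SUGroup n)}
    (hG : IsCompact (G : Set (SUGroup n))) {z : CSpace n} {g : SUGroup n} (hg : g ∈ G)
    {v : CSpace n} (hv : v ∈ tangentConeAt ℝ (orbit G z) (act g z)) :
    act g⁻¹ v ∈ orbitTangent G z := by
  have h := (hasFDerivAt_act g⁻¹ (act g z)).hasFDerivWithinAt (s := orbit G z)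
    |>.mapsTo_tangent_cone hv
  rw [image_act_orbit (G.inv_mem hg), act_inv_act, ← act_eq_matActL] at h
  exact tangentConeAt_orbit_subset hG z h

theorem isCompact_orbit {G : Subgroup (SUGroup n)} (hG : IsCompact (G : Set (SUGroup n)))
    (z : CSpace n) : IsCompact (orbit G z) := by
  have : orbit G z = (fun g => act g z) '' (G : Set (SUGroup n)) := by
    ext w; exact ⟨fun ⟨g, hg, h⟩ => ⟨g, hg, h.symm⟩, fun ⟨g, hg, h⟩ => ⟨g, hg, h.symm⟩⟩
  rw [this]
  exact hG.image (continuous_act_left z)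

end Orbits

/-! ### Consequences of the vanishing of the moment map. -/

section Isotropy

open Set Filter Topology

open scoped Matrix.Norms.L2Operator

variable {n : ℕ}

theorem kahlerForm_eq_im_inner (v w : CSpace n) : kahlerForm v w = (inner ℂ v w).im := by
  simp only [kahlerForm, PiLp.inner_apply, Complex.im_sum]
  refine Finset.sum_congr rfl fun i _ => ?_
  simp [Complex.mul_im]
  ring

theorem liouvilleForm_eq_im_inner (v w : CSpace n) : liouvilleForm v w = (inner ℂ v w).im := by
  simp only [liouvilleForm, PiLp.inner_apply, Complex.im_sum]
  refine Finset.sum_congr rfl fun i _ => ?_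
  simp [Complex.mul_im]
  ring

theorem re_inner_eq_inner_real (v w : CSpace n) : (inner ℂ v w).re = inner ℝ v w := by
  simp only [PiLp.inner_apply, Complex.re_sum]
  refine Finset.sum_congr rfl fun i _ => ?_
  simp [Complex.inner]

theorem inner_act_act (g : SUGroup n) (v w : CSpace n) :
    inner ℂ (act g v) (act g w) = inner ℂ v w := by
  have h : star (g : Matrix (Fin n) (Fin n) ℂ) * g = 1 := (Matrix.mem_unitaryGroup_iff').1 g.2.1
  rw [Matrix.star_eq_conjTranspose] at h
  simp only [EuclideanSpace.inner_eq_star_dotProduct, act]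
  rw [Matrix.star_mulVec, dotProduct_comm, ← Matrix.dotProduct_mulVec, Matrix.mulVec_mulVec, h,
    Matrix.one_mulVec, dotProduct_comm]

theorem hasDerivAt_matActL_exp (X : Matrix (Fin n) (Fin n) ℂ) (z : CSpace n) :
    HasDerivAt (fun t : ℝ => matActL n (NormedSpace.exp (t • X)) z) (matActL n X z) 0 := by
  have := ((matActL n).flip z).hasFDerivAt.comp_hasDerivAt (0 : ℝ)
    (hasDerivAt_exp_smul_const X (0 : ℝ))
  simpa [Function.comp_def] using this

variable {G : Subgroup (SUGroup n)}

/-- Differentiate the invariance of the Hermitian product along exp(tX). -/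
theorem inner_lieGen_left {X : Matrix (Fin n) (Fin n) ℂ} (hX : X ∈ lieGen G) (v w : CSpace n) :
    inner ℂ (matActL n X v) w = - inner ℂ v (matActL n X w) := by
  have h := (hasDerivAt_matActL_exp X v).inner ℂ (hasDerivAt_matActL_exp X w)
  have hc : (fun t : ℝ => inner ℂ (matActL n (NormedSpace.exp (t • X)) v)
      (matActL n (NormedSpace.exp (t • X)) w)) = fun _ => inner ℂ v w := by
    funext t
    obtain ⟨g, -, hg⟩ := hX t
    rw [← hg, ← act_eq_matActL, ← act_eq_matActL, inner_act_act]
  rw [hc] at h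
  have := h.unique (hasDerivAt_const (0 : ℝ) _)
  simp only [zero_smul, NormedSpace.exp_zero, matActL_one] at this
  exact eq_neg_of_add_eq_zero_right this

theorem conj_mem_lieGen {X : Matrix (Fin n) (Fin n) ℂ} (hX : X ∈ lieGen G) {g : SUGroup n}
    (hg : g ∈ G) :
    ((g⁻¹ : SUGroup n) : Matrix (Fin n) (Fin n) ℂ) * X * (g : Matrix (Fin n) (Fin n) ℂ)
      ∈ lieGen G := by
  intro t
  obtain ⟨h, hh, hh'⟩ := hX t
  refine ⟨g⁻¹ * h * g, G.mul_mem (G.mul_mem (G.inv_mem hg) hh) hg, ?_⟩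
  let U : (Matrix (Fin n) (Fin n) ℂ)ˣ :=
    ⟨g, (g⁻¹ : SUGroup n), by rw [← Submonoid.coe_mul, mul_inv_cancel, Submonoid.coe_one],
      by rw [← Submonoid.coe_mul, inv_mul_cancel, Submonoid.coe_one]⟩
  have := Matrix.exp_units_conj' U (t • X)
  simp only [Submonoid.coe_mul, hh']
  rw [Matrix.mul_smul, Matrix.smul_mul] at this
  exact this.symm

/-- The trace pairing of X with i z z* is i times ⟨X z, z⟩, so its real part is minus the imaginary
part in question. -/
theorem kahlerForm_lieGen_self (hG : IsCompact (G : Set (SUGroup n))) {z : CSpace n}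
    (hz : momentMap G z = 0) {X : Matrix (Fin n) (Fin n) ℂ} (hX : X ∈ lieGen G) :
    (inner ℂ (matActL n X z) z).im = 0 := by
  have h := LinearMap.congr_fun hz ⟨X, (mem_lieAlg_iff hG).2 hX⟩
  simp only [momentMap, traceForm, LinearMap.smul_apply, LinearMap.comp_apply,
    Submodule.subtype_apply, LinearMap.coe_mk, AddHom.coe_mk, LinearMap.zero_apply,
    smul_eq_mul, mul_eq_zero] at h
  replace h := h.resolve_left (by norm_num)
  have e : Matrix.trace (X.conjTranspose * (Complex.I • Matrix.vecMulVec z (star (z : Fin n → ℂ))))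
      = Complex.I * inner ℂ (matActL n X z) z := by
    rw [Matrix.mul_smul, Matrix.trace_smul, Matrix.mul_vecMulVec, Matrix.trace_vecMulVec,
      smul_eq_mul, EuclideanSpace.inner_eq_star_dotProduct, matActL_apply, Matrix.star_mulVec,
      dotProduct_comm _ (Matrix.vecMul _ _), ← Matrix.dotProduct_mulVec, dotProduct_comm]
  rw [e] at h
  simpa using h

/-- The imaginary part is the moment map, and the real part vanishes because X is skew-Hermitian.
This is the Legendrian condition on the orbit. -/
theorem inner_lieGen_self (hG : IsCompact (G : Set (SUGroup n))) {z : CSpace n}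
    (hz : momentMap G z = 0) {X : Matrix (Fin n) (Fin n) ℂ} (hX : X ∈ lieGen G) :
    inner ℂ (matActL n X z) z = 0 := by
  refine Complex.ext ?_ (kahlerForm_lieGen_self hG hz hX)
  have h := congrArg Complex.re (inner_lieGen_left hX z z)
  rw [← inner_conj_symm z] at h
  simp only [Complex.neg_re, Complex.conj_re] at h
  simp only [Complex.zero_re]
  linarith

/-- Conjugation by exp(tY) preserves the Lie algebra, so the previous vanishing persists along
exp(tY) z. Its derivative at t = 0 is twice the Kähler form of X z and Y z, because X is
skew-Hermitian. -/
theorem kahlerForm_lieGen (hG : IsCompact (G : Set (SUGroup n))) {z : CSpace n}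
    (hz : momentMap G z = 0) {X Y : Matrix (Fin n) (Fin n) ℂ} (hX : X ∈ lieGen G)
    (hY : Y ∈ lieGen G) : kahlerForm (matActL n X z) (matActL n Y z) = 0 := by
  rw [kahlerForm_eq_im_inner]
  have h1 := ((matActL n X).hasFDerivAt.comp_hasDerivAt (0 : ℝ)
    (hasDerivAt_matActL_exp Y z)).inner ℂ (hasDerivAt_matActL_exp Y z)
  have h2 := Complex.imCLM.hasFDerivAt.comp_hasDerivAt (0 : ℝ) h1
  have hc : (⇑Complex.imCLM ∘ fun t : ℝ => inner ℂ ((⇑(matActL n X) ∘ fun t : ℝ =>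
      matActL n (NormedSpace.exp (t • Y)) z) t) (matActL n (NormedSpace.exp (t • Y)) z))
      = fun _ => 0 := by
    funext t
    obtain ⟨g, hg, hg'⟩ := hY t
    have := kahlerForm_lieGen_self hG hz (conj_mem_lieGen hX hg)
    rw [← inner_act_act g, matActL_mul, matActL_mul, ← act_eq_matActL, ← act_eq_matActL,
      act_inv_act', act_eq_matActL, hg'] at this
    exact this
  rw [hc] at h2
  have h3 := h2.unique (hasDerivAt_const (0 : ℝ) _)
  simp only [zero_smul, NormedSpace.exp_zero, matActL_one, Function.comp_apply] at h3
  rw [inner_lieGen_left hX (matActL n Y z) z, ← inner_conj_symm (matActL n Y z)] at h3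
  simp only [Complex.imCLM_apply, Complex.add_im, Complex.neg_im, Complex.conj_im] at h3
  linarith

/-- The moment map is quadratic and scales by |c|². This passes its vanishing from z' to V. -/
theorem momentMap_smul (c : ℂ) (z : CSpace n) (hz : momentMap G z = 0) :
    momentMap G (c • z) = 0 := by
  have e : Matrix.vecMulVec (c • z : CSpace n) (star ((c • z : CSpace n) : Fin n → ℂ))
      = (‖c‖ ^ 2 : ℝ) • Matrix.vecMulVec z (star (z : Fin n → ℂ)) := by
    ext i j
    have : (c * (starRingEnd ℂ) c) = ((‖c‖ ^ 2 : ℝ) : ℂ) := by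
      rw [Complex.mul_conj, Complex.normSq_eq_norm_sq]
    simp only [Matrix.vecMulVec_apply, PiLp.smul_apply, Pi.star_apply, smul_eq_mul, star_mul',
      Matrix.smul_apply, Complex.real_smul, ← this, Complex.star_def]
    ring
  ext X
  have h := LinearMap.congr_fun hz X
  simp only [momentMap, traceForm, LinearMap.smul_apply, LinearMap.comp_apply,
    LinearMap.coe_mk, AddHom.coe_mk, LinearMap.zero_apply, smul_eq_mul] at h ⊢
  rw [e, smul_comm Complex.I, Matrix.mul_smul, Matrix.trace_smul, Complex.smul_re, smul_eq_mul,
    mul_left_comm, h, mul_zero]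

end Isotropy

/-! ### Special Legendrian links from orbits. -/

section Links

open Set Filter Topology

variable {k : ℕ}

/-- A compact `k`-dimensional submanifold of the unit sphere of `ℂ^(k+1)` whose complex cone over
`ℝ` is special Lagrangian of phase `0`. -/
structure IsSpecialLegendrian (Q : Set (CSpace (k + 1))) : Prop where
  submanifold : IsSubmanifold k Q
  isCompact : IsCompact Q
  norm_eq : ∀ p ∈ Q, ‖p‖ = 1
  frame : ∀ p ∈ Q, ∃ τ : Fin k → CSpace (k + 1),
    tangentConeAt ℝ Q p ⊆ Submodule.span ℝ (range τ) ∧ (∀ i, inner ℂ (τ i) p = 0) ∧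
    (∀ i j, (inner ℂ (τ i) (τ j)).im = 0) ∧
    (holVolForm (Fin.snoc (α := fun _ => CSpace (k + 1)) τ p)).im = 0

theorem holVolForm_snoc_eq (τ : Fin k → CSpace (k + 1)) (p : CSpace (k + 1)) :
    (fun j : Fin (k + 1) => if h : (j : ℕ) < k + 1 - 1 then τ ⟨j, h⟩ else p)
      = Fin.snoc (α := fun _ => CSpace (k + 1)) τ p := by
  funext j
  simp only [Nat.add_sub_cancel, Fin.snoc]
  rfl

theorem holVolForm_act {n : ℕ} (g : SUGroup n) (v : Fin n → CSpace n) :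
    holVolForm (fun j => act g (v j)) = holVolForm v := by
  have : (Matrix.of fun i j => act g (v j) i) =
      (g : Matrix (Fin n) (Fin n) ℂ) * Matrix.of fun i j => v j i := by
    ext i j
    simp [act, Matrix.mul_apply, Matrix.mulVec, dotProduct]
  have hdet : (g : Matrix (Fin n) (Fin n) ℂ).det = 1 := g.2.2
  rw [holVolForm, holVolForm, this, Matrix.det_mul, hdet, one_mul]

/-- The Gram matrix of (τ, p) is diagonal with entries 1, …, 1, ‖p‖², so |Ω(τ, p)|² = ‖p‖². -/
theorem norm_eq_one_of_holVolForm {τ : Fin k → CSpace (k + 1)} {p : CSpace (k + 1)}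
    (hτ : Orthonormal ℝ τ) (hp : ∀ i, inner ℂ (τ i) p = 0)
    (him : ∀ i j, (inner ℂ (τ i) (τ j)).im = 0)
    (hdet : ‖holVolForm (Fin.snoc (α := fun _ => CSpace (k + 1)) τ p)‖ = 1) : ‖p‖ = 1 := by
  set v := Fin.snoc (α := fun _ => CSpace (k + 1)) τ p with hv
  let M : Matrix (Fin (k + 1)) (Fin (k + 1)) ℂ := Matrix.of fun i j => v j i
  have hM : ∀ i j, (M.conjTranspose * M) i j = inner ℂ (v i) (v j) := by
    intro i j
    simp [M, Matrix.mul_apply, PiLp.inner_apply, mul_comm]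
  have hdiag : M.conjTranspose * M =
      Matrix.diagonal (Fin.snoc (α := fun _ => ℂ) (fun _ => 1) ((‖p‖ : ℂ) ^ 2)) := by
    ext i j
    rw [hM]
    refine Fin.lastCases ?_ (fun i => ?_) i <;> refine Fin.lastCases ?_ (fun j => ?_) j
    · simp [hv]
    · rw [Matrix.diagonal_apply_ne _ (Fin.castSucc_lt_last j).ne', hv]
      simp only [Fin.snoc_last, Fin.snoc_castSucc]
      rw [← inner_conj_symm, hp, map_zero]
    · rw [Matrix.diagonal_apply_ne _ (Fin.castSucc_lt_last i).ne, hv]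
      simp only [Fin.snoc_last, Fin.snoc_castSucc]
      exact hp i
    · have h1 := (orthonormal_iff_ite.1 hτ) i j
      rw [← re_inner_eq_inner_real] at h1
      have h2 : inner ℂ (τ i) (τ j) = if i = j then 1 else 0 := by
        refine Complex.ext ?_ ?_
        · rw [h1]; split_ifs <;> simp
        · rw [him]; split_ifs <;> simp
      simp only [hv, Fin.snoc_castSucc, h2, Matrix.diagonal_apply, Fin.castSucc_inj]
  have h1 := congrArg Matrix.det hdiag
  rw [Matrix.det_mul, Matrix.det_conjTranspose, Matrix.det_diagonal, Fin.prod_univ_castSucc] at h1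
  simp only [Fin.snoc_castSucc, Finset.prod_const_one, Fin.snoc_last, one_mul] at h1
  have h2 : ‖M.det‖ = 1 := hdet
  have h3 : ((‖M.det‖ ^ 2 : ℝ) : ℂ) = ((‖p‖ ^ 2 : ℝ) : ℂ) := by
    rw [← Complex.normSq_eq_norm_sq, Complex.normSq_eq_conj_mul_self]
    simpa using h1
  rw [h2, Complex.ofReal_inj] at h3
  nlinarith [norm_nonneg p]

/-- Everything is checked at z and carried along the orbit, since SU(n) preserves the Hermitian
product and the holomorphic volume. -/
theorem isSpecialLegendrian_orbit {G : Subgroup (SUGroup (k + 1))}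
    (hG : IsCompact (G : Set (SUGroup (k + 1)))) {z : CSpace (k + 1)} (hz : momentMap G z = 0)
    {τ : Fin k → CSpace (k + 1)} (hτ : Orthonormal ℝ τ)
    (hspan : Submodule.span ℝ (range τ) = orbitTangent G z) {ε : ℂ} (hε : ε = 1 ∨ ε = -1)
    (hdet : holVolForm (Fin.snoc (α := fun _ => CSpace (k + 1)) τ z) = ε) :
    IsSpecialLegendrian (orbit G z) := by
  have hτT : ∀ i, τ i ∈ orbitTangent G z := fun i => hspan ▸ Submodule.subset_span ⟨i, rfl⟩
  have h1 : ∀ i, inner ℂ (τ i) z = 0 := fun i => by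
    obtain ⟨X, hX, hX'⟩ := (mem_orbitTangent_iff hG).1 (hτT i)
    rw [hX', inner_lieGen_self hG hz hX]
  have h2 : ∀ i j, (inner ℂ (τ i) (τ j)).im = 0 := fun i j => by
    obtain ⟨X, hX, hX'⟩ := (mem_orbitTangent_iff hG).1 (hτT i)
    obtain ⟨Y, hY, hY'⟩ := (mem_orbitTangent_iff hG).1 (hτT j)
    rw [hX', hY', ← kahlerForm_eq_im_inner, kahlerForm_lieGen hG hz hX hY]
  have hnorm : ‖z‖ = 1 := norm_eq_one_of_holVolForm hτ h1 h2 (by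
    rw [hdet]; rcases hε with rfl | rfl <;> simp)
  refine ⟨isSubmanifold_orbit hG ?_, isCompact_orbit hG z, ?_, ?_⟩
  · rw [← hspan, finrank_span_eq_card hτ.linearIndependent, Fintype.card_fin]
  · rintro _ ⟨g, -, rfl⟩
    have h : ∀ w : CSpace (k + 1), ‖w‖ ^ 2 = (inner ℂ w w).re := fun w =>
      (inner_self_eq_norm_sq (𝕜 := ℂ) w).symm
    have := h (act g z)
    rw [inner_act_act, ← h, hnorm] at this
    nlinarith [norm_nonneg (act g z)]
  · rintro _ ⟨g, hg, rfl⟩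
    refine ⟨fun i => act g (τ i), fun v hv => ?_, fun i => ?_, fun i j => ?_, ?_⟩
    · have h := act_inv_mem_orbitTangent hG hg hv
      rw [← hspan] at h
      have h' := Submodule.mem_map_of_mem
        (f := (matActL (k + 1) (g : Matrix (Fin (k + 1)) (Fin (k + 1)) ℂ)).toLinearMap) h
      rw [Submodule.map_span, ← range_comp] at h'
      have e : matActL (k + 1) (g : Matrix (Fin (k + 1)) (Fin (k + 1)) ℂ) (act g⁻¹ v) = v := by
        rw [← act_eq_matActL, act_inv_act']
      have e' : (⇑(matActL (k + 1) (g : Matrix (Fin (k + 1)) (Fin (k + 1)) ℂ)).toLinearMap ∘ τ)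
          = fun i => act g (τ i) := funext fun i => (act_eq_matActL g _).symm
      rw [e', ContinuousLinearMap.coe_coe, e] at h'
      exact h'
    · rw [inner_act_act, h1]
    · rw [inner_act_act, h2]
    · have : (Fin.snoc (α := fun _ => CSpace (k + 1)) (fun i => act g (τ i)) (act g z))
          = fun j => act g (Fin.snoc (α := fun _ => CSpace (k + 1)) τ z j) := by
        funext j
        refine Fin.lastCases ?_ (fun i => ?_) j <;> simp
      rw [this, holVolForm_act, hdet]
      rcases hε with rfl | rfl <;> simp

theorem holVolForm_neg {n : ℕ} (v : Fin n → CSpace n) :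
    holVolForm (fun j => -v j) = (-1) ^ n * holVolForm v := by
  have : (Matrix.of fun i j => (-v j) i) = -(Matrix.of fun i j => v j i) := by
    ext i j; simp
  rw [holVolForm, holVolForm, this, Matrix.det_neg, Fintype.card_fin]

theorem orbitTangent_neg {G : Subgroup (SUGroup (k + 1))}
    (hG : IsCompact (G : Set (SUGroup (k + 1)))) (z : CSpace (k + 1)) :
    orbitTangent G (-z) = orbitTangent G z := by
  ext v
  rw [mem_orbitTangent_iff hG, mem_orbitTangent_iff hG]
  constructor <;> rintro ⟨X, hX, rfl⟩ <;>
    exact ⟨(-1 : ℝ) • X, smul_mem_lieGen hX _, by simp⟩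

/-- Negating the frame together with z changes the volume by the sign (-1)^(k+1), so it is still ±1.
-/
theorem isSpecialLegendrian_orbit_neg {G : Subgroup (SUGroup (k + 1))}
    (hG : IsCompact (G : Set (SUGroup (k + 1)))) {z : CSpace (k + 1)} (hz : momentMap G z = 0)
    {τ : Fin k → CSpace (k + 1)} (hτ : Orthonormal ℝ τ)
    (hspan : Submodule.span ℝ (range τ) = orbitTangent G z) {ε : ℂ} (hε : ε = 1 ∨ ε = -1)
    (hdet : holVolForm (Fin.snoc (α := fun _ => CSpace (k + 1)) τ z) = ε) :
    IsSpecialLegendrian (orbit G (-z)) := by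
  refine isSpecialLegendrian_orbit hG (τ := fun i => -τ i) (ε := (-1) ^ (k + 1) * ε) ?_ ?_ ?_ ?_ ?_
  · have := momentMap_smul (-1) z hz
    rwa [neg_one_smul] at this
  · rw [orthonormal_iff_ite] at hτ ⊢
    simpa using hτ
  · rw [orbitTangent_neg hG, ← hspan, ← Submodule.span_neg (range τ)]
    congr 1
    ext v
    simp [Set.mem_neg, neg_eq_iff_eq_neg]
  · rcases neg_one_pow_eq_or ℂ (k + 1) with h | h <;> rcases hε with rfl | rfl <;> simp [h]
  · rw [← hdet, ← holVolForm_neg]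
    congr 1
    funext j
    refine Fin.lastCases ?_ (fun i => ?_) j <;> simp

theorem nhdsWithin_union_of_notMem {X : Type*} [TopologicalSpace X] {A B : Set X}
    (hB : IsClosed B) {p : X} (hp : p ∉ B) : 𝓝[A ∪ B] p = 𝓝[A] p := by
  have h : 𝓝[B] p = ⊥ := by
    rw [← not_neBot, ← mem_closure_iff_nhdsWithin_neBot, hB.closure_eq]
    exact hp
  rw [nhdsWithin_union, h, sup_bot_eq]

/-- Disjoint compact sets do not see each other locally, so neighbourhood filters and tangent cones
are unchanged. -/
theorem IsSpecialLegendrian.union {Q Q' : Set (CSpace (k + 1))} (hQ : IsSpecialLegendrian Q)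
    (hQ' : IsSpecialLegendrian Q') (hd : Disjoint Q Q') : IsSpecialLegendrian (Q ∪ Q') := by
  have n1 : ∀ p ∈ Q, 𝓝[Q ∪ Q'] p = 𝓝[Q] p := fun p hp =>
    nhdsWithin_union_of_notMem hQ'.isCompact.isClosed (disjoint_left.1 hd hp)
  have n2 : ∀ p ∈ Q', 𝓝[Q ∪ Q'] p = 𝓝[Q'] p := fun p hp => by
    rw [union_comm]
    exact nhdsWithin_union_of_notMem hQ.isCompact.isClosed (disjoint_right.1 hd hp)
  refine ⟨isSubmanifold_of_germs (W := EuclideanSpace ℝ (Fin k)) (by simp) ?_,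
    hQ.isCompact.union hQ'.isCompact, fun p hp => hp.elim (hQ.norm_eq p) (hQ'.norm_eq p), ?_⟩
  · rintro p (hp | hp)
    · obtain ⟨-, φ, u, -, -, hφ, rfl⟩ := hQ.submanifold.exists_germ hp
      exact ⟨φ, u, ⟨hφ.smooth, hφ.immersive, hφ.map_nhds.trans (n1 _ hp).symm⟩, rfl⟩
    · obtain ⟨-, φ, u, -, -, hφ, rfl⟩ := hQ'.submanifold.exists_germ hp
      exact ⟨φ, u, ⟨hφ.smooth, hφ.immersive, hφ.map_nhds.trans (n2 _ hp).symm⟩, rfl⟩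
  · rintro p (hp | hp)
    · rw [tangentConeAt_congr (n1 p hp)]
      exact hQ.frame p hp
    · rw [tangentConeAt_congr (n2 p hp)]
      exact hQ'.frame p hp

theorem neg_mem_orbit_iff {n : ℕ} {G : Subgroup (SUGroup n)} {z w : CSpace n} :
    -w ∈ orbit G z ↔ w ∈ orbit G (-z) := by
  have h : ∀ g : SUGroup n, act g (-z) = -act g z := fun g => by
    rw [← neg_one_smul ℂ, act_smul, neg_one_smul]
  exact ⟨fun ⟨g, hg, h'⟩ => ⟨g, hg, by rw [h, ← h', neg_neg]⟩,
    fun ⟨g, hg, h'⟩ => ⟨g, hg, by rw [h', h, neg_neg]⟩⟩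

theorem orbit_eq_of_mem {n : ℕ} {G : Subgroup (SUGroup n)} {z w : CSpace n}
    (h : w ∈ orbit G z) : orbit G w = orbit G z := by
  obtain ⟨g, hg, rfl⟩ := h
  ext x
  constructor
  · rintro ⟨h, hh, rfl⟩
    exact ⟨h * g, G.mul_mem hh hg, (act_mul h g z).symm⟩
  · rintro ⟨h, hh, rfl⟩
    exact ⟨h * g⁻¹, G.mul_mem hh (G.inv_mem hg), by rw [act_mul, act_inv_act]⟩

/-- Two orbits are disjoint or equal. The union is the link for the line ansatz once negative y is
folded onto positive y. -/
theorem isSpecialLegendrian_orbit_union_neg {G : Subgroup (SUGroup (k + 1))}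
    (hG : IsCompact (G : Set (SUGroup (k + 1)))) {z : CSpace (k + 1)} (hz : momentMap G z = 0)
    {τ : Fin k → CSpace (k + 1)} (hτ : Orthonormal ℝ τ)
    (hspan : Submodule.span ℝ (range τ) = orbitTangent G z) {ε : ℂ} (hε : ε = 1 ∨ ε = -1)
    (hdet : holVolForm (Fin.snoc (α := fun _ => CSpace (k + 1)) τ z) = ε) :
    IsSpecialLegendrian (orbit G z ∪ orbit G (-z)) := by
  have h1 := isSpecialLegendrian_orbit hG hz hτ hspan hε hdet
  by_cases hd : Disjoint (orbit G z) (orbit G (-z))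
  · exact h1.union (isSpecialLegendrian_orbit_neg hG hz hτ hspan hε hdet) hd
  · obtain ⟨w, hw, hw'⟩ := not_disjoint_iff.1 hd
    rw [← orbit_eq_of_mem hw', orbit_eq_of_mem hw, union_self]
    exact h1

end Links

/-! ### Profile curves: constant phase, β, monotonicity and properness. -/

section Curves

open Set Filter Topology

/-- A smooth curve on an open interval around `0` for which `γ^k γ'` has constant phase. -/
structure IsProfileCurve (k : ℕ) (J : Set ℝ) (γ : ℝ → ℂ) : Prop where
  isOpen : IsOpen J
  ordConnected : J.OrdConnected
  zero_mem : (0 : ℝ) ∈ J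
  smooth : ContDiffOn ℝ ∞ γ J
  phase : ∃ θ : ℝ, ∀ s ∈ J, ∃ r : ℝ, γ s ^ k * deriv γ s = r * Complex.exp (θ * Complex.I)

theorem hasDerivAt_primitive {J : Set ℝ} (hJ : IsOpen J) (hJc : J.OrdConnected)
    (h0 : (0 : ℝ) ∈ J) {f : ℝ → ℝ} (hf : ContinuousOn f J) {s : ℝ} (hs : s ∈ J) :
    HasDerivAt (fun s => ∫ t in (0 : ℝ)..s, f t) (f s) s :=
  intervalIntegral.integral_hasDerivAt_right
    ((hf.mono (hJc.uIcc_subset h0 hs)).intervalIntegrable)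
    (hf.stronglyMeasurableAtFilter hJ s hs) (hf.continuousAt (hJ.mem_nhds hs))

theorem contDiffOn_primitive {J : Set ℝ} (hJ : IsOpen J) (hJc : J.OrdConnected)
    (h0 : (0 : ℝ) ∈ J) {f : ℝ → ℝ} (hf : ContDiffOn ℝ ∞ f J) :
    ContDiffOn ℝ ∞ (fun s => ∫ t in (0 : ℝ)..s, f t) J := by
  rw [contDiffOn_infty_iff_deriv_of_isOpen hJ]
  have h := fun s (hs : s ∈ J) => hasDerivAt_primitive hJ hJc h0 hf.continuousOn hs
  exact ⟨fun s hs => (h s hs).differentiableAt.differentiableWithinAt,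
    hf.congr fun s hs => (h s hs).deriv⟩

variable {k : ℕ} {J : Set ℝ} {γ : ℝ → ℂ}

theorem IsProfileCurve.hasDerivAt (h : IsProfileCurve k J γ) {s : ℝ} (hs : s ∈ J) :
    HasDerivAt γ (deriv γ s) s :=
  ((h.smooth.contDiffAt (h.isOpen.mem_nhds hs)).differentiableAt (by simp)).hasDerivAt

theorem IsProfileCurve.smooth_deriv (h : IsProfileCurve k J γ) : ContDiffOn ℝ ∞ (deriv γ) J :=
  h.smooth.deriv_of_isOpen h.isOpen le_rfl

theorem IsProfileCurve.smooth_conj_mul_deriv (h : IsProfileCurve k J γ) :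
    ContDiffOn ℝ ∞ (fun s => starRingEnd ℂ (γ s) * deriv γ s) J :=
  (Complex.conjCLE.contDiff.comp_contDiffOn h.smooth).mul h.smooth_deriv

theorem betaFun_eq (γ : ℝ → ℂ) :
    betaFun γ = fun s => ∫ t in (0 : ℝ)..s, (starRingEnd ℂ (γ t) * deriv γ t).im := by
  funext s
  rw [betaFun, ← intervalIntegral.integral_neg]
  refine intervalIntegral.integral_congr fun t _ => ?_
  simp only [Complex.mul_re, Complex.mul_im, Complex.I_re, Complex.I_im]
  ring

theorem IsProfileCurve.hasDerivAt_betaFun (h : IsProfileCurve k J γ) {s : ℝ} (hs : s ∈ J) :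
    HasDerivAt (betaFun γ) (starRingEnd ℂ (γ s) * deriv γ s).im s := by
  rw [betaFun_eq]
  exact hasDerivAt_primitive h.isOpen h.ordConnected h.zero_mem
    (Complex.continuous_im.comp_continuousOn h.smooth_conj_mul_deriv.continuousOn) hs

theorem IsProfileCurve.smooth_betaFun (h : IsProfileCurve k J γ) :
    ContDiffOn ℝ ∞ (betaFun γ) J := by
  rw [betaFun_eq]
  exact contDiffOn_primitive h.isOpen h.ordConnected h.zero_mem
    (Complex.imCLM.contDiff.comp_contDiffOn h.smooth_conj_mul_deriv)

theorem betaFun_zero (γ : ℝ → ℂ) : betaFun γ 0 = 0 := by simp [betaFun]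

/-- `1/2 |γ|^2`. -/
noncomputable def halfNormSq (γ : ℝ → ℂ) (s : ℝ) : ℝ := 1 / 2 * ‖γ s‖ ^ 2

theorem IsProfileCurve.smooth_halfNormSq (h : IsProfileCurve k J γ) :
    ContDiffOn ℝ ∞ (halfNormSq γ) J :=
  contDiffOn_const.mul (h.smooth.norm_sq ℝ)

theorem IsProfileCurve.hasDerivAt_halfNormSq (h : IsProfileCurve k J γ) {s : ℝ} (hs : s ∈ J) :
    HasDerivAt (halfNormSq γ) (starRingEnd ℂ (γ s) * deriv γ s).re s := by
  have := ((h.hasDerivAt hs).norm_sq).const_mul (1 / 2)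
  refine this.congr_deriv ?_
  rw [Complex.inner]
  ring_nf

/-- A primitive of `Im (conj b b')` for `b = 1/2 |γ|^2 + i β_γ`. -/
noncomputable def selfAction (γ : ℝ → ℂ) (s : ℝ) : ℝ :=
  ∫ t in (0 : ℝ)..s, (halfNormSq γ t * (starRingEnd ℂ (γ t) * deriv γ t).im -
    betaFun γ t * (starRingEnd ℂ (γ t) * deriv γ t).re)

theorem IsProfileCurve.smooth_selfAction_integrand (h : IsProfileCurve k J γ) :
    ContDiffOn ℝ ∞ (fun t => halfNormSq γ t * (starRingEnd ℂ (γ t) * deriv γ t).im -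
      betaFun γ t * (starRingEnd ℂ (γ t) * deriv γ t).re) J :=
  (h.smooth_halfNormSq.mul (Complex.imCLM.contDiff.comp_contDiffOn h.smooth_conj_mul_deriv)).sub
    (h.smooth_betaFun.mul (Complex.reCLM.contDiff.comp_contDiffOn h.smooth_conj_mul_deriv))

theorem IsProfileCurve.smooth_selfAction (h : IsProfileCurve k J γ) :
    ContDiffOn ℝ ∞ (selfAction γ) J :=
  contDiffOn_primitive h.isOpen h.ordConnected h.zero_mem h.smooth_selfAction_integrand

theorem IsProfileCurve.hasDerivAt_selfAction (h : IsProfileCurve k J γ) {s : ℝ} (hs : s ∈ J) :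
    HasDerivAt (selfAction γ) (halfNormSq γ s * (starRingEnd ℂ (γ s) * deriv γ s).im -
      betaFun γ s * (starRingEnd ℂ (γ s) * deriv γ s).re) s :=
  hasDerivAt_primitive h.isOpen h.ordConnected h.zero_mem
    h.smooth_selfAction_integrand.continuousOn hs

/-! ### The line -/

theorem hasDerivAt_lineCurve (φ s : ℝ) :
    HasDerivAt (lineCurve φ) (Complex.exp (φ * Complex.I)) s := by
  have := (hasDerivAt_id s).ofReal_comp.const_mul (Complex.exp (φ * Complex.I))
  change HasDerivAt (fun s : ℝ => Complex.exp (φ * Complex.I) * (s : ℂ)) _ s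
  simpa using this

theorem deriv_lineCurve (φ s : ℝ) : deriv (lineCurve φ) s = Complex.exp (φ * Complex.I) :=
  (hasDerivAt_lineCurve φ s).deriv

theorem isProfileCurve_lineCurve (k : ℕ) (φ : ℝ) : IsProfileCurve k univ (lineCurve φ) where
  isOpen := isOpen_univ
  ordConnected := ordConnected_univ
  zero_mem := mem_univ _
  smooth := (contDiff_const.mul Complex.ofRealCLM.contDiff).contDiffOn
  phase := by
    -- Here γ^k γ' = s^k e^{i(k+1)φ}; the real factor may be zero or negative.
    refine ⟨(k + 1) * φ, fun s _ => ⟨s ^ k, ?_⟩⟩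
    rw [deriv_lineCurve, lineCurve, mul_pow, ← Complex.exp_nat_mul, mul_right_comm,
      ← Complex.exp_add, mul_comm]
    push_cast
    ring_nf

theorem norm_lineCurve (φ s : ℝ) : ‖lineCurve φ s‖ = |s| := by
  rw [lineCurve, norm_mul, Complex.norm_exp_ofReal_mul_I, one_mul, Complex.norm_real,
    Real.norm_eq_abs]

theorem betaFun_lineCurve (φ s : ℝ) : betaFun (lineCurve φ) s = 0 := by
  have : ∀ t : ℝ, (starRingEnd ℂ (lineCurve φ t) * deriv (lineCurve φ) t).im = 0 := fun t => by
    rw [deriv_lineCurve, lineCurve, map_mul, Complex.conj_ofReal, mul_right_comm,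
      ← Complex.normSq_eq_conj_mul_self, ← Complex.ofReal_mul, Complex.ofReal_im]
  simp [betaFun_eq, this]

/-! ### The Lawlor neck -/

theorem cos_pos_of_mem_lawlorInterval {s : ℝ} (hs : s ∈ lawlorInterval (k + 1)) :
    |((k + 1 : ℕ) : ℝ) * s| < Real.pi / 2 ∧ 0 < Real.cos ((k + 1 : ℕ) * s) := by
  have hn : (0 : ℝ) < (k + 1 : ℕ) := by positivity
  have h : |((k + 1 : ℕ) : ℝ) * s| < Real.pi / 2 := by
    have h1 : |s| < Real.pi / (2 * (k + 1 : ℕ)) := abs_lt.2 hs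
    rw [abs_mul, abs_of_pos hn]
    calc ((k + 1 : ℕ) : ℝ) * |s| < (k + 1 : ℕ) * (Real.pi / (2 * (k + 1 : ℕ))) := by gcongr
      _ = Real.pi / 2 := by field_simp
  exact ⟨h, Real.cos_pos_of_mem_Ioo (abs_lt.1 h)⟩

theorem neg_mem_lawlorInterval {n : ℕ} {s : ℝ} (hs : s ∈ lawlorInterval n) :
    -s ∈ lawlorInterval n := ⟨neg_lt_neg hs.2, by linarith [hs.1]⟩

variable {φ μ : ℝ} {s : ℝ}

/-- The logarithmic derivative of the neck is tan(ns) + i: the power of the cosine gives the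
tangent, the rotation gives i. -/
theorem hasDerivAt_lawlorCurve (φ μ : ℝ) (hs : s ∈ lawlorInterval (k + 1)) :
    HasDerivAt (lawlorCurve (k + 1) φ μ)
      (lawlorCurve (k + 1) φ μ s * (Real.tan ((k + 1 : ℕ) * s) + Complex.I)) s := by
  have hc := (cos_pos_of_mem_lawlorInterval hs).2
  have hn : ((k + 1 : ℕ) : ℝ) ≠ 0 := by positivity
  have h1 : HasDerivAt (fun s : ℝ => Real.cos ((k + 1 : ℕ) * s) ^ (-(1 / ((k + 1 : ℕ) : ℝ))))
      (Real.cos ((k + 1 : ℕ) * s) ^ (-(1 / ((k + 1 : ℕ) : ℝ))) * Real.tan ((k + 1 : ℕ) * s)) s := by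
    have h := (((hasDerivAt_id s).const_mul ((k + 1 : ℕ) : ℝ)).cos).rpow_const
      (p := -(1 / ((k + 1 : ℕ) : ℝ))) (Or.inl hc.ne')
    refine h.congr_deriv ?_
    simp only [id, mul_one]
    rw [Real.rpow_sub_one hc.ne', Real.tan_eq_sin_div_cos]
    field_simp
  have h2 : HasDerivAt (fun s : ℝ => Complex.exp (s * Complex.I))
      (Complex.exp (s * Complex.I) * Complex.I) s := by
    have := ((hasDerivAt_id s).ofReal_comp.mul_const Complex.I).cexp
    simpa using this
  have h3 := (h1.ofReal_comp.mul h2).const_mul (Complex.exp (φ * Complex.I) * (μ : ℂ))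
  refine h3.congr_deriv ?_
  rw [lawlorCurve, lawlor]
  push_cast
  ring

/-- Since e^{it} / cos t = 1 + i tan t, the n-th power of the neck runs along a straight line. This
is why γ^(n-1) γ' has constant phase. -/
theorem lawlorCurve_pow (φ μ : ℝ) (hs : s ∈ lawlorInterval (k + 1)) :
    lawlorCurve (k + 1) φ μ s ^ (k + 1) = Complex.exp (((k + 1) * φ : ℝ) * Complex.I) *
      ((μ ^ (k + 1) / Real.cos ((k + 1 : ℕ) * s) : ℝ) : ℂ) *
      Complex.exp (((k + 1 : ℕ) * s : ℝ) * Complex.I) := by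
  have hc := (cos_pos_of_mem_lawlorInterval hs).2
  have hn : ((k + 1 : ℕ) : ℝ) ≠ 0 := by positivity
  have h : (Real.cos ((k + 1 : ℕ) * s) ^ (-(1 / ((k + 1 : ℕ) : ℝ)))) ^ (k + 1)
      = (Real.cos ((k + 1 : ℕ) * s))⁻¹ := by
    rw [← Real.rpow_natCast, ← Real.rpow_mul hc.le, neg_mul, one_div, inv_mul_cancel₀ hn,
      Real.rpow_neg_one]
  rw [lawlorCurve, lawlor, mul_pow, mul_pow, mul_pow, ← Complex.exp_nat_mul, ← Complex.exp_nat_mul,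
    ← Complex.ofReal_pow, ← Complex.ofReal_pow, h, div_eq_mul_inv, Complex.ofReal_mul]
  push_cast
  ring_nf

theorem norm_lawlorCurve (hμ : 0 < μ) (hs : s ∈ lawlorInterval (k + 1)) :
    ‖lawlorCurve (k + 1) φ μ s‖ ^ (k + 1) * Real.cos ((k + 1 : ℕ) * s) = μ ^ (k + 1) := by
  have hc := (cos_pos_of_mem_lawlorInterval hs).2
  rw [← norm_pow, lawlorCurve_pow φ μ hs, norm_mul, norm_mul, Complex.norm_exp_ofReal_mul_I,
    Complex.norm_exp_ofReal_mul_I, Complex.norm_real, Real.norm_of_nonneg (by positivity)]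
  field_simp

theorem le_norm_lawlorCurve (hμ : 0 < μ) (hs : s ∈ lawlorInterval (k + 1)) :
    μ ≤ ‖lawlorCurve (k + 1) φ μ s‖ := by
  have hc := (cos_pos_of_mem_lawlorInterval hs).2
  refine (pow_le_pow_iff_left₀ hμ.le (norm_nonneg _) k.succ_ne_zero).1 ?_
  rw [← norm_lawlorCurve (φ := φ) hμ hs]
  exact mul_le_of_le_one_right (by positivity) (Real.cos_le_one _)

theorem lawlorCurve_ne_zero (hμ : 0 < μ) (hs : s ∈ lawlorInterval (k + 1)) :
    lawlorCurve (k + 1) φ μ s ≠ 0 :=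
  norm_pos_iff.1 (hμ.trans_le (le_norm_lawlorCurve hμ hs))

theorem deriv_lawlorCurve_ne_zero (hμ : 0 < μ) (hs : s ∈ lawlorInterval (k + 1)) :
    deriv (lawlorCurve (k + 1) φ μ) s ≠ 0 := by
  rw [(hasDerivAt_lawlorCurve φ μ hs).deriv]
  refine mul_ne_zero (lawlorCurve_ne_zero hμ hs) fun h => ?_
  have := congrArg Complex.im h
  rw [Complex.add_im, Complex.ofReal_im, Complex.I_im, zero_add, Complex.zero_im] at this
  exact one_ne_zero this

theorem tan_add_I {t : ℝ} (ht : Real.cos t ≠ 0) :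
    Complex.exp (t * Complex.I) * (Real.tan t + Complex.I)
      = ((Real.cos t)⁻¹ : ℝ) * Complex.I := by
  rw [Complex.exp_mul_I, ← Complex.ofReal_cos, ← Complex.ofReal_sin, Real.tan_eq_sin_div_cos]
  have h := Real.sin_sq_add_cos_sq t
  generalize Real.cos t = c at *
  generalize Real.sin t = d at *
  apply Complex.ext
  · simp only [Complex.mul_re, Complex.add_re, Complex.add_im, Complex.mul_im, Complex.ofReal_re,
      Complex.ofReal_im, Complex.I_re, Complex.I_im]
    field_simp
    ring
  · simp only [Complex.mul_re, Complex.add_re, Complex.add_im, Complex.mul_im, Complex.ofReal_re,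
      Complex.ofReal_im, Complex.I_re, Complex.I_im]
    field_simp
    linarith

theorem isProfileCurve_lawlorCurve (k : ℕ) (φ μ : ℝ) :
    IsProfileCurve k (lawlorInterval (k + 1)) (lawlorCurve (k + 1) φ μ) where
  isOpen := isOpen_Ioo
  ordConnected := ordConnected_Ioo
  zero_mem := by
    have : 0 < Real.pi / (2 * (k + 1 : ℕ)) := by positivity
    exact ⟨by linarith, this⟩
  smooth := by
    refine contDiffOn_const.mul (ContDiffOn.mul ?_ ?_)
    · refine Complex.ofRealCLM.contDiff.comp_contDiffOn (ContDiffOn.rpow_const_of_ne ?_ fun s hs =>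
        (cos_pos_of_mem_lawlorInterval hs).2.ne')
      exact (Real.contDiff_cos.comp (contDiff_const.mul contDiff_id)).contDiffOn
    · exact (Complex.contDiff_exp.comp
        (Complex.ofRealCLM.contDiff.mul contDiff_const)).contDiffOn
  phase := by
    -- The line traced by γ^(k+1) points along i e^{i(k+1)φ}, hence the extra right angle.
    refine ⟨(k + 1) * φ + Real.pi / 2, fun s hs =>
      ⟨μ ^ (k + 1) / Real.cos ((k + 1 : ℕ) * s) ^ 2, ?_⟩⟩
    have hc := (cos_pos_of_mem_lawlorInterval hs).2
    rw [(hasDerivAt_lawlorCurve φ μ hs).deriv, ← mul_assoc, ← pow_succ, lawlorCurve_pow φ μ hs,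
      mul_assoc _ (Complex.exp (((k + 1 : ℕ) * s : ℝ) * Complex.I)), tan_add_I hc.ne']
    have hE : Complex.exp (((k + 1) * φ + Real.pi / 2 : ℝ) * Complex.I)
        = Complex.exp (((k + 1) * φ : ℝ) * Complex.I) * Complex.I := by
      rw [Complex.ofReal_add, add_mul, Complex.exp_add]
      congr 1
      push_cast
      exact Complex.exp_pi_div_two_mul_I
    rw [hE]
    generalize Complex.exp (((k + 1) * φ : ℝ) * Complex.I) = E
    push_cast
    ring

/-- The logarithmic derivative has imaginary part 1. So β' = |γ|² > 0, which yields strict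
monotonicity of β, and oddness as |γ| is even. -/
theorem conj_mul_deriv_lawlorCurve (φ μ : ℝ) (hs : s ∈ lawlorInterval (k + 1)) :
    (starRingEnd ℂ (lawlorCurve (k + 1) φ μ s) * deriv (lawlorCurve (k + 1) φ μ) s).im
      = ‖lawlorCurve (k + 1) φ μ s‖ ^ 2 := by
  rw [(hasDerivAt_lawlorCurve φ μ hs).deriv, ← mul_assoc, ← Complex.normSq_eq_conj_mul_self,
    Complex.normSq_eq_norm_sq, Complex.im_ofReal_mul,
    Complex.add_im, Complex.ofReal_im, Complex.I_im, zero_add, mul_one]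

theorem strictMonoOn_betaFun_lawlorCurve (hμ : 0 < μ) :
    StrictMonoOn (betaFun (lawlorCurve (k + 1) φ μ)) (lawlorInterval (k + 1)) := by
  have h := isProfileCurve_lawlorCurve k φ μ
  refine strictMonoOn_of_deriv_pos (convex_Ioo _ _) h.smooth_betaFun.continuousOn fun s hs => ?_
  have hs' : s ∈ lawlorInterval (k + 1) := interior_subset hs
  rw [(h.hasDerivAt_betaFun hs').deriv, conj_mul_deriv_lawlorCurve φ μ hs']
  have := hμ.trans_le (le_norm_lawlorCurve (φ := φ) hμ hs')
  positivity

theorem norm_lawlorCurve_neg (s : ℝ) :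
    ‖lawlorCurve (k + 1) φ μ (-s)‖ = ‖lawlorCurve (k + 1) φ μ s‖ := by
  have h : ∀ t : ℝ, ‖Complex.exp (t * Complex.I)‖ = 1 := Complex.norm_exp_ofReal_mul_I
  simp only [lawlorCurve, lawlor, norm_mul, h, mul_neg, Real.cos_neg]

theorem betaFun_lawlorCurve_neg (hs : s ∈ lawlorInterval (k + 1)) :
    betaFun (lawlorCurve (k + 1) φ μ) (-s) = -betaFun (lawlorCurve (k + 1) φ μ) s := by
  have h := isProfileCurve_lawlorCurve k φ μ
  have e : ∀ t ∈ lawlorInterval (k + 1), betaFun (lawlorCurve (k + 1) φ μ) t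
      = ∫ u in (0 : ℝ)..t, ‖lawlorCurve (k + 1) φ μ u‖ ^ 2 := fun t ht => by
    rw [betaFun_eq]
    exact intervalIntegral.integral_congr fun u hu =>
      conj_mul_deriv_lawlorCurve φ μ (h.ordConnected.uIcc_subset h.zero_mem ht hu)
  rw [e _ hs, e _ (neg_mem_lawlorInterval hs), intervalIntegral.integral_symm]
  have := intervalIntegral.integral_comp_neg (a := 0) (b := s)
    (fun u => ‖lawlorCurve (k + 1) φ μ u‖ ^ 2)
  rw [neg_zero] at this
  rw [← this]
  simp only [norm_lawlorCurve_neg]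

/-- From |γ|ⁿ cos(ns) = μⁿ the modulus determines the cosine, which is injective in |ns| < π/2. -/
theorem abs_eq_of_norm_lawlorCurve_eq (hμ : 0 < μ) {t : ℝ} (hs : s ∈ lawlorInterval (k + 1))
    (ht : t ∈ lawlorInterval (k + 1))
    (h : ‖lawlorCurve (k + 1) φ μ s‖ = ‖lawlorCurve (k + 1) φ μ t‖) : |s| = |t| := by
  have hn : (0 : ℝ) < (k + 1 : ℕ) := by positivity
  have h1 := norm_lawlorCurve (φ := φ) hμ hs
  rw [h, ← norm_lawlorCurve (φ := φ) hμ ht] at h1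
  have hpos : 0 < ‖lawlorCurve (k + 1) φ μ t‖ ^ (k + 1) :=
    pow_pos (hμ.trans_le (le_norm_lawlorCurve hμ ht)) _
  have h2 := mul_left_cancel₀ hpos.ne' h1
  rw [← Real.cos_abs, ← Real.cos_abs ((k + 1 : ℕ) * t)] at h2
  have h3 := Real.injOn_cos ⟨abs_nonneg _, by
    linarith [(cos_pos_of_mem_lawlorInterval hs).1, Real.pi_pos]⟩ ⟨abs_nonneg _, by
    linarith [(cos_pos_of_mem_lawlorInterval ht).1, Real.pi_pos]⟩ h2
  rw [abs_mul, abs_mul, abs_of_pos hn] at h3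
  exact mul_left_cancel₀ hn.ne' h3

theorem exists_isCompact_norm_lawlorCurve_le (φ : ℝ) (hμ : 0 < μ) (A : ℝ) :
    ∃ C ⊆ lawlorInterval (k + 1), IsCompact C ∧
      ∀ s ∈ lawlorInterval (k + 1), ‖lawlorCurve (k + 1) φ μ s‖ ≤ A → s ∈ C := by
  let a : ℝ := Real.pi / (2 * (k + 1 : ℕ))
  have hn : (0 : ℝ) < (k + 1 : ℕ) := by positivity
  have hna : ((k + 1 : ℕ) : ℝ) * a = Real.pi / 2 := by simp only [a]; field_simp
  -- Multiplying the bound by the cosine gives a closed condition on the closed interval. It fails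
  -- at both ends, where the cosine vanishes while μ > 0.
  refine ⟨Icc (-a) a ∩ {s | μ ^ (k + 1) ≤ A ^ (k + 1) * Real.cos ((k + 1 : ℕ) * s)}, ?_, ?_, ?_⟩
  · rintro s ⟨⟨h1, h2⟩, h3⟩
    have hpos : 0 < A ^ (k + 1) * Real.cos ((k + 1 : ℕ) * s) := (pow_pos hμ _).trans_le h3
    refine ⟨lt_of_le_of_ne h1 ?_, lt_of_le_of_ne h2 ?_⟩
    · rintro h
      rw [← h, mul_neg, hna, Real.cos_neg, Real.cos_pi_div_two, mul_zero] at hpos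
      exact hpos.false
    · rintro h
      rw [h, hna, Real.cos_pi_div_two, mul_zero] at hpos
      exact hpos.false
  · exact isCompact_Icc.inter_right (isClosed_le continuous_const (by fun_prop))
  · intro s hs hA
    refine ⟨⟨hs.1.le, hs.2.le⟩, ?_⟩
    rw [mem_ofPred, ← norm_lawlorCurve (φ := φ) hμ hs]
    have := (cos_pos_of_mem_lawlorInterval hs).2.le
    gcongr

theorem lawlor_neg (n : ℕ) (s : ℝ) :
    lawlor n (-s) = Complex.exp (-(2 * s : ℝ) * Complex.I) * lawlor n s := by
  rw [lawlor, lawlor, mul_neg, Real.cos_neg, mul_left_comm, ← Complex.exp_add]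
  push_cast
  ring_nf

end Curves

/-! ### Derivative, potential and volume of the ansatz map. -/

section Ansatz

open Set Filter Topology

/-- `joinC` as a continuous real-linear map. -/
noncomputable def joinL (n : ℕ) : CSpace n × ℂ →L[ℝ] CSpace (n + 1) :=
  LinearMap.toContinuousLinearMap
    { toFun := fun p => joinC p.1 p.2
      map_add' := fun p q => by
        ext i
        refine Fin.lastCases ?_ (fun i => ?_) i <;> simp [joinC]
      map_smul' := fun c p => by
        ext i
        refine Fin.lastCases ?_ (fun i => ?_) i <;> simp [joinC] }

theorem joinL_apply {n : ℕ} (p : CSpace n × ℂ) : joinL n p = joinC p.1 p.2 := rfl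

theorem joinC_castSucc {n : ℕ} (z : CSpace n) (w : ℂ) (i : Fin n) :
    joinC z w i.castSucc = z i := by simp [joinC]

theorem joinC_last {n : ℕ} (z : CSpace n) (w : ℂ) : joinC z w (Fin.last n) = w := by simp [joinC]

theorem joinC_inj {n : ℕ} {z z' : CSpace n} {w w' : ℂ} :
    joinC z w = joinC z' w' ↔ z = z' ∧ w = w' := by
  refine ⟨fun h => ⟨?_, ?_⟩, fun ⟨h, h'⟩ => by rw [h, h']⟩
  · ext i; rw [← joinC_castSucc z w, h, joinC_castSucc]
  · rw [← joinC_last z w, h, joinC_last]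

theorem inner_joinC {n : ℕ} (z z' : CSpace n) (w w' : ℂ) :
    inner ℂ (joinC z w) (joinC z' w') = inner ℂ z z' + starRingEnd ℂ w * w' := by
  rw [PiLp.inner_apply, Fin.sum_univ_castSucc, PiLp.inner_apply]
  simp only [joinC_castSucc, joinC_last]
  simp [mul_comm]

variable {k : ℕ} {J₁ J₂ I₁ I₂ : Set ℝ} {γ ξ : ℝ → ℂ}

/-- The definition of β is made so that ½|γ|² + iβ_γ has derivative exactly conj(γ) γ'; likewise for
ξ. -/
theorem exists_hasFDerivAt_ansatzQuotMap {n : ℕ} (hγ : IsProfileCurve k J₁ γ) (hξ : IsProfileCurve k J₂ ξ)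
    {q : CSpace n × ℝ × ℝ} (h₁ : q.2.1 ∈ J₁) (h₂ : q.2.2 ∈ J₂) :
    ∃ L : CSpace n × ℝ × ℝ →L[ℝ] CSpace (n + 1), HasFDerivAt (ansatzQuotMap γ ξ) L q ∧
      ∀ v, L v = joinC ((γ q.2.1 * ξ q.2.2) • v.1 +
          (v.2.1 * (deriv γ q.2.1 * ξ q.2.2) + v.2.2 * (γ q.2.1 * deriv ξ q.2.2) : ℂ) • q.1)
        (-v.2.1 * (starRingEnd ℂ (γ q.2.1) * deriv γ q.2.1) +
          v.2.2 * (starRingEnd ℂ (ξ q.2.2) * deriv ξ q.2.2)) := by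
  have X : HasFDerivAt (fun q : CSpace n × ℝ × ℝ => q.2.1) _ q :=
    (hasFDerivAt_fst (𝕜 := ℝ) (p := q.2)).comp q (hasFDerivAt_snd (p := q))
  have Y : HasFDerivAt (fun q : CSpace n × ℝ × ℝ => q.2.2) _ q :=
    (hasFDerivAt_snd (𝕜 := ℝ) (p := q.2)).comp q (hasFDerivAt_snd (p := q))
  have g := (hγ.hasDerivAt h₁).hasFDerivAt.comp q X
  have x := (hξ.hasDerivAt h₂).hasFDerivAt.comp q Y
  have bg := (hγ.hasDerivAt_betaFun h₁).hasFDerivAt.comp q X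
  have bx := (hξ.hasDerivAt_betaFun h₂).hasFDerivAt.comp q Y
  have ng := (hγ.hasDerivAt_halfNormSq h₁).hasFDerivAt.comp q X
  have nx := (hξ.hasDerivAt_halfNormSq h₂).hasFDerivAt.comp q Y
  have c1 := (g.mul x).smul (hasFDerivAt_fst (𝕜 := ℝ) (p := q))
  have c2 := (Complex.ofRealCLM.hasFDerivAt.comp q (nx.sub ng)).add
    ((Complex.ofRealCLM.hasFDerivAt.comp q (bx.sub bg)).const_mul Complex.I)
  have hc := (joinL n).hasFDerivAt.comp q (c1.prodMk c2)
  refine ⟨_, hc.congr_of_eventuallyEq (Eventually.of_forall fun r => ?_), fun v => ?_⟩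
  · simp only [ansatzQuotMap, profileFst, profileSnd, Function.comp_apply, joinL_apply, mul_sub]
    rfl
  · simp only [ContinuousLinearMap.comp_apply, joinL_apply]
    rw [joinC_inj]
    constructor
    · simp [add_smul]
      ring_nf
      abel
    · simp
      apply Complex.ext
      · simp; ring
      · simp; ring

theorem fderiv_ansatzQuotMap {n : ℕ} (hγ : IsProfileCurve k J₁ γ) (hξ : IsProfileCurve k J₂ ξ)
    {q : CSpace n × ℝ × ℝ} (h₁ : q.2.1 ∈ J₁) (h₂ : q.2.2 ∈ J₂) (v : CSpace n × ℝ × ℝ) :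
    fderiv ℝ (ansatzQuotMap γ ξ) q v = joinC ((γ q.2.1 * ξ q.2.2) • v.1 +
          (v.2.1 * (deriv γ q.2.1 * ξ q.2.2) + v.2.2 * (γ q.2.1 * deriv ξ q.2.2) : ℂ) • q.1)
        (-v.2.1 * (starRingEnd ℂ (γ q.2.1) * deriv γ q.2.1) +
          v.2.2 * (starRingEnd ℂ (ξ q.2.2) * deriv ξ q.2.2)) := by
  obtain ⟨L, hL, hLv⟩ := exists_hasFDerivAt_ansatzQuotMap hγ hξ h₁ h₂
  rw [hL.fderiv, hLv]

theorem hasFDerivAt_ansatzQuotMap {n : ℕ} (hγ : IsProfileCurve k J₁ γ)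
    (hξ : IsProfileCurve k J₂ ξ) {q : CSpace n × ℝ × ℝ} (h₁ : q.2.1 ∈ J₁) (h₂ : q.2.2 ∈ J₂) :
    HasFDerivAt (ansatzQuotMap γ ξ) (fderiv ℝ (ansatzQuotMap γ ξ) q) q := by
  obtain ⟨L, hL, -⟩ := exists_hasFDerivAt_ansatzQuotMap hγ hξ h₁ h₂
  exact hL.differentiableAt.hasFDerivAt

theorem contDiffOn_ansatzQuotMap {n : ℕ} (hγ : IsProfileCurve k J₁ γ)
    (hξ : IsProfileCurve k J₂ ξ) :
    ContDiffOn ℝ ∞ (ansatzQuotMap (n := n) γ ξ) (univ ×ˢ J₁ ×ˢ J₂) := by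
  have X : ContDiffOn ℝ ∞ (fun q : CSpace n × ℝ × ℝ => q.2.1) (univ ×ˢ J₁ ×ˢ J₂) :=
    (contDiff_fst.comp contDiff_snd).contDiffOn
  have Y : ContDiffOn ℝ ∞ (fun q : CSpace n × ℝ × ℝ => q.2.2) (univ ×ˢ J₁ ×ˢ J₂) :=
    (contDiff_snd.comp contDiff_snd).contDiffOn
  have mX : MapsTo (fun q : CSpace n × ℝ × ℝ => q.2.1) (univ ×ˢ J₁ ×ˢ J₂) J₁ := fun q hq => hq.2.1
  have mY : MapsTo (fun q : CSpace n × ℝ × ℝ => q.2.2) (univ ×ˢ J₁ ×ˢ J₂) J₂ := fun q hq => hq.2.2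
  have c1 := ((hγ.smooth.comp X mX).mul (hξ.smooth.comp Y mY)).smul
    (contDiff_fst (𝕜 := ℝ) (E := CSpace n) (F := ℝ × ℝ)).contDiffOn
  have c2 := (Complex.ofRealCLM.contDiff.comp_contDiffOn
    ((hξ.smooth_halfNormSq.comp Y mY).sub (hγ.smooth_halfNormSq.comp X mX))).add
    (contDiffOn_const (c := Complex.I) |>.mul (Complex.ofRealCLM.contDiff.comp_contDiffOn
    ((hξ.smooth_betaFun.comp Y mY).sub (hγ.smooth_betaFun.comp X mX))))
  refine ((joinL n).contDiff.comp_contDiffOn (c1.prodMk c2)).congr fun r _ => ?_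
  simp only [ansatzQuotMap, profileFst, profileSnd, Function.comp_apply, joinL_apply, mul_sub]
  rfl

/-- A primitive of the pullback of the Liouville form under the ansatz map. -/
noncomputable def ansatzPotential {n : ℕ} (γ ξ : ℝ → ℂ) (q : CSpace n × ℝ × ℝ) : ℝ :=
  halfNormSq ξ q.2.2 * betaFun γ q.2.1 + halfNormSq γ q.2.1 * betaFun ξ q.2.2 +
    selfAction γ q.2.1 + selfAction ξ q.2.2

theorem contDiffOn_ansatzPotential {n : ℕ} (hγ : IsProfileCurve k J₁ γ)
    (hξ : IsProfileCurve k J₂ ξ) :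
    ContDiffOn ℝ ∞ (ansatzPotential (n := n) γ ξ) (univ ×ˢ J₁ ×ˢ J₂) := by
  have X : ContDiffOn ℝ ∞ (fun q : CSpace n × ℝ × ℝ => q.2.1) (univ ×ˢ J₁ ×ˢ J₂) :=
    (contDiff_fst.comp contDiff_snd).contDiffOn
  have Y : ContDiffOn ℝ ∞ (fun q : CSpace n × ℝ × ℝ => q.2.2) (univ ×ˢ J₁ ×ˢ J₂) :=
    (contDiff_snd.comp contDiff_snd).contDiffOn
  have mX : MapsTo (fun q : CSpace n × ℝ × ℝ => q.2.1) (univ ×ˢ J₁ ×ˢ J₂) J₁ := fun q hq => hq.2.1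
  have mY : MapsTo (fun q : CSpace n × ℝ × ℝ => q.2.2) (univ ×ˢ J₁ ×ˢ J₂) J₂ := fun q hq => hq.2.2
  exact ((((hξ.smooth_halfNormSq.comp Y mY).mul (hγ.smooth_betaFun.comp X mX)).add
    ((hγ.smooth_halfNormSq.comp X mX).mul (hξ.smooth_betaFun.comp Y mY))).add
    (hγ.smooth_selfAction.comp X mX)).add (hξ.smooth_selfAction.comp Y mY)

theorem exists_hasFDerivAt_ansatzPotential {n : ℕ} (hγ : IsProfileCurve k J₁ γ)
    (hξ : IsProfileCurve k J₂ ξ) {q : CSpace n × ℝ × ℝ} (h₁ : q.2.1 ∈ J₁) (h₂ : q.2.2 ∈ J₂) :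
    ∃ L : CSpace n × ℝ × ℝ →L[ℝ] ℝ, HasFDerivAt (ansatzPotential γ ξ) L q ∧
      ∀ v, L v =
        v.2.1 * (halfNormSq ξ q.2.2 * (starRingEnd ℂ (γ q.2.1) * deriv γ q.2.1).im +
          (starRingEnd ℂ (γ q.2.1) * deriv γ q.2.1).re * betaFun ξ q.2.2 +
          (halfNormSq γ q.2.1 * (starRingEnd ℂ (γ q.2.1) * deriv γ q.2.1).im -
            betaFun γ q.2.1 * (starRingEnd ℂ (γ q.2.1) * deriv γ q.2.1).re)) +
        v.2.2 * (halfNormSq γ q.2.1 * (starRingEnd ℂ (ξ q.2.2) * deriv ξ q.2.2).im +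
          (starRingEnd ℂ (ξ q.2.2) * deriv ξ q.2.2).re * betaFun γ q.2.1 +
          (halfNormSq ξ q.2.2 * (starRingEnd ℂ (ξ q.2.2) * deriv ξ q.2.2).im -
            betaFun ξ q.2.2 * (starRingEnd ℂ (ξ q.2.2) * deriv ξ q.2.2).re)) := by
  have X : HasFDerivAt (fun q : CSpace n × ℝ × ℝ => q.2.1) _ q :=
    (hasFDerivAt_fst (𝕜 := ℝ) (p := q.2)).comp q (hasFDerivAt_snd (p := q))
  have Y : HasFDerivAt (fun q : CSpace n × ℝ × ℝ => q.2.2) _ q :=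
    (hasFDerivAt_snd (𝕜 := ℝ) (p := q.2)).comp q (hasFDerivAt_snd (p := q))
  have bg := (hγ.hasDerivAt_betaFun h₁).hasFDerivAt.comp q X
  have bx := (hξ.hasDerivAt_betaFun h₂).hasFDerivAt.comp q Y
  have ng := (hγ.hasDerivAt_halfNormSq h₁).hasFDerivAt.comp q X
  have nx := (hξ.hasDerivAt_halfNormSq h₂).hasFDerivAt.comp q Y
  have sg := (hγ.hasDerivAt_selfAction h₁).hasFDerivAt.comp q X
  have sx := (hξ.hasDerivAt_selfAction h₂).hasFDerivAt.comp q Y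
  have hc := (((nx.mul bg).add (ng.mul bx)).add sg).add sx
  refine ⟨_, hc, fun v => ?_⟩
  simp only [add_apply, smul_apply, ContinuousLinearMap.comp_apply,
    ContinuousLinearMap.toSpanSingleton_apply, ContinuousLinearMap.coe_fst',
    ContinuousLinearMap.coe_snd', smul_eq_mul, Function.comp_apply]
  ring

theorem inner_eq_zero_of_mem_span {n : ℕ} {τ : Fin k → CSpace n} {p v : CSpace n}
    (hτ : ∀ i, inner ℂ (τ i) p = 0) (hv : v ∈ Submodule.span ℝ (range τ)) : inner ℂ v p = 0 := by
  refine Submodule.span_induction ?_ ?_ ?_ ?_ hv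
  · rintro _ ⟨i, rfl⟩; exact hτ i
  · exact inner_zero_left _
  · intro x y _ _ hx hy; rw [inner_add_left, hx, hy, add_zero]
  · intro c x _ hx
    rw [← Complex.coe_smul, inner_smul_left, hx, mul_zero]

theorem im_inner_eq_zero_of_mem_span {n : ℕ} {τ : Fin k → CSpace n} {v w : CSpace n}
    (hτ : ∀ i j, (inner ℂ (τ i) (τ j)).im = 0) (hv : v ∈ Submodule.span ℝ (range τ))
    (hw : w ∈ Submodule.span ℝ (range τ)) : (inner ℂ v w).im = 0 := by
  refine Submodule.span_induction ?_ ?_ ?_ ?_ hv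
  · rintro _ ⟨i, rfl⟩
    refine Submodule.span_induction ?_ ?_ ?_ ?_ hw
    · rintro _ ⟨j, rfl⟩; exact hτ i j
    · simp
    · intro x y _ _ hx hy; rw [inner_add_right, Complex.add_im, hx, hy, add_zero]
    · intro c x _ hx
      rw [← Complex.coe_smul, inner_smul_right, Complex.im_ofReal_mul, hx, mul_zero]
  · simp
  · intro x y _ _ hx hy; rw [inner_add_left, Complex.add_im, hx, hy, add_zero]
  · intro c x _ hx
    rw [← Complex.coe_smul, inner_smul_left, Complex.conj_ofReal, Complex.im_ofReal_mul, hx,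
      mul_zero]

/-- The pullback of the Hermitian form under the ansatz map. -/
theorem inner_ansatz {n : ℕ} {p v w : CSpace n} (hp : ‖p‖ = 1) (hv : inner ℂ v p = 0)
    (hw : inner ℂ w p = 0) (c A B c' A' B' : ℂ) :
    inner ℂ (joinC (c • v + A • p) B) (joinC (c' • w + A' • p) B') =
      starRingEnd ℂ c * c' * inner ℂ v w + starRingEnd ℂ A * A' + starRingEnd ℂ B * B' := by
  have hpp : inner ℂ p p = 1 := by rw [inner_self_eq_norm_sq_to_K, hp]; simp
  have hw' : inner ℂ p w = 0 := by rw [← inner_conj_symm, hw, map_zero]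
  simp only [inner_joinC, inner_add_left, inner_add_right, inner_smul_left, inner_smul_right, hv,
    hw', hpp]
  ring

variable {Q : Set (CSpace (k + 1))}

theorem IsSpecialLegendrian.isSubmanifold_prod (hQ : IsSpecialLegendrian Q) (hI₁ : IsOpen I₁)
    (hI₂ : IsOpen I₂) : IsSubmanifold (k + 1 + 1) (Q ×ˢ I₁ ×ˢ I₂) :=
  hQ.submanifold.prod ((hI₁.isSubmanifold (d := 1) (by simp)).prod
    (hI₂.isSubmanifold (d := 1) (by simp)))

/-- Components of a tangent vector to `Q × I₁ × I₂`. -/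
theorem fst_mem_tangentConeAt {q v : CSpace (k + 1) × ℝ × ℝ}
    (hv : v ∈ tangentConeAt ℝ (Q ×ˢ I₁ ×ˢ I₂) q) : v.1 ∈ tangentConeAt ℝ Q q.1 :=
  (tangentConeAt_prod_subset hv).1

/-- The matrix of vectors factors as (τ, p, e_m) times a block matrix with c on the k directions τ
and the 2 × 2 profile Jacobian, times a real coordinate matrix. The real r is the determinant of the
last factor. -/
theorem holVolForm_ansatz {τ : Fin k → CSpace (k + 1)} {p : CSpace (k + 1)} (c A₁ A₂ B₁ B₂ : ℂ)
    (a : Fin k → Fin (k + 1 + 1) → ℝ) (s t : Fin (k + 1 + 1) → ℝ) :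
    ∃ r : ℝ, holVolForm (fun j => joinC (c • (∑ l, a l j • τ l) + (s j * A₁ + t j * A₂ : ℂ) • p)
      (s j * B₁ + t j * B₂)) =
      r * holVolForm (Fin.snoc (α := fun _ => CSpace (k + 1)) τ p) *
        (c ^ k * (A₁ * B₂ - A₂ * B₁)) := by
  let C : Matrix (Fin (k + 1 + 1)) (Fin k ⊕ Fin 2) ℂ := Matrix.of fun i j =>
    Sum.elim (fun l => joinC (τ l) 0 i) ![joinC p 0 i, joinC (0 : CSpace (k + 1)) 1 i] j
  let D : Matrix (Fin k ⊕ Fin 2) (Fin k ⊕ Fin 2) ℂ :=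
    Matrix.fromBlocks (c • (1 : Matrix (Fin k) (Fin k) ℂ)) 0 0 !![A₁, A₂; B₁, B₂]
  let A : Matrix (Fin k ⊕ Fin 2) (Fin (k + 1 + 1)) ℝ := Matrix.of fun i j =>
    Sum.elim (fun l => a l j) ![s j, t j] i
  let e : Fin (k + 1 + 1) ≃ Fin k ⊕ Fin 2 := (finSumFinEquiv (m := k) (n := 2)).symm
  have hprod : (Matrix.of fun i j => joinC (c • (∑ l, a l j • τ l) +
      (s j * A₁ + t j * A₂ : ℂ) • p) (s j * B₁ + t j * B₂) i) =
      C.submatrix id e * D.submatrix e e * (A.submatrix e id).map Complex.ofReal := by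
    rw [Matrix.submatrix_mul_equiv, ← Matrix.submatrix_map, Matrix.submatrix_mul_equiv]
    ext i j
    have hCD : ∀ x, (C * D) i x = Sum.elim (fun l => c * joinC (τ l) 0 i)
        ![joinC p 0 i * A₁ + joinC (0 : CSpace (k + 1)) 1 i * B₁,
          joinC p 0 i * A₂ + joinC (0 : CSpace (k + 1)) 1 i * B₂] x := by
      rintro (l | l)
      · simp [Matrix.mul_apply, Fintype.sum_sum_type, C, D, Matrix.one_apply, mul_comm]
      · fin_cases l <;> simp [Matrix.mul_apply, Fintype.sum_sum_type, C, D]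
    rw [Matrix.submatrix_apply, Matrix.mul_apply, Fintype.sum_sum_type, Fin.sum_univ_two]
    simp only [id, hCD, Matrix.of_apply, A, Matrix.map_apply, Sum.elim_inl, Sum.elim_inr,
      Matrix.cons_val_zero, Matrix.cons_val_one]
    refine Fin.lastCases ?_ (fun i => ?_) i
    · simp only [joinC_last]
      simp
      ring
    · simp only [joinC_castSucc]
      simp [Finset.mul_sum]
      ring_nf
      rw [Finset.sum_congr rfl fun x _ => mul_right_comm c _ _]
      ring
  have hC : (C.submatrix id e).det = holVolForm (Fin.snoc (α := fun _ => CSpace (k + 1)) τ p) := by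
    have hlast : ∀ i, C i (e (Fin.last (k + 1))) = joinC (0 : CSpace (k + 1)) 1 i := fun i => by
      have : e (Fin.last (k + 1)) = Sum.inr 1 := by
        simp only [e, Equiv.symm_apply_eq]
        ext; simp
      rw [this]
      simp [C]
    have hcast : ∀ (i j : Fin (k + 1)), C i.castSucc (e j.castSucc) =
        Fin.snoc (α := fun _ => CSpace (k + 1)) τ p j i := fun i j => by
      refine Fin.lastCases ?_ (fun j => ?_) j
      · have : e (Fin.last k).castSucc = Sum.inr 0 := by
          simp only [e, Equiv.symm_apply_eq]
          ext; simp
        rw [this]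
        simp [C, joinC_castSucc]
      · have : e j.castSucc.castSucc = Sum.inl j := by
          simp only [e, Equiv.symm_apply_eq]
          ext; simp
        rw [this]
        simp [C, joinC_castSucc]
    -- The last column is e_m; expanding along it leaves the determinant of (τ, p).
    rw [Matrix.det_succ_column _ (Fin.last (k + 1)), Fin.sum_univ_castSucc,
      Finset.sum_eq_zero fun i _ => by
        rw [Matrix.submatrix_apply, hlast, id, joinC_castSucc]; simp, zero_add,
      Matrix.submatrix_apply, hlast, id, joinC_last, ← two_mul, pow_mul]
    simp only [even_two, Even.neg_pow, one_pow, one_mul, mul_one, holVolForm]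
    congr 1
    ext i j
    simp only [Matrix.submatrix_apply, id, Fin.succAbove_last, hcast, Matrix.of_apply]
  have hD : (D.submatrix e e).det = c ^ k * (A₁ * B₂ - A₂ * B₁) := by
    rw [Matrix.det_submatrix_equiv_self, Matrix.det_fromBlocks_zero₂₁, Matrix.det_smul,
      Matrix.det_one, Matrix.det_fin_two_of]
    simp
  refine ⟨(A.submatrix e id).det, ?_⟩
  have hA : ((A.submatrix e id).map Complex.ofReal).det = ((A.submatrix e id).det : ℂ) :=
    (RingHom.map_det Complex.ofRealHom (A.submatrix e id)).symm
  rw [holVolForm, hprod, Matrix.det_mul, Matrix.det_mul, hC, hD, hA]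
  ring

end Ansatz

/-! ### The ansatz map is exact special Lagrangian, and when it is an immersion. -/

section AnsatzSpecialLagrangian

open Set Filter Topology

variable {k : ℕ} {J₁ J₂ I₁ I₂ : Set ℝ} {γ ξ : ℝ → ℂ} {Q : Set (CSpace (k + 1))}

theorem IsSpecialLegendrian.inner_tangent (hQ : IsSpecialLegendrian Q) {p : CSpace (k + 1)}
    (hp : p ∈ Q) {v : CSpace (k + 1)} (hv : v ∈ tangentConeAt ℝ Q p) : inner ℂ v p = 0 := by
  obtain ⟨τ, h1, h2, -, -⟩ := hQ.frame p hp
  exact inner_eq_zero_of_mem_span h2 (h1 hv)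

theorem IsSpecialLegendrian.im_inner_tangent (hQ : IsSpecialLegendrian Q) {p : CSpace (k + 1)}
    (hp : p ∈ Q) {v w : CSpace (k + 1)} (hv : v ∈ tangentConeAt ℝ Q p)
    (hw : w ∈ tangentConeAt ℝ Q p) : (inner ℂ v w).im = 0 := by
  obtain ⟨τ, h1, -, h2, -⟩ := hQ.frame p hp
  exact im_inner_eq_zero_of_mem_span h2 (h1 hv) (h1 hw)

theorem im_conj_mul_self_mul (c : ℂ) {w : ℂ} (hw : w.im = 0) : (starRingEnd ℂ c * c * w).im = 0 := by
  rw [← Complex.normSq_eq_conj_mul_self, Complex.im_ofReal_mul, hw, mul_zero]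

/-- In the Hermitian form the mixed x-y terms of the two components cancel, and the remaining terms
are real. -/
theorem kahler_identity (g g' x x' : ℂ) (s t s' t' : ℝ) :
    (starRingEnd ℂ (s * (g' * x) + t * (g * x')) * (s' * (g' * x) + t' * (g * x')) +
      starRingEnd ℂ (-s * (starRingEnd ℂ g * g') + t * (starRingEnd ℂ x * x')) *
        (-s' * (starRingEnd ℂ g * g') + t' * (starRingEnd ℂ x * x'))).im = 0 := by
  simp only [Complex.add_im, Complex.mul_im, Complex.mul_re, Complex.add_re, Complex.conj_re,
    Complex.conj_im, Complex.ofReal_re, Complex.ofReal_im, Complex.neg_re, Complex.neg_im]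
  ring

theorem liouville_identity (g g' x x' : ℂ) (s t bg bx : ℝ) :
    (starRingEnd ℂ (g * x) * (s * (g' * x) + t * (g * x')) +
      starRingEnd ℂ (((1 / 2 * (‖x‖ ^ 2 - ‖g‖ ^ 2) : ℝ) : ℂ) + Complex.I * ((bx - bg : ℝ) : ℂ)) *
        (-s * (starRingEnd ℂ g * g') + t * (starRingEnd ℂ x * x'))).im =
    s * (1 / 2 * ‖x‖ ^ 2 * (starRingEnd ℂ g * g').im + (starRingEnd ℂ g * g').re * bx +
      (1 / 2 * ‖g‖ ^ 2 * (starRingEnd ℂ g * g').im - bg * (starRingEnd ℂ g * g').re)) +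
    t * (1 / 2 * ‖g‖ ^ 2 * (starRingEnd ℂ x * x').im + (starRingEnd ℂ x * x').re * bg +
      (1 / 2 * ‖x‖ ^ 2 * (starRingEnd ℂ x * x').im - bx * (starRingEnd ℂ x * x').re)) := by
  simp only [← Complex.normSq_eq_norm_sq, Complex.normSq_apply]
  simp only [Complex.add_im, Complex.mul_im, Complex.mul_re, Complex.add_re, Complex.conj_re,
    Complex.conj_im, Complex.ofReal_re, Complex.ofReal_im, Complex.neg_re, Complex.neg_im,
    Complex.I_re, Complex.I_im]
  ring

/-- The ansatz map is exact special Lagrangian. -/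
theorem isExactSpecialLagrangianMap_ansatz (hQ : IsSpecialLegendrian Q)
    (hγ : IsProfileCurve k J₁ γ) (hξ : IsProfileCurve k J₂ ξ) (hI₁ : IsOpen I₁) (hI₂ : IsOpen I₂)
    (hIJ₁ : I₁ ⊆ J₁) (hIJ₂ : I₂ ⊆ J₂) :
    IsExactSpecialLagrangianMap (Q ×ˢ I₁ ×ˢ I₂) (ansatzQuotMap γ ξ) := by
  obtain ⟨θ₁, hθ₁⟩ := hγ.phase
  obtain ⟨θ₂, hθ₂⟩ := hξ.phase
  have hsub : Q ×ˢ I₁ ×ˢ I₂ ⊆ univ ×ˢ J₁ ×ˢ J₂ := fun q hq => ⟨trivial, hIJ₁ hq.2.1, hIJ₂ hq.2.2⟩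
  have hpot : ∀ q ∈ Q ×ˢ I₁ ×ˢ I₂, HasFDerivAt (ansatzPotential γ ξ)
      (fderiv ℝ (ansatzPotential γ ξ) q) q := fun q hq => by
    obtain ⟨L, hL, -⟩ := exists_hasFDerivAt_ansatzPotential hγ hξ (hsub hq).2.1 (hsub hq).2.2
    exact hL.differentiableAt.hasFDerivAt
  refine .of_tangent (hQ.isSubmanifold_prod hI₁ hI₂)
    ((contDiffOn_ansatzQuotMap hγ hξ).mono hsub)
    (f' := fun q => fderiv ℝ (ansatzQuotMap γ ξ) q)
    (fun q hq => (hasFDerivAt_ansatzQuotMap hγ hξ (hsub hq).2.1 (hsub hq).2.2).hasFDerivWithinAt)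
    ((contDiffOn_ansatzPotential hγ hξ).mono hsub)
    (h' := fun q => fderiv ℝ (ansatzPotential γ ξ) q)
    (fun q hq => (hpot q hq).hasFDerivWithinAt) ?_ ?_ (θ₁ + θ₂) ?_
  · intro q hq v w hv hw
    have hv' := fst_mem_tangentConeAt hv
    have hw' := fst_mem_tangentConeAt hw
    rw [fderiv_ansatzQuotMap hγ hξ (hsub hq).2.1 (hsub hq).2.2,
      fderiv_ansatzQuotMap hγ hξ (hsub hq).2.1 (hsub hq).2.2, kahlerForm_eq_im_inner,
      inner_ansatz (hQ.norm_eq _ hq.1) (hQ.inner_tangent hq.1 hv') (hQ.inner_tangent hq.1 hw'),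
      add_assoc, Complex.add_im, kahler_identity,
      im_conj_mul_self_mul _ (hQ.im_inner_tangent hq.1 hv' hw'), add_zero]
  · intro q hq v hv
    obtain ⟨L, hL, hLv⟩ := exists_hasFDerivAt_ansatzPotential hγ hξ (hsub hq).2.1 (hsub hq).2.2
    have hv' := fst_mem_tangentConeAt hv
    -- The position vector in the shape of a tangent vector with zero orbit part, so the formula for
    -- the Hermitian form also computes the Liouville form.
    have e : ansatzQuotMap γ ξ q = joinC ((0 : ℂ) • (0 : CSpace (k + 1)) +
        (γ q.2.1 * ξ q.2.2) • q.1) (profileSnd γ ξ q.2.1 q.2.2) := by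
      rw [zero_smul, zero_add]; rfl
    rw [hL.fderiv, hLv, fderiv_ansatzQuotMap hγ hξ (hsub hq).2.1 (hsub hq).2.2,
      liouvilleForm_eq_im_inner, e, inner_ansatz (hQ.norm_eq _ hq.1) (inner_zero_left _)
      (hQ.inner_tangent hq.1 hv'), map_zero, zero_mul, zero_mul, zero_add, profileSnd,
      liouville_identity]
    rfl
  · intro q hq v hv
    obtain ⟨τ, h1, -, -, h4⟩ := hQ.frame q.1 hq.1
    have hspan : ∀ j, ∃ a : Fin k → ℝ, ∑ l, a l • τ l = (v j).1 := fun j =>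
      (Submodule.mem_span_range_iff_exists_fun ℝ).1 (h1 (fst_mem_tangentConeAt (hv j)))
    choose a ha using hspan
    obtain ⟨r, hr⟩ := holVolForm_ansatz (τ := τ) (p := q.1) (γ q.2.1 * ξ q.2.2)
      (deriv γ q.2.1 * ξ q.2.2) (γ q.2.1 * deriv ξ q.2.2)
      (-(starRingEnd ℂ (γ q.2.1) * deriv γ q.2.1)) (starRingEnd ℂ (ξ q.2.2) * deriv ξ q.2.2)
      (fun l j => a j l) (fun j => (v j).2.1) (fun j => (v j).2.2)
    have e : (fun j => fderiv ℝ (ansatzQuotMap γ ξ) q (v j)) = fun j =>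
        joinC ((γ q.2.1 * ξ q.2.2) • (∑ l, a j l • τ l) +
          (((v j).2.1 : ℂ) * (deriv γ q.2.1 * ξ q.2.2) +
            ((v j).2.2 : ℂ) * (γ q.2.1 * deriv ξ q.2.2) : ℂ) • q.1)
          (((v j).2.1 : ℂ) * (-(starRingEnd ℂ (γ q.2.1) * deriv γ q.2.1)) +
            ((v j).2.2 : ℂ) * (starRingEnd ℂ (ξ q.2.2) * deriv ξ q.2.2)) := by
      funext j
      rw [fderiv_ansatzQuotMap hγ hξ (hsub hq).2.1 (hsub hq).2.2, ha, neg_mul, mul_neg]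
    obtain ⟨r₁, hr₁⟩ := hθ₁ _ (hsub hq).2.1
    obtain ⟨r₂, hr₂⟩ := hθ₂ _ (hsub hq).2.2
    have hvol : holVolForm (Fin.snoc (α := fun _ => CSpace (k + 1)) τ q.1)
        = ((holVolForm (Fin.snoc (α := fun _ => CSpace (k + 1)) τ q.1)).re : ℂ) :=
      Complex.ext rfl (by rw [h4, Complex.ofReal_im])
    rw [e, hr, hvol]
    -- The profile Jacobian separates into a nonnegative factor times the two curve expressions of
    -- constant phase.
    have hval : (γ q.2.1 * ξ q.2.2) ^ k * (deriv γ q.2.1 * ξ q.2.2 *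
        (starRingEnd ℂ (ξ q.2.2) * deriv ξ q.2.2) - γ q.2.1 * deriv ξ q.2.2 *
        (-(starRingEnd ℂ (γ q.2.1) * deriv γ q.2.1))) =
        ((Complex.normSq (ξ q.2.2) + Complex.normSq (γ q.2.1) : ℝ) : ℂ) *
          ((γ q.2.1 ^ k * deriv γ q.2.1) * (ξ q.2.2 ^ k * deriv ξ q.2.2)) := by
      rw [Complex.ofReal_add, Complex.normSq_eq_conj_mul_self, Complex.normSq_eq_conj_mul_self]
      ring
    rw [hval, hr₁, hr₂]
    have hexp : Complex.exp (-((θ₁ + θ₂ : ℝ) : ℂ) * Complex.I) *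
        (Complex.exp (θ₁ * Complex.I) * Complex.exp (θ₂ * Complex.I)) = 1 := by
      rw [← Complex.exp_add, ← Complex.exp_add]
      push_cast
      ring_nf
      exact Complex.exp_zero
    generalize (holVolForm (Fin.snoc (α := fun _ => CSpace (k + 1)) τ q.1)).re = r₃
    generalize Complex.normSq (ξ q.2.2) + Complex.normSq (γ q.2.1) = r₄
    have : Complex.exp (-((θ₁ + θ₂ : ℝ) : ℂ) * Complex.I) * (r * r₃ * (r₄ *
        (r₁ * Complex.exp (θ₁ * Complex.I) * (r₂ * Complex.exp (θ₂ * Complex.I))))) =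
        ((r * r₃ * r₄ * r₁ * r₂ : ℝ) : ℂ) * (Complex.exp (-((θ₁ + θ₂ : ℝ) : ℂ) * Complex.I) *
        (Complex.exp (θ₁ * Complex.I) * Complex.exp (θ₂ * Complex.I))) := by
      push_cast; ring
    rw [this, hexp, mul_one, Complex.ofReal_im]

/-- Pairing the first component with p separates the orbit direction from the two profile
directions. The remaining complex 2 × 2 system is nondegenerate. -/
theorem isImmersionOn_ansatz (hQ : IsSpecialLegendrian Q)
    (hγ : IsProfileCurve k J₁ γ) (hξ : IsProfileCurve k J₂ ξ) (hI₁ : IsOpen I₁) (hI₂ : IsOpen I₂)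
    (hIJ₁ : I₁ ⊆ J₁) (hIJ₂ : I₂ ⊆ J₂) (hγ0 : ∀ x ∈ I₁, γ x ≠ 0 ∧ deriv γ x ≠ 0)
    (hξ0 : ∀ y ∈ I₂, ξ y ≠ 0 ∧ deriv ξ y ≠ 0) :
    IsImmersionOn (k + 1 + 1) (Q ×ˢ I₁ ×ˢ I₂) (ansatzQuotMap γ ξ) := by
  have hsub : Q ×ˢ I₁ ×ˢ I₂ ⊆ univ ×ˢ J₁ ×ˢ J₂ := fun q hq => ⟨trivial, hIJ₁ hq.2.1, hIJ₂ hq.2.2⟩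
  refine .of_tangent (hQ.isSubmanifold_prod hI₁ hI₂)
    ((contDiffOn_ansatzQuotMap hγ hξ).mono hsub)
    (f' := fun q => fderiv ℝ (ansatzQuotMap γ ξ) q)
    (fun q hq => (hasFDerivAt_ansatzQuotMap hγ hξ (hsub hq).2.1 (hsub hq).2.2).hasFDerivWithinAt) ?_
  intro q hq v w hv hw hvw
  obtain ⟨g0, g1⟩ := hγ0 _ hq.2.1
  obtain ⟨x0, x1⟩ := hξ0 _ hq.2.2
  have hd : fderiv ℝ (ansatzQuotMap γ ξ) q (v - w) = 0 := by rw [map_sub, hvw, sub_self]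
  have hin : inner ℂ q.1 (v - w).1 = 0 := by
    rw [← inner_conj_symm, Prod.fst_sub, inner_sub_left,
      hQ.inner_tangent hq.1 (fst_mem_tangentConeAt hv),
      hQ.inner_tangent hq.1 (fst_mem_tangentConeAt hw), sub_zero, map_zero]
  rw [← sub_eq_zero]
  generalize v - w = u at hd hin
  have hz : (0 : CSpace (k + 1 + 1)) = joinC 0 0 := by
    ext i; refine Fin.lastCases ?_ (fun i => ?_) i <;> simp [joinC]
  rw [fderiv_ansatzQuotMap hγ hξ (hsub hq).2.1 (hsub hq).2.2, hz, joinC_inj] at hd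
  obtain ⟨h1, h2⟩ := hd
  have hpp : inner ℂ q.1 q.1 = 1 := by
    rw [inner_self_eq_norm_sq_to_K, hQ.norm_eq _ hq.1]; simp
  have hA := congrArg (inner ℂ q.1) h1
  rw [inner_add_right, inner_smul_right, inner_smul_right, hin, hpp, inner_zero_right, mul_zero,
    zero_add, mul_one] at hA
  rw [hA, zero_smul, add_zero, smul_eq_zero] at h1
  have hu1 := h1.resolve_left (mul_ne_zero g0 x0)
  have hpos : ((Complex.normSq (ξ q.2.2) + Complex.normSq (γ q.2.1) : ℝ) : ℂ) ≠ 0 := by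
    have h3 := Complex.normSq_pos.2 x0
    have h4 := Complex.normSq_pos.2 g0
    exact_mod_cast (add_pos h3 h4).ne'
  -- The combination conj(ξ) · (first equation) - γ · (second equation) eliminates the y component.
  have hs : (u.2.1 : ℂ) * (deriv γ q.2.1 *
      ((Complex.normSq (ξ q.2.2) + Complex.normSq (γ q.2.1) : ℝ) : ℂ)) = 0 := by
    rw [Complex.ofReal_add, Complex.normSq_eq_conj_mul_self, Complex.normSq_eq_conj_mul_self]
    linear_combination (starRingEnd ℂ (ξ q.2.2)) * hA - γ q.2.1 * h2
  have hs0 : u.2.1 = 0 := by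
    rcases mul_eq_zero.1 hs with h | h
    · exact_mod_cast h
    · exact absurd h (mul_ne_zero g1 hpos)
  have ht0 : u.2.2 = 0 := by
    rw [hs0, Complex.ofReal_zero, zero_mul, zero_add] at hA
    rcases mul_eq_zero.1 hA with h | h
    · exact_mod_cast h
    · exact absurd h (mul_ne_zero g0 x1)
  exact Prod.ext hu1 (Prod.ext hs0 ht0)

end AnsatzSpecialLagrangian

/-! ### Injectivity and properness of the two ansatz maps. -/

section Embeddings

open Set Filter Topology

variable {k : ℕ}

theorem norm_sq_joinC {n : ℕ} (z : CSpace n) (w : ℂ) : ‖joinC z w‖ ^ 2 = ‖z‖ ^ 2 + ‖w‖ ^ 2 := by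
  have h := inner_joinC z z w w
  rw [inner_self_eq_norm_sq_to_K, inner_self_eq_norm_sq_to_K, ← Complex.normSq_eq_conj_mul_self,
    Complex.normSq_eq_norm_sq] at h
  have h' := congrArg Complex.re h
  norm_cast at h'

theorem norm_fst_le_norm_joinC {n : ℕ} (z : CSpace n) (w : ℂ) : ‖z‖ ≤ ‖joinC z w‖ := by
  refine (sq_le_sq₀ (norm_nonneg _) (norm_nonneg _)).1 ?_
  rw [norm_sq_joinC]
  exact le_add_of_nonneg_right (sq_nonneg _)

theorem norm_snd_le_norm_joinC {n : ℕ} (z : CSpace n) (w : ℂ) : ‖w‖ ≤ ‖joinC z w‖ := by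
  refine (sq_le_sq₀ (norm_nonneg _) (norm_nonneg _)).1 ?_
  rw [norm_sq_joinC]
  exact le_add_of_nonneg_left (sq_nonneg _)

theorem profileSnd_re (γ ξ : ℝ → ℂ) (x y : ℝ) :
    (profileSnd γ ξ x y).re = 1 / 2 * (‖ξ y‖ ^ 2 - ‖γ x‖ ^ 2) := by
  rw [profileSnd, Complex.add_re, Complex.ofReal_re, Complex.re_mul_ofReal, Complex.I_re, zero_mul,
    add_zero]

theorem profileSnd_im (γ ξ : ℝ → ℂ) (x y : ℝ) :
    (profileSnd γ ξ x y).im = betaFun ξ y - betaFun γ x := by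
  rw [profileSnd, Complex.add_im, Complex.ofReal_im, Complex.im_mul_ofReal, Complex.I_im, one_mul,
    zero_add]

theorem eventually_norm_lt {X : Type*} [SeminormedAddCommGroup X] (w : X) :
    ∀ᶠ w' in 𝓝 w, ‖w'‖ < ‖w‖ + 1 :=
  continuous_norm.continuousAt.eventually (gt_mem_nhds (lt_add_one ‖w‖))

/-! ### Two Lawlor necks -/

/-- A bound on |γ| |ξ| bounds each modulus, since both are bounded below by the neck radii; sublevel
sets of the moduli lie in compact subintervals. -/
theorem isEmbedding_ansatz_lawlor_lawlor {Q : Set (CSpace (k + 1))} (hQ : IsSpecialLegendrian Q)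
    {φ₁ φ₂ μ₁ μ₂ : ℝ} (hμ₁ : 0 < μ₁) (hμ₂ : 0 < μ₂)
    (hinj : InjOn (ansatzQuotMap (lawlorCurve (k + 1) φ₁ μ₁) (lawlorCurve (k + 1) φ₂ μ₂))
      (Q ×ˢ lawlorInterval (k + 1) ×ˢ lawlorInterval (k + 1))) :
    IsEmbedding ((Q ×ˢ lawlorInterval (k + 1) ×ˢ lawlorInterval (k + 1)).domRestrict
      (ansatzQuotMap (lawlorCurve (k + 1) φ₁ μ₁) (lawlorCurve (k + 1) φ₂ μ₂))) := by
  have hγ := isProfileCurve_lawlorCurve k φ₁ μ₁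
  have hξ := isProfileCurve_lawlorCurve k φ₂ μ₂
  refine isEmbedding_domRestrict_of_locally_proper
    ((contDiffOn_ansatzQuotMap hγ hξ).continuousOn.mono fun q hq => ⟨trivial, hq.2⟩) hinj ?_
  intro p _
  generalize ansatzQuotMap (lawlorCurve (k + 1) φ₁ μ₁) (lawlorCurve (k + 1) φ₂ μ₂) p = w
  obtain ⟨C₁, hC₁, hC₁c, hC₁m⟩ := exists_isCompact_norm_lawlorCurve_le (k := k) φ₁ hμ₁
    ((‖w‖ + 1) / μ₂)
  obtain ⟨C₂, hC₂, hC₂c, hC₂m⟩ := exists_isCompact_norm_lawlorCurve_le (k := k) φ₂ hμ₂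
    ((‖w‖ + 1) / μ₁)
  refine ⟨_, eventually_norm_lt w, Q ×ˢ C₁ ×ˢ C₂, prod_mono_right (prod_mono hC₁ hC₂),
    hQ.isCompact.prod (hC₁c.prod hC₂c), ?_⟩
  rintro q ⟨hq1, hq2, hq3⟩ hqw
  have h1 := (norm_fst_le_norm_joinC _ _).trans (le_of_lt hqw)
  rw [norm_smul, hQ.norm_eq _ hq1, mul_one, profileFst, norm_mul] at h1
  have h2 := le_norm_lawlorCurve (φ := φ₁) hμ₁ hq2
  have h3 := le_norm_lawlorCurve (φ := φ₂) hμ₂ hq3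
  refine ⟨hq1, hC₁m _ hq2 ?_, hC₂m _ hq3 ?_⟩
  · rw [le_div_iff₀ hμ₂]
    exact (mul_le_mul_of_nonneg_left h3 (norm_nonneg _)).trans h1
  · rw [le_div_iff₀ hμ₁, mul_comm]
    exact (mul_le_mul_of_nonneg_right h2 (norm_nonneg _)).trans h1

/-- Use (b² + a²)² = (b² - a²)² + 4(ab)². -/
theorem eq_and_eq_of_mul_eq_of_sub_eq {a b a' b' : ℝ} (ha : 0 < a) (hb : 0 < b) (ha' : 0 < a')
    (hb' : 0 < b') (h1 : a * b = a' * b') (h2 : b ^ 2 - a ^ 2 = b' ^ 2 - a' ^ 2) :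
    a = a' ∧ b = b' := by
  have h3 : (b ^ 2 + a ^ 2) ^ 2 = (b' ^ 2 + a' ^ 2) ^ 2 := by
    have : (b ^ 2 + a ^ 2) ^ 2 = (b ^ 2 - a ^ 2) ^ 2 + 4 * (a * b) ^ 2 := by ring
    rw [this, h2, h1]; ring
  have h4 : b ^ 2 + a ^ 2 = b' ^ 2 + a' ^ 2 :=
    (pow_left_inj₀ (by positivity) (by positivity) two_ne_zero).1 h3
  exact ⟨(pow_left_inj₀ ha.le ha'.le two_ne_zero).1 (by linarith),
    (pow_left_inj₀ hb.le hb'.le two_ne_zero).1 (by linarith)⟩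

theorem lawlorCurve_neg (n : ℕ) (φ μ s : ℝ) :
    lawlorCurve n φ μ (-s) = Complex.exp (-(2 * s : ℝ) * Complex.I) * lawlorCurve n φ μ s := by
  rw [lawlorCurve, lawlorCurve, lawlor_neg]; ring

theorem pos_iff_betaFun_lawlorCurve_pos {φ μ s : ℝ} (hμ : 0 < μ)
    (hs : s ∈ lawlorInterval (k + 1)) : 0 < betaFun (lawlorCurve (k + 1) φ μ) s ↔ 0 < s := by
  have := (strictMonoOn_betaFun_lawlorCurve (k := k) (φ := φ) hμ).lt_iff_lt
    (isProfileCurve_lawlorCurve k φ μ).zero_mem hs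
  rwa [betaFun_zero] at this

/-- The only obstruction to injectivity is a rotation of `Q` into itself by a small angle. -/
theorem injOn_ansatz_lawlor_lawlor {Q : Set (CSpace (k + 1))} (hQ : IsSpecialLegendrian Q)
    {φ₁ φ₂ μ₁ μ₂ : ℝ} (hμ₁ : 0 < μ₁) (hμ₂ : 0 < μ₂)
    (hrot : ∀ t : ℝ, (k + 1 : ℕ) * |t| < 2 * Real.pi → ∀ p ∈ Q,
      Complex.exp (t * Complex.I) • p ∈ Q → t = 0) :
    InjOn (ansatzQuotMap (lawlorCurve (k + 1) φ₁ μ₁) (lawlorCurve (k + 1) φ₂ μ₂))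
      (Q ×ˢ lawlorInterval (k + 1) ×ˢ lawlorInterval (k + 1)) := by
  rintro ⟨p, x, y⟩ ⟨hp, hx, hy⟩ ⟨p', x', y'⟩ ⟨hp', hx', hy'⟩ h
  simp only at hp hx hy hp' hx' hy'
  rw [ansatzQuotMap, ansatzQuotMap, joinC_inj] at h
  obtain ⟨h1, h2⟩ := h
  simp only at h1 h2
  have ha := hμ₁.trans_le (le_norm_lawlorCurve (φ := φ₁) hμ₁ hx)
  have ha' := hμ₁.trans_le (le_norm_lawlorCurve (φ := φ₁) hμ₁ hx')
  have hb := hμ₂.trans_le (le_norm_lawlorCurve (φ := φ₂) hμ₂ hy)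
  have hb' := hμ₂.trans_le (le_norm_lawlorCurve (φ := φ₂) hμ₂ hy')
  have hn := congrArg norm h1
  rw [norm_smul, norm_smul, hQ.norm_eq _ hp, hQ.norm_eq _ hp', mul_one, mul_one, profileFst,
    profileFst, norm_mul, norm_mul] at hn
  have hre := congrArg Complex.re h2
  rw [profileSnd_re, profileSnd_re] at hre
  have him := congrArg Complex.im h2
  rw [profileSnd_im, profileSnd_im] at him
  obtain ⟨e1, e2⟩ := eq_and_eq_of_mul_eq_of_sub_eq ha hb ha' hb' hn (by linarith)
  have ex := abs_eq_of_norm_lawlorCurve_eq hμ₁ hx hx' e1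
  have ey := abs_eq_of_norm_lawlorCurve_eq hμ₂ hy hy' e2
  have m1 := (strictMonoOn_betaFun_lawlorCurve (k := k) (φ := φ₁) hμ₁).injOn
  have m2 := (strictMonoOn_betaFun_lawlorCurve (k := k) (φ := φ₂) hμ₂).injOn
  have hfin : x = x' → y = y' → (p, x, y) = (p', x', y') := by
    rintro rfl rfl
    have : p = p' := smul_right_injective _
      (mul_ne_zero (norm_pos_iff.1 ha) (norm_pos_iff.1 hb)) h1
    rw [this]
  by_cases hxx : x = x'
  · subst hxx
    exact hfin rfl (m2 hy hy' (by linarith))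
  by_cases hyy : y = y'
  · subst hyy
    exact hfin (m1 hx hx' (by linarith)) rfl
  -- If one of x, y is unchanged, β determines the other and the points agree. What remains is that
  -- both change sign.
  exfalso
  have hx'' : x' = -x := by
    rcases abs_eq_abs.1 ex with h | h
    · exact absurd h hxx
    · linarith
  have hy'' : y' = -y := by
    rcases abs_eq_abs.1 ey with h | h
    · exact absurd h hyy
    · linarith
  subst hx'' hy''
  rw [betaFun_lawlorCurve_neg hx, betaFun_lawlorCurve_neg hy] at him
  -- The difference of the β values is both preserved and negated, hence zero: x and y lie on the
  -- same side of 0.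
  have hsign : 0 < x ↔ 0 < y := by
    rw [← pos_iff_betaFun_lawlorCurve_pos (φ := φ₁) hμ₁ hx,
      ← pos_iff_betaFun_lawlorCurve_pos (φ := φ₂) hμ₂ hy]
    constructor <;> intro h <;> linarith
  have hsmall : ((k + 1 : ℕ) : ℝ) * |-(2 * x) + -(2 * y)| < 2 * Real.pi := by
    have hn : (0 : ℝ) < (k + 1 : ℕ) := by positivity
    have h1 := (cos_pos_of_mem_lawlorInterval hx).1
    have h2 := (cos_pos_of_mem_lawlorInterval hy).1
    rw [abs_mul, abs_of_pos hn] at h1 h2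
    have h3 : |-(2 * x) + -(2 * y)| ≤ 2 * |x| + 2 * |y| := by
      refine (abs_add_le _ _).trans (le_of_eq ?_)
      rw [abs_neg, abs_neg, abs_mul, abs_mul, abs_two]
    calc ((k + 1 : ℕ) : ℝ) * |-(2 * x) + -(2 * y)| ≤ (k + 1 : ℕ) * (2 * |x| + 2 * |y|) := by gcongr
      _ = 2 * ((k + 1 : ℕ) * |x|) + 2 * ((k + 1 : ℕ) * |y|) := by ring
      _ < 2 * Real.pi := by linarith
  -- Negating s multiplies the neck by e^{-2is}, so the two link points differ by the rotation
  -- through -2(x + y).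
  have hrot' : Complex.exp ((-(2 * x) + -(2 * y) : ℝ) * Complex.I) • p' = p := by
    refine smul_right_injective _ (mul_ne_zero (norm_pos_iff.1 ha) (norm_pos_iff.1 hb)) ?_
    simp only [profileFst, lawlorCurve_neg] at h1
    simp only
    rw [h1, smul_smul]
    congr 1
    rw [Complex.ofReal_add, add_mul, Complex.exp_add, Complex.ofReal_neg, Complex.ofReal_neg]
    ring
  have h0 := hrot _ hsmall p' hp' (by rw [hrot']; exact hp)
  have hx0 : x ≠ 0 := fun h => hxx (by rw [h, neg_zero])
  rcases lt_or_gt_of_ne hx0 with h | h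
  · have : ¬ 0 < y := fun hy => absurd (hsign.2 hy) (not_lt.2 h.le)
    linarith
  · have := hsign.1 h
    linarith

/-- If `Stab(P_z) / Stab(z)` has at most `N` elements, its roots of unity have order at most `N`. -/
theorem exists_pow_eq_one_of_card_le {n N : ℕ} {G : Subgroup (SUGroup n)} {z : CSpace n} (hz : z ≠ 0)
    (hcard : ENat.card (CyclicQuotient G z) ≤ N) {g : SUGroup n} (hg : g ∈ G) {c : ℂ}
    (hc : act g z = c • z) : ∃ j : ℕ, 0 < j ∧ j ≤ N ∧ c ^ j = 1 := by
  have hpow : ∀ i : ℕ, act (g ^ i) z = c ^ i • z := fun i => by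
    induction i with
    | zero => rw [pow_zero, pow_zero, act_one, one_smul]
    | succ i ih => rw [pow_succ, act_mul, hc, act_smul, ih, smul_smul, pow_succ']
  have hc0 : c ≠ 0 := by
    rintro rfl
    have := act_inv_act g z
    rw [hc, zero_smul, ← zero_smul ℂ z, act_smul, zero_smul] at this
    exact hz this.symm
  let G' : lineStab G z := ⟨g, hg, c, hc0, hc⟩
  have hfin : Finite (CyclicQuotient G z) :=
    ENat.card_lt_top.1 (lt_of_le_of_lt hcard (ENat.natCast_lt_top N))
  have hN : Nat.card (CyclicQuotient G z) ≤ N := by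
    rw [ENat.card_eq_coe_natCard] at hcard
    exact_mod_cast hcard
  have := Fintype.ofFinite (CyclicQuotient G z)
  -- Pigeonhole: among the N + 1 powers of index 0, …, N two coincide in the quotient, and their
  -- index difference is the required exponent.
  obtain ⟨i, j, hij, heq⟩ := Fintype.exists_ne_map_eq_of_card_lt
    (fun i : Fin (N + 1) => ((G' ^ (i : ℕ) : lineStab G z) : CyclicQuotient G z)) (by
      rw [Fintype.card_fin, ← Nat.card_eq_fintype_card]; exact Nat.lt_succ_of_le hN)
  have key : ∀ i j : Fin (N + 1), i < j →
      ((G' ^ (i : ℕ) : lineStab G z) : CyclicQuotient G z) = (G' ^ (j : ℕ) : lineStab G z) →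
      ∃ j : ℕ, 0 < j ∧ j ≤ N ∧ c ^ j = 1 := by
    intro i j hij heq
    have h1 := (QuotientGroup.eq.1 heq)
    rw [Subgroup.mem_subgroupOf] at h1
    have hlt : (i : ℕ) < j := hij
    have e : ((G' ^ (i : ℕ))⁻¹ * G' ^ (j : ℕ) : lineStab G z) = G' ^ ((j : ℕ) - i) := by
      rw [inv_mul_eq_iff_eq_mul, ← pow_add]; congr 1; omega
    rw [e] at h1
    have h2 : act (g ^ ((j : ℕ) - i)) z = z := h1.2
    rw [hpow] at h2
    refine ⟨(j : ℕ) - i, by omega, by omega, ?_⟩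
    have h3 : (c ^ ((j : ℕ) - i) - 1) • z = 0 := by rw [sub_smul, one_smul, h2, sub_self]
    exact sub_eq_zero.1 ((smul_eq_zero.1 h3).resolve_right hz)
  rcases lt_or_gt_of_ne hij with h | h
  · exact key i j h heq
  · exact key j i h heq.symm

/-! ### A Lawlor neck and a line -/

/-- The line has β = 0, so the imaginary part of the last coordinate gives x, the real part then
gives y > 0, and p follows. For properness y must also be kept away from 0, which a lower bound on
|γ| y does. -/
theorem isEmbedding_ansatz_lawlor_line {Q : Set (CSpace (k + 1))} (hQ : IsSpecialLegendrian Q)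
    {φ₁ φ₂ μ : ℝ} (hμ : 0 < μ) :
    IsEmbedding ((Q ×ˢ lawlorInterval (k + 1) ×ˢ Ioi 0).domRestrict
      (ansatzQuotMap (lawlorCurve (k + 1) φ₁ μ) (lineCurve φ₂))) := by
  have hγ := isProfileCurve_lawlorCurve k φ₁ μ
  have hξ := isProfileCurve_lineCurve k φ₂
  have hξ0 : ∀ y : ℝ, 0 < y → lineCurve φ₂ y ≠ 0 := fun y hy => by
    rw [← norm_pos_iff, norm_lineCurve, abs_of_pos hy]; exact hy
  refine isEmbedding_domRestrict_of_locally_proper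
    ((contDiffOn_ansatzQuotMap hγ hξ).continuousOn.mono fun q hq => ⟨trivial, hq.2.1, trivial⟩)
    ?_ ?_
  · rintro ⟨p, x, y⟩ ⟨hp, hx, hy⟩ ⟨p', x', y'⟩ ⟨hp', hx', hy'⟩ h
    simp only [mem_Ioi] at hp hx hy hp' hx' hy'
    rw [ansatzQuotMap, ansatzQuotMap, joinC_inj] at h
    obtain ⟨h1, h2⟩ := h
    simp only at h1 h2
    have hre := congrArg Complex.re h2
    rw [profileSnd_re, profileSnd_re, norm_lineCurve, norm_lineCurve, sq_abs, sq_abs] at hre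
    have him := congrArg Complex.im h2
    rw [profileSnd_im, profileSnd_im, betaFun_lineCurve, betaFun_lineCurve] at him
    obtain rfl := (strictMonoOn_betaFun_lawlorCurve (k := k) (φ := φ₁) hμ).injOn hx hx'
      (by linarith)
    obtain rfl : y = y' := (pow_left_inj₀ hy.le hy'.le two_ne_zero).1 (by linarith)
    obtain rfl : p = p' := smul_right_injective _
      (mul_ne_zero (lawlorCurve_ne_zero hμ hx) (hξ0 y hy)) h1
    rfl
  · rintro p ⟨hp1, hp2, hp3⟩
    -- the squared norm of the first component
    let Λ : CSpace (k + 1 + 1) → ℝ := fun w => ‖w‖ ^ 2 - ‖w (Fin.last (k + 1))‖ ^ 2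
    have hΛc : Continuous Λ := by fun_prop
    have hΛ : ∀ q ∈ Q ×ˢ lawlorInterval (k + 1) ×ˢ Ioi (0 : ℝ),
        Λ (ansatzQuotMap (lawlorCurve (k + 1) φ₁ μ) (lineCurve φ₂) q) =
          (‖lawlorCurve (k + 1) φ₁ μ q.2.1‖ * q.2.2) ^ 2 := by
      rintro q ⟨hq1, hq2, hq3⟩
      simp only [Λ, ansatzQuotMap, norm_sq_joinC, joinC_last, add_sub_cancel_right]
      rw [norm_smul, hQ.norm_eq _ hq1, mul_one, profileFst, norm_mul, norm_lineCurve,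
        abs_of_pos hq3]
    have hpos : 0 < Λ (ansatzQuotMap (lawlorCurve (k + 1) φ₁ μ) (lineCurve φ₂) p) := by
      rw [hΛ p ⟨hp1, hp2, hp3⟩]
      exact pow_pos (mul_pos (norm_pos_iff.2 (lawlorCurve_ne_zero hμ hp2)) hp3) 2
    generalize ansatzQuotMap (lawlorCurve (k + 1) φ₁ μ) (lineCurve φ₂) p = w at hpos
    obtain ⟨δ, hδ, hδw⟩ := exists_between hpos
    obtain ⟨R, hR⟩ : ∃ R, R = ‖w‖ + 1 := ⟨_, rfl⟩
    have hR0 : 0 < R := by rw [hR]; positivity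
    -- With a = |γ|, y ≤ R / μ and ½|y² - a²| ≤ R give a² ≤ (R / μ)² + 2R; the extra 1 absorbs a ≤
    -- a² + 1. Then √δ ≤ a y ≤ A y bounds y below.
    obtain ⟨A, hA⟩ : ∃ A, A = (R / μ) ^ 2 + 2 * R + 1 := ⟨_, rfl⟩
    have hA0 : 0 < A := by rw [hA]; positivity
    obtain ⟨C₁, hC₁, hC₁c, hC₁m⟩ := exists_isCompact_norm_lawlorCurve_le (k := k) φ₁ hμ A
    refine ⟨_, (eventually_norm_lt w).and (hΛc.continuousAt.eventually (lt_mem_nhds hδw)),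
      Q ×ˢ C₁ ×ˢ Icc (√δ / A) (R / μ), prod_mono_right (prod_mono hC₁ fun y hy => ?_),
      hQ.isCompact.prod (hC₁c.prod isCompact_Icc), ?_⟩
    · exact lt_of_lt_of_le (div_pos (Real.sqrt_pos.2 hδ) hA0) hy.1
    rintro q ⟨hq1, hq2, hq3⟩ ⟨hqw, hqΛ⟩
    rw [mem_Ioi] at hq3
    rw [hΛ q ⟨hq1, hq2, hq3⟩] at hqΛ
    rw [← hR] at hqw
    have h1 := (norm_fst_le_norm_joinC _ _).trans (le_of_lt hqw)
    rw [norm_smul, hQ.norm_eq _ hq1, mul_one, profileFst, norm_mul, norm_lineCurve,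
      abs_of_pos hq3] at h1
    have h2 := (Complex.abs_re_le_norm _).trans ((norm_snd_le_norm_joinC _ _).trans (le_of_lt hqw))
    rw [profileSnd_re, norm_lineCurve, abs_of_pos hq3] at h2
    have h3 := le_norm_lawlorCurve (φ := φ₁) hμ hq2
    obtain ⟨a, ha_def⟩ : ∃ a, a = ‖lawlorCurve (k + 1) φ₁ μ q.2.1‖ := ⟨_, rfl⟩
    rw [← ha_def] at h1 h2 h3 hqΛ
    have hy : q.2.2 ≤ R / μ := by
      rw [le_div_iff₀ hμ, mul_comm]
      exact (mul_le_mul_of_nonneg_right h3 hq3.le).trans h1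
    have ha : a ≤ A := by
      have h4 : q.2.2 ^ 2 ≤ (R / μ) ^ 2 := pow_le_pow_left₀ hq3.le hy 2
      have h5 := neg_abs_le (1 / 2 * (q.2.2 ^ 2 - a ^ 2))
      nlinarith [sq_nonneg (a - 1)]
    refine ⟨hq1, hC₁m _ hq2 (ha_def ▸ ha), ?_, hy⟩
    rw [div_le_iff₀ hA0]
    refine Real.sqrt_le_iff.2 ⟨by positivity, hqΛ.le.trans ?_⟩
    have : 0 ≤ a := hμ.le.trans h3
    rw [mul_comm]
    gcongr

/-- The singular locus is a curve. -/
theorem isSubmanifold_singular_curve {φ₁ φ₂ μ : ℝ} (hμ : 0 < μ) :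
    IsSubmanifold 1 ((fun x : ℝ => ansatzQuotMap (lawlorCurve (k + 1) φ₁ μ) (lineCurve φ₂)
      ((0 : CSpace (k + 1)), x, (0 : ℝ))) '' lawlorInterval (k + 1)) := by
  have hγ := isProfileCurve_lawlorCurve k φ₁ μ
  have hξ := isProfileCurve_lineCurve k φ₂
  have hline : lineCurve φ₂ 0 = 0 := by simp [lineCurve]
  let ι : ℝ →L[ℝ] CSpace (k + 1) × ℝ × ℝ :=
    (0 : ℝ →L[ℝ] CSpace (k + 1)).prod ((ContinuousLinearMap.id ℝ ℝ).prod 0)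
  have hι : ∀ x, ι x = ((0 : CSpace (k + 1)), x, (0 : ℝ)) := fun x => rfl
  set F := ansatzQuotMap (n := k + 1) (lawlorCurve (k + 1) φ₁ μ) (lineCurve φ₂) with hF
  have hs : ContDiffOn ℝ ∞ (fun x : ℝ => F ((0 : CSpace (k + 1)), x, (0 : ℝ)))
      (lawlorInterval (k + 1)) :=
    (contDiffOn_ansatzQuotMap hγ hξ).comp ι.contDiff.contDiffOn fun x hx => ⟨trivial, hx, trivial⟩
  refine IsSmoothEmbeddingOn.isSubmanifold_image ⟨.of_tangent
    (hγ.isOpen.isSubmanifold (by simp)) hs (f' := fun x => (fderiv ℝ F (ι x)).comp ι)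
    (fun x hx => ?_) ?_, isEmbedding_domRestrict_of_locally_proper hs.continuousOn ?_ ?_⟩
  · have := (hasFDerivAt_ansatzQuotMap hγ hξ (q := ι x) hx trivial).comp x ι.hasFDerivAt
    exact this.hasFDerivWithinAt
  · intro x hx v w _ _ hvw
    simp only [ContinuousLinearMap.comp_apply] at hvw
    rw [hF, fderiv_ansatzQuotMap hγ hξ (q := ι x) hx trivial,
      fderiv_ansatzQuotMap hγ hξ (q := ι x) hx trivial, joinC_inj] at hvw
    have h := hvw.2
    simp only [hι, hline, map_zero, zero_mul, mul_zero, add_zero] at h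
    have hne := mul_ne_zero ((map_ne_zero (starRingEnd ℂ)).2 (lawlorCurve_ne_zero (φ := φ₁) hμ hx))
      (deriv_lawlorCurve_ne_zero (φ := φ₁) hμ hx)
    exact_mod_cast neg_injective (mul_right_cancel₀ hne h)
  · intro x hx x' hx' h
    simp only [hF] at h
    rw [ansatzQuotMap, ansatzQuotMap, joinC_inj] at h
    have him := congrArg Complex.im h.2
    rw [profileSnd_im, profileSnd_im, sub_right_inj] at him
    exact (strictMonoOn_betaFun_lawlorCurve hμ).injOn hx hx' him
  · intro x _
    generalize F ((0 : CSpace (k + 1)), x, (0 : ℝ)) = w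
    -- At y = 0 the real part is -½|γ|², so |γ|² ≤ 2(‖w‖ + 1), and |γ| ≤ |γ|² + 1.
    obtain ⟨C₁, hC₁, hC₁c, hC₁m⟩ := exists_isCompact_norm_lawlorCurve_le (k := k) φ₁ hμ
      (2 * (‖w‖ + 1) + 1)
    refine ⟨_, eventually_norm_lt w, C₁, hC₁, hC₁c, fun y hy hyw => hC₁m y hy ?_⟩
    have h2 := (Complex.abs_re_le_norm _).trans ((norm_snd_le_norm_joinC _ _).trans (le_of_lt hyw))
    simp only at h2
    rw [profileSnd_re, hline, norm_zero] at h2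
    have h5 := neg_abs_le (1 / 2 * ((0 : ℝ) ^ 2 - ‖lawlorCurve (k + 1) φ₁ μ y‖ ^ 2))
    nlinarith [sq_nonneg (‖lawlorCurve (k + 1) φ₁ μ y‖ - 1)]

/-- The line is odd, with even modulus and zero β. For a neck and a line this symmetry is the only
failure of injectivity off y = 0. -/
theorem ansatzQuotMap_lineCurve_neg {n : ℕ} (γ : ℝ → ℂ) (φ : ℝ) (p : CSpace n) (x y : ℝ) :
    ansatzQuotMap γ (lineCurve φ) (-p, x, -y) = ansatzQuotMap γ (lineCurve φ) (p, x, y) := by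
  rw [ansatzQuotMap, ansatzQuotMap, joinC_inj]
  constructor
  · simp [profileFst, lineCurve]
  · simp only [profileSnd, norm_lineCurve, abs_neg, betaFun_lineCurve]

theorem image_ansatz_line_diff {G : Subgroup (SUGroup (k + 1))} {z : CSpace (k + 1)} (hz : z ≠ 0)
    {φ₁ φ₂ μ : ℝ} (hμ : 0 < μ) :
    ansatzQuotMap (lawlorCurve (k + 1) φ₁ μ) (lineCurve φ₂) ''
        (orbit G z ×ˢ lawlorInterval (k + 1) ×ˢ univ) \
      ansatzQuotMap (lawlorCurve (k + 1) φ₁ μ) (lineCurve φ₂) ''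
        (orbit G z ×ˢ lawlorInterval (k + 1) ×ˢ {0}) =
    ansatzQuotMap (lawlorCurve (k + 1) φ₁ μ) (lineCurve φ₂) ''
        ((orbit G z ∪ orbit G (-z)) ×ˢ lawlorInterval (k + 1) ×ˢ Ioi 0) := by
  have hp0 : ∀ p ∈ orbit G z, p ≠ 0 := by
    rintro _ ⟨g, -, rfl⟩ h
    have := act_inv_act g z
    rw [h, ← zero_smul ℂ z, act_smul, zero_smul] at this
    exact hz this.symm
  ext w
  constructor
  · rintro ⟨⟨⟨p, x, y⟩, ⟨hp, hx, -⟩, rfl⟩, hw⟩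
    have hy : y ≠ 0 := by
      rintro rfl
      exact hw ⟨(p, x, 0), ⟨hp, hx, rfl⟩, rfl⟩
    rcases lt_or_gt_of_ne hy with h | h
    · refine ⟨(-p, x, -y), ⟨Or.inr ?_, hx, neg_pos.2 h⟩, ansatzQuotMap_lineCurve_neg _ _ _ _ _⟩
      rw [← neg_mem_orbit_iff, neg_neg]; exact hp
    · exact ⟨(p, x, y), ⟨Or.inl hp, hx, h⟩, rfl⟩
  · rintro ⟨⟨p, x, y⟩, ⟨hp, hx, hy⟩, rfl⟩
    simp only [mem_Ioi] at hp hx hy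
    have hne : ∀ p : CSpace (k + 1), p ≠ 0 → ∀ y : ℝ, y ≠ 0 →
        ansatzQuotMap (lawlorCurve (k + 1) φ₁ μ) (lineCurve φ₂) (p, x, y) ∉
        ansatzQuotMap (lawlorCurve (k + 1) φ₁ μ) (lineCurve φ₂) ''
        (orbit G z ×ˢ lawlorInterval (k + 1) ×ˢ {0}) := by
      rintro p hp y hy ⟨⟨p', x', y'⟩, ⟨-, hx', hy'⟩, h⟩
      obtain rfl : y' = 0 := hy'
      rw [ansatzQuotMap, ansatzQuotMap, joinC_inj] at h
      have h1 := h.1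
      have hl : lineCurve φ₂ 0 = 0 := by simp [lineCurve]
      have hl' : lineCurve φ₂ y ≠ 0 := by
        rw [← norm_pos_iff, norm_lineCurve]; exact abs_pos.2 hy
      simp only [profileFst, hl, mul_zero, zero_smul] at h1
      exact (smul_ne_zero (mul_ne_zero (lawlorCurve_ne_zero hμ hx) hl') hp) h1.symm
    rcases hp with hp | hp
    · exact ⟨⟨(p, x, y), ⟨hp, hx, trivial⟩, rfl⟩, hne p (hp0 p hp) y hy.ne'⟩
    · have hp' := neg_mem_orbit_iff.2 hp
      rw [← ansatzQuotMap_lineCurve_neg]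
      exact ⟨⟨(-p, x, -y), ⟨hp', hx, trivial⟩, rfl⟩, hne _ (hp0 _ hp') _ (neg_ne_zero.2 hy.ne')⟩

end Embeddings

/-! ### Real vectors inside complex space. -/

section RealVectors

open Set Filter Topology

/-- The inclusion `ℝ^n ⊆ ℂ^n`. -/
noncomputable def realIncl (n : ℕ) : EuclideanSpace ℝ (Fin n) →L[ℝ] CSpace n :=
  LinearMap.toContinuousLinearMap
    { toFun := fun v => WithLp.toLp 2 fun i => (v i : ℂ)
      map_add' := fun v w => by ext i; simp
      map_smul' := fun c v => by ext i; simp }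

theorem realIncl_apply {n : ℕ} (v : EuclideanSpace ℝ (Fin n)) (i : Fin n) :
    realIncl n v i = (v i : ℂ) := rfl

theorem inner_realIncl {n : ℕ} (v w : EuclideanSpace ℝ (Fin n)) :
    inner ℂ (realIncl n v) (realIncl n w) = ((inner ℝ v w : ℝ) : ℂ) := by
  simp [PiLp.inner_apply, realIncl_apply]

theorem norm_realIncl {n : ℕ} (v : EuclideanSpace ℝ (Fin n)) : ‖realIncl n v‖ = ‖v‖ := by
  refine (pow_left_inj₀ (norm_nonneg _) (norm_nonneg _) two_ne_zero).1 ?_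
  have h := inner_realIncl v v
  rw [inner_self_eq_norm_sq_to_K, real_inner_self_eq_norm_sq] at h
  have h' := congrArg Complex.re h
  norm_cast at h'

theorem realIncl_injective (n : ℕ) : Function.Injective (realIncl n) := fun v w h => by
  rw [← sub_eq_zero, ← norm_eq_zero, ← norm_realIncl, map_sub, h, sub_self, norm_zero]

theorem map_mulVec_realIncl {n : ℕ} (A : Matrix (Fin n) (Fin n) ℝ) (v : EuclideanSpace ℝ (Fin n)) :
    (WithLp.toLp 2 ((A.map Complex.ofReal).mulVec (realIncl n v)) : CSpace n) =
      realIncl n (WithLp.toLp 2 (A.mulVec v)) := by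
  ext i
  simp [Matrix.mulVec, dotProduct, realIncl_apply]

end RealVectors

/-! ### The special orthogonal group: zeros of its moment map and its action on lines. -/

section SpecialOrthogonal

open Set Filter Topology

/-- A real special orthogonal matrix as an element of `SU(n)`. -/
theorem exists_suGroup_of_mem_specialOrthogonalGroup {n : ℕ} {A : Matrix (Fin n) (Fin n) ℝ}
    (hA : A ∈ Matrix.specialOrthogonalGroup (Fin n) ℝ) :
    ∃ g : SUGroup n, (g : Matrix (Fin n) (Fin n) ℂ) = A.map Complex.ofReal := by
  obtain ⟨h1, h2⟩ := Matrix.mem_specialOrthogonalGroup_iff.1 hA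
  rw [Matrix.mem_orthogonalGroup_iff'] at h1
  refine ⟨⟨A.map Complex.ofReal, Matrix.mem_specialUnitaryGroup_iff.2 ⟨?_, ?_⟩⟩, rfl⟩
  · rw [Matrix.mem_unitaryGroup_iff', Matrix.star_eq_conjTranspose]
    have e : (A.map Complex.ofReal).conjTranspose = A.transpose.map Complex.ofReal := by
      ext i j; simp
    have := congrArg (fun M : Matrix (Fin n) (Fin n) ℝ => M.map Complex.ofRealHom) h1
    simp only [Matrix.map_mul] at this
    rw [e]
    refine this.trans ?_
    ext i j
    simp [Matrix.one_apply]
  · have := RingHom.map_det Complex.ofRealHom A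
    rw [h2, map_one] at this
    exact this.symm

open scoped Matrix.Norms.Operator in
theorem map_exp_ofReal {n : ℕ} (A : Matrix (Fin n) (Fin n) ℝ) :
    (NormedSpace.exp A).map Complex.ofReal = NormedSpace.exp (A.map Complex.ofReal) :=
  NormedSpace.map_exp (Complex.ofRealHom.mapMatrix (m := Fin n))
    (continuous_id.matrix_map Complex.continuous_ofReal) A

theorem exp_mem_specialOrthogonalGroup {n : ℕ} {A : Matrix (Fin n) (Fin n) ℝ}
    (hA : A.transpose = -A) : NormedSpace.exp A ∈ Matrix.specialOrthogonalGroup (Fin n) ℝ := by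
  have key : ∀ B : Matrix (Fin n) (Fin n) ℝ, B.transpose = -B →
      (NormedSpace.exp B).transpose * NormedSpace.exp B = 1 := fun B hB => by
    rw [← Matrix.exp_transpose, hB, ← Matrix.exp_add_of_commute _ _ (Commute.refl B).neg_left,
      neg_add_cancel, NormedSpace.exp_zero]
  refine Matrix.mem_specialOrthogonalGroup_iff.2
    ⟨(Matrix.mem_orthogonalGroup_iff' _ _).2 (key A hA), ?_⟩
  -- The determinant of exp A is the square of that of exp(A/2), which is 1 by orthogonality.
  have h := key ((1 / 2 : ℝ) • A) (by rw [Matrix.transpose_smul, hA, smul_neg])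
  have h' := congrArg Matrix.det h
  rw [Matrix.det_mul, Matrix.det_transpose, Matrix.det_one] at h'
  have e : A = (1 / 2 : ℝ) • A + (1 / 2 : ℝ) • A := by rw [← add_smul]; norm_num
  rw [e, Matrix.exp_add_of_commute _ _ (Commute.refl _), Matrix.det_mul, h']

theorem IsSO.map_mem_lieGen {n : ℕ} {G : Subgroup (SUGroup n)} (hSO : IsSO G)
    {A : Matrix (Fin n) (Fin n) ℝ} (hA : A.transpose = -A) :
    A.map Complex.ofReal ∈ lieGen G := fun t => by
  have hm := exp_mem_specialOrthogonalGroup (A := t • A) (by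
    rw [Matrix.transpose_smul, hA, smul_neg])
  obtain ⟨g, hg⟩ := exists_suGroup_of_mem_specialOrthogonalGroup hm
  refine ⟨g, (hSO g).2 ⟨_, hm, hg⟩, ?_⟩
  rw [hg, map_exp_ofReal]
  congr 1
  ext i j
  simp

/-- Pair the moment map with the elementary rotation E_ij - E_ji. All coordinates of z therefore
share a phase up to sign. -/
theorem IsSO.im_conj_mul_eq_zero {n : ℕ} {G : Subgroup (SUGroup n)} (hSO : IsSO G)
    (hG : IsCompact (G : Set (SUGroup n))) {z : CSpace n} (hz : momentMap G z = 0) (i j : Fin n) :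
    (starRingEnd ℂ (z j) * z i).im = 0 := by
  have hX := hSO.map_mem_lieGen (A := Matrix.single i j 1 - Matrix.single j i 1) (by
    rw [Matrix.transpose_sub, Matrix.transpose_single, Matrix.transpose_single, neg_sub])
  have h := kahlerForm_lieGen_self hG hz hX
  have e : (matActL n ((Matrix.single i j (1 : ℝ) - Matrix.single j i 1).map Complex.ofReal) z :
      CSpace n) = EuclideanSpace.single i (z j) - EuclideanSpace.single j (z i) := by
    rw [matActL_apply]
    have : (Matrix.single i j (1 : ℝ) - Matrix.single j i 1).map Complex.ofReal =
        (Matrix.single i j (1 : ℂ) - Matrix.single j i 1) := by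
      ext a b
      simp [Matrix.single_apply, apply_ite Complex.ofReal]
    rw [this, Matrix.sub_mulVec, Matrix.single_mulVec, Matrix.single_mulVec]
    ext a
    simp [Function.update_apply]
  rw [e, inner_sub_left, EuclideanSpace.inner_single_left, EuclideanSpace.inner_single_left] at h
  simp only [Complex.sub_im, Complex.mul_im, Complex.conj_re, Complex.conj_im] at h ⊢
  linarith

/-- The zeros of the moment map of `SO(n)` are the multiples of real vectors. -/
theorem IsSO.exists_eq_exp_smul_realIncl {n : ℕ} {G : Subgroup (SUGroup n)} (hSO : IsSO G)
    (hG : IsCompact (G : Set (SUGroup n))) {z : CSpace n} (hz : momentMap G z = 0) :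
    ∃ (ψ : ℝ) (v : EuclideanSpace ℝ (Fin n)), z = Complex.exp (ψ * Complex.I) • realIncl n v := by
  by_cases h0 : z = 0
  · exact ⟨0, 0, by rw [h0, map_zero, smul_zero]⟩
  obtain ⟨j, hj⟩ : ∃ j, z j ≠ 0 := by
    by_contra! h
    exact h0 (by ext i; simp [h i])
  obtain ⟨c, hc⟩ : ∃ c, c = Complex.exp ((z j).arg * Complex.I) := ⟨_, rfl⟩
  have hcc : c * starRingEnd ℂ c = 1 := by
    rw [Complex.mul_conj, Complex.normSq_eq_norm_sq, hc, Complex.norm_exp_ofReal_mul_I]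
    simp
  have hzj : z j = ‖z j‖ * c := by rw [hc, Complex.norm_mul_exp_arg_mul_I]
  refine ⟨(z j).arg, WithLp.toLp 2 fun i => (starRingEnd ℂ c * z i).re, ?_⟩
  rw [← hc]
  ext i
  have him : (starRingEnd ℂ c * z i).im = 0 := by
    have h := hSO.im_conj_mul_eq_zero hG hz i j
    rw [hzj, map_mul, Complex.conj_ofReal, mul_assoc, Complex.im_ofReal_mul] at h
    exact (mul_eq_zero.1 h).resolve_left (norm_ne_zero_iff.2 hj)
  have hre : (((starRingEnd ℂ c * z i).re : ℝ) : ℂ) = starRingEnd ℂ c * z i :=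
    Complex.ext rfl (by rw [him, Complex.ofReal_im])
  rw [PiLp.smul_apply, realIncl_apply]
  simp only [smul_eq_mul]
  rw [hre, ← mul_assoc, hcc, one_mul]

/-- Extend u to an orthonormal basis and multiply the first column by the determinant. The sign s is
the price, unavoidable in dimension one. -/
theorem exists_specialOrthogonal_mulVec_single {k : ℕ} {u : EuclideanSpace ℝ (Fin (k + 1))}
    (hu : ‖u‖ = 1) : ∃ A ∈ Matrix.specialOrthogonalGroup (Fin (k + 1)) ℝ, ∃ s : ℝ, s * s = 1 ∧
      A.mulVec (Pi.single 0 1) = s • (u : Fin (k + 1) → ℝ) := by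
  obtain ⟨b, hb⟩ := Orthonormal.exists_orthonormalBasis_extension_of_card_eq (𝕜 := ℝ)
    (E := EuclideanSpace ℝ (Fin (k + 1))) (ι := Fin (k + 1)) (by simp) (v := fun _ => u) (s := {0})
    ⟨fun _ => hu, fun i j hij => absurd (Subsingleton.elim i j) hij⟩
  have hb0 : b 0 = u := hb 0 rfl
  let U : Matrix (Fin (k + 1)) (Fin (k + 1)) ℝ := Matrix.of fun i j => b j i
  have hU : U.transpose * U = 1 := by
    ext i j
    have := orthonormal_iff_ite.1 b.orthonormal i j
    rw [PiLp.inner_apply] at this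
    rw [Matrix.mul_apply, Matrix.one_apply, ← this]
    exact Finset.sum_congr rfl fun l _ => by simp [U, mul_comm]
  have hs : U.det * U.det = 1 := by
    have := congrArg Matrix.det hU
    rwa [Matrix.det_mul, Matrix.det_transpose, Matrix.det_one] at this
  let d : Fin (k + 1) → ℝ := Fin.cons U.det fun _ => 1
  refine ⟨U * Matrix.diagonal d, Matrix.mem_specialOrthogonalGroup_iff.2
    ⟨(Matrix.mem_orthogonalGroup_iff' _ _).2 ?_, ?_⟩, U.det, hs, ?_⟩
  · rw [Matrix.transpose_mul, Matrix.mul_assoc, ← Matrix.mul_assoc U.transpose, hU, Matrix.one_mul,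
      Matrix.diagonal_transpose, Matrix.diagonal_mul_diagonal, ← Matrix.diagonal_one]
    congr 1
    funext i
    refine Fin.cases ?_ (fun i => ?_) i
    · simpa [d] using hs
    · simp [d]
  · rw [Matrix.det_mul, Matrix.det_diagonal, Fin.prod_univ_succ]
    simpa [d] using hs
  · rw [← Matrix.mulVec_mulVec]
    have : (Matrix.diagonal d).mulVec (Pi.single 0 1) = Pi.single 0 U.det := by
      ext i
      rw [Matrix.mulVec_diagonal]
      refine Fin.cases ?_ (fun i => ?_) i <;> simp [d]
    rw [this, Matrix.mulVec_single]
    ext i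
    simp [U, hb0, mul_comm]

/-- `SO(n)` acts transitively on the lines through the origin. -/
theorem exists_specialOrthogonal_smul_eq {k : ℕ} {v : EuclideanSpace ℝ (Fin (k + 1))}
    (hv : ‖v‖ = 1) (w : EuclideanSpace ℝ (Fin (k + 1))) :
    ∃ A ∈ Matrix.specialOrthogonalGroup (Fin (k + 1)) ℝ, ∃ y : ℝ,
      w = y • WithLp.toLp 2 (A.mulVec v) := by
  rcases eq_or_ne w 0 with rfl | hw
  · exact ⟨1, one_mem _, 0, by rw [zero_smul]⟩
  obtain ⟨A, hA, s, hs, hAs⟩ := exists_specialOrthogonal_mulVec_single hv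
  obtain ⟨B, hB, t, ht, hBt⟩ := exists_specialOrthogonal_mulVec_single
    (u := ‖w‖⁻¹ • w) (by rw [norm_smul, norm_inv, norm_norm, inv_mul_cancel₀ (norm_ne_zero_iff.2 hw)])
  have hA' := (Matrix.mem_orthogonalGroup_iff' _ _).1 (Matrix.mem_specialOrthogonalGroup_iff.1 hA).1
  have hAv : A.transpose.mulVec v = s • Pi.single 0 1 := by
    have h := congrArg (fun x => s • A.transpose.mulVec x) hAs
    simp only [Matrix.mulVec_mulVec, hA', Matrix.one_mulVec, Matrix.mulVec_smul, smul_smul, hs,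
      one_smul] at h
    exact h.symm
  refine ⟨B * star A, mul_mem hB ?_, ‖w‖ * (s * t), ?_⟩
  · exact (star (⟨A, hA⟩ : Matrix.specialOrthogonalGroup (Fin (k + 1)) ℝ)).2
  · have e : (B * star A).mulVec v = (s * t) • (‖w‖⁻¹ • w : EuclideanSpace ℝ (Fin (k + 1))) := by
      rw [← Matrix.mulVec_mulVec, Matrix.star_eq_conjTranspose, Matrix.conjTranspose_eq_transpose_of_trivial,
        hAv, Matrix.mulVec_smul, hBt, smul_smul]
    rw [e]
    ext i
    have h0 := norm_ne_zero_iff.2 hw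
    simp only [PiLp.smul_apply, smul_eq_mul, Pi.smul_apply]
    have : ‖w‖ * (s * t) * (s * t * (‖w‖⁻¹ * w i)) = (s * s) * (t * t) * (‖w‖ * ‖w‖⁻¹) * w i := by ring
    rw [this, hs, ht, mul_inv_cancel₀ h0]
    ring

end SpecialOrthogonal

/-! ### The smooth extension across the axis for the special orthogonal group. -/

section SmoothNeck

open Set Filter Topology

variable {k : ℕ} {J : Set ℝ} {γ : ℝ → ℂ} {c : ℂ}

/-- The desingularised ansatz for the sphere, with `c` a unit complex number. -/
noncomputable def sphereAnsatz (c : ℂ) (γ : ℝ → ℂ) (q : EuclideanSpace ℝ (Fin (k + 1)) × ℝ) :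
    CSpace (k + 1 + 1) :=
  joinC ((γ q.2 * c) • realIncl (k + 1) q.1)
    (((1 / 2 * ‖q.1‖ ^ 2 - halfNormSq γ q.2 : ℝ) : ℂ) + Complex.I * ((-betaFun γ q.2 : ℝ) : ℂ))

theorem exists_hasFDerivAt_sphereAnsatz (hγ : IsProfileCurve k J γ)
    {q : EuclideanSpace ℝ (Fin (k + 1)) × ℝ} (hq : q.2 ∈ J) :
    ∃ L : EuclideanSpace ℝ (Fin (k + 1)) × ℝ →L[ℝ] CSpace (k + 1 + 1),
      HasFDerivAt (sphereAnsatz c γ) L q ∧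
      ∀ u, L u = joinC ((γ q.2 * c) • realIncl (k + 1) u.1 +
          (u.2 * (deriv γ q.2 * c) : ℂ) • realIncl (k + 1) q.1)
        ((inner ℝ q.1 u.1 : ℝ) - u.2 * (starRingEnd ℂ (γ q.2) * deriv γ q.2)) := by
  have V := (hasFDerivAt_fst (𝕜 := ℝ) (p := q))
  have X := (hasFDerivAt_snd (𝕜 := ℝ) (p := q))
  have g := ((hγ.hasDerivAt hq).mul_const c).hasFDerivAt.comp q X
  have bg := (hγ.hasDerivAt_betaFun hq).neg.hasFDerivAt.comp q X
  have ng := (hγ.hasDerivAt_halfNormSq hq).hasFDerivAt.comp q X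
  have nv := V.norm_sq.const_mul (1 / 2)
  have c1 := g.smul ((realIncl (k + 1)).hasFDerivAt.comp q V)
  have c2 := (Complex.ofRealCLM.hasFDerivAt.comp q (nv.sub ng)).add
    ((Complex.ofRealCLM.hasFDerivAt.comp q bg).const_mul Complex.I)
  have hc := (joinL (k + 1)).hasFDerivAt.comp q (c1.prodMk c2)
  refine ⟨_, hc.congr_of_eventuallyEq (Eventually.of_forall fun r => ?_), fun v => ?_⟩
  · simp only [sphereAnsatz, Function.comp_apply, joinL_apply]
    rfl
  · simp only [ContinuousLinearMap.comp_apply, joinL_apply]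
    rw [joinC_inj]
    constructor
    · simp
    · simp
      apply Complex.ext
      · simp
      · simp; ring

theorem contDiffOn_sphereAnsatz (hγ : IsProfileCurve k J γ) :
    ContDiffOn ℝ ∞ (sphereAnsatz (k := k) c γ) (univ ×ˢ J) := by
  have X : ContDiffOn ℝ ∞ (fun q : EuclideanSpace ℝ (Fin (k + 1)) × ℝ => q.2) (univ ×ˢ J) :=
    contDiff_snd.contDiffOn
  have mX : MapsTo (fun q : EuclideanSpace ℝ (Fin (k + 1)) × ℝ => q.2) (univ ×ˢ J) J :=
    fun q hq => hq.2
  have V : ContDiff ℝ ∞ (fun q : EuclideanSpace ℝ (Fin (k + 1)) × ℝ => q.1) := contDiff_fst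
  have c1 := ((hγ.smooth.comp X mX).mul (contDiffOn_const (c := c))).smul
    ((realIncl (k + 1)).contDiff.comp V).contDiffOn
  have c2 := (Complex.ofRealCLM.contDiff.comp_contDiffOn
    ((contDiff_const (c := (1 / 2 : ℝ)).mul (V.norm_sq ℝ)).contDiffOn.sub
      (hγ.smooth_halfNormSq.comp X mX))).add
    (contDiffOn_const (c := Complex.I) |>.mul (Complex.ofRealCLM.contDiff.comp_contDiffOn
    (hγ.smooth_betaFun.comp X mX).neg))
  refine ((joinL (k + 1)).contDiff.comp_contDiffOn (c1.prodMk c2)).congr fun r _ => ?_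
  simp only [sphereAnsatz, Function.comp_apply, joinL_apply]
  rfl

theorem fderiv_sphereAnsatz (hγ : IsProfileCurve k J γ)
    {q : EuclideanSpace ℝ (Fin (k + 1)) × ℝ} (hq : q.2 ∈ J)
    (u : EuclideanSpace ℝ (Fin (k + 1)) × ℝ) :
    fderiv ℝ (sphereAnsatz c γ) q u = joinC ((γ q.2 * c) • realIncl (k + 1) u.1 +
          (u.2 * (deriv γ q.2 * c) : ℂ) • realIncl (k + 1) q.1)
        ((inner ℝ q.1 u.1 : ℝ) - u.2 * (starRingEnd ℂ (γ q.2) * deriv γ q.2)) := by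
  obtain ⟨L, hL, hLu⟩ := exists_hasFDerivAt_sphereAnsatz (c := c) hγ hq
  rw [hL.fderiv, hLu]

theorem hasFDerivAt_sphereAnsatz (hγ : IsProfileCurve k J γ)
    {q : EuclideanSpace ℝ (Fin (k + 1)) × ℝ} (hq : q.2 ∈ J) :
    HasFDerivAt (sphereAnsatz c γ) (fderiv ℝ (sphereAnsatz c γ) q) q := by
  obtain ⟨L, hL, -⟩ := exists_hasFDerivAt_sphereAnsatz (c := c) hγ hq
  exact hL.differentiableAt.hasFDerivAt

/-- A primitive of the pullback of the Liouville form. -/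
noncomputable def spherePotential (γ : ℝ → ℂ) (q : EuclideanSpace ℝ (Fin (k + 1)) × ℝ) : ℝ :=
  1 / 2 * ‖q.1‖ ^ 2 * betaFun γ q.2 + selfAction γ q.2

theorem contDiffOn_spherePotential (hγ : IsProfileCurve k J γ) :
    ContDiffOn ℝ ∞ (spherePotential (k := k) γ) (univ ×ˢ J) := by
  have X : ContDiffOn ℝ ∞ (fun q : EuclideanSpace ℝ (Fin (k + 1)) × ℝ => q.2) (univ ×ˢ J) :=
    contDiff_snd.contDiffOn
  have mX : MapsTo (fun q : EuclideanSpace ℝ (Fin (k + 1)) × ℝ => q.2) (univ ×ˢ J) J :=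
    fun q hq => hq.2
  have V : ContDiff ℝ ∞ (fun q : EuclideanSpace ℝ (Fin (k + 1)) × ℝ => q.1) := contDiff_fst
  exact ((contDiff_const.mul (V.norm_sq ℝ)).contDiffOn.mul (hγ.smooth_betaFun.comp X mX)).add
    (hγ.smooth_selfAction.comp X mX)

theorem exists_hasFDerivAt_spherePotential (hγ : IsProfileCurve k J γ)
    {q : EuclideanSpace ℝ (Fin (k + 1)) × ℝ} (hq : q.2 ∈ J) :
    ∃ L : EuclideanSpace ℝ (Fin (k + 1)) × ℝ →L[ℝ] ℝ, HasFDerivAt (spherePotential γ) L q ∧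
      ∀ u, L u = inner ℝ q.1 u.1 * betaFun γ q.2 + u.2 *
        (1 / 2 * ‖q.1‖ ^ 2 * (starRingEnd ℂ (γ q.2) * deriv γ q.2).im +
          (halfNormSq γ q.2 * (starRingEnd ℂ (γ q.2) * deriv γ q.2).im -
            betaFun γ q.2 * (starRingEnd ℂ (γ q.2) * deriv γ q.2).re)) := by
  have X := (hasFDerivAt_snd (𝕜 := ℝ) (p := q))
  have bg := (hγ.hasDerivAt_betaFun hq).hasFDerivAt.comp q X
  have sg := (hγ.hasDerivAt_selfAction hq).hasFDerivAt.comp q X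
  have nv := (hasFDerivAt_fst (𝕜 := ℝ) (p := q)).norm_sq.const_mul (1 / 2)
  refine ⟨_, (nv.mul bg).add sg, fun u => ?_⟩
  simp
  ring

/-- The pulled-back Hermitian form is real, which is the Lagrangian condition, and it is positive
definite if γ and γ' do not vanish, also at the origin of ℝⁿ. -/
theorem inner_fderiv_sphereAnsatz (hγ : IsProfileCurve k J γ) (hc : starRingEnd ℂ c * c = 1)
    {q : EuclideanSpace ℝ (Fin (k + 1)) × ℝ} (hq : q.2 ∈ J)
    (u w : EuclideanSpace ℝ (Fin (k + 1)) × ℝ) :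
    inner ℂ (fderiv ℝ (sphereAnsatz c γ) q u) (fderiv ℝ (sphereAnsatz c γ) q w) =
      ((Complex.normSq (γ q.2) * inner ℝ u.1 w.1 + inner ℝ q.1 u.1 * inner ℝ q.1 w.1 +
        u.2 * w.2 * (Complex.normSq (deriv γ q.2) * (‖q.1‖ ^ 2 + Complex.normSq (γ q.2))) : ℝ)
          : ℂ) := by
  rw [fderiv_sphereAnsatz hγ hq, fderiv_sphereAnsatz hγ hq, inner_joinC]
  simp only [inner_add_left, inner_add_right, inner_smul_left, inner_smul_right, inner_realIncl,
    real_inner_self_eq_norm_sq, map_mul, map_sub, Complex.conj_ofReal, Complex.conj_conj]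
  rw [real_inner_comm q.1 u.1]
  push_cast
  rw [Complex.normSq_eq_conj_mul_self, Complex.normSq_eq_conj_mul_self]
  linear_combination (starRingEnd ℂ (γ q.2) * γ q.2 * inner ℝ u.1 w.1 +
    starRingEnd ℂ (γ q.2) * deriv γ q.2 * w.2 * inner ℝ q.1 u.1 +
    u.2 * γ q.2 * starRingEnd ℂ (deriv γ q.2) * inner ℝ q.1 w.1 +
    u.2 * w.2 * starRingEnd ℂ (deriv γ q.2) * deriv γ q.2 * ‖q.1‖ ^ 2) * hc

theorem fderiv_sphereAnsatz_injective (hγ : IsProfileCurve k J γ) (hc : starRingEnd ℂ c * c = 1)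
    {q : EuclideanSpace ℝ (Fin (k + 1)) × ℝ} (hq : q.2 ∈ J) (h0 : γ q.2 ≠ 0)
    (h1 : deriv γ q.2 ≠ 0) : Function.Injective (fderiv ℝ (sphereAnsatz c γ) q) := by
  refine (injective_iff_map_eq_zero _).2 fun u hu => ?_
  have h := inner_fderiv_sphereAnsatz hγ hc hq u u
  rw [hu, inner_zero_left] at h
  have h' : Complex.normSq (γ q.2) * inner ℝ u.1 u.1 + inner ℝ q.1 u.1 * inner ℝ q.1 u.1 +
        u.2 * u.2 * (Complex.normSq (deriv γ q.2) * (‖q.1‖ ^ 2 + Complex.normSq (γ q.2))) = 0 := by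
    exact_mod_cast h.symm
  rw [real_inner_self_eq_norm_sq] at h'
  have p0 := Complex.normSq_pos.2 h0
  have p1 := Complex.normSq_pos.2 h1
  have pp : 0 < Complex.normSq (deriv γ q.2) * (‖q.1‖ ^ 2 + Complex.normSq (γ q.2)) := by positivity
  have t1 : 0 ≤ Complex.normSq (γ q.2) * ‖u.1‖ ^ 2 := by positivity
  have t2 := mul_self_nonneg (inner ℝ q.1 u.1 : ℝ)
  have t3 := mul_nonneg (mul_self_nonneg u.2) pp.le
  have e1 : Complex.normSq (γ q.2) * ‖u.1‖ ^ 2 = 0 := by linarith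
  have e3 : u.2 * u.2 * (Complex.normSq (deriv γ q.2) * (‖q.1‖ ^ 2 + Complex.normSq (γ q.2))) = 0 := by
    linarith
  refine Prod.ext ?_ ?_
  · exact norm_eq_zero.1 (pow_eq_zero_iff two_ne_zero |>.1 ((mul_eq_zero.1 e1).resolve_left p0.ne'))
  · exact mul_self_eq_zero.1 ((mul_eq_zero.1 e3).resolve_right pp.ne')

/-- Factor off the real coordinate matrix. The remaining bordered matrix has the scalar block a, and
its Schur complement is -(d + b‖v‖² / a). -/
theorem holVolForm_sphereAnsatz {a b d : ℂ} (ha : a ≠ 0) (v : EuclideanSpace ℝ (Fin (k + 1)))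
    (u : Fin (k + 1 + 1) → EuclideanSpace ℝ (Fin (k + 1)) × ℝ) :
    ∃ r : ℝ, holVolForm (fun j => joinC (a • realIncl (k + 1) (u j).1 +
        ((u j).2 * b : ℂ) • realIncl (k + 1) v) ((inner ℝ v (u j).1 : ℝ) - (u j).2 * d)) =
      r * (a ^ k * (a * d + b * (‖v‖ ^ 2 : ℝ))) := by
  let D : Matrix (Fin (k + 1) ⊕ Fin 1) (Fin (k + 1) ⊕ Fin 1) ℂ :=
    Matrix.fromBlocks (a • (1 : Matrix (Fin (k + 1)) (Fin (k + 1)) ℂ))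
      (Matrix.of fun i _ => b * (v i : ℂ)) (Matrix.of fun _ j => (v j : ℂ)) (Matrix.of fun _ _ => -d)
  let A : Matrix (Fin (k + 1) ⊕ Fin 1) (Fin (k + 1 + 1)) ℝ := Matrix.of fun i j =>
    Sum.elim (fun l => (u j).1 l) (fun _ => (u j).2) i
  let e : Fin (k + 1 + 1) ≃ Fin (k + 1) ⊕ Fin 1 := (finSumFinEquiv (m := k + 1) (n := 1)).symm
  have ecast : ∀ i : Fin (k + 1), e i.castSucc = Sum.inl i := fun i => by
    simp only [e, Equiv.symm_apply_eq]; ext; simp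
  have elast : e (Fin.last (k + 1)) = Sum.inr 0 := by
    simp only [e, Equiv.symm_apply_eq]; ext; simp
  have hprod : (Matrix.of fun i j => joinC (a • realIncl (k + 1) (u j).1 +
        ((u j).2 * b : ℂ) • realIncl (k + 1) v) ((inner ℝ v (u j).1 : ℝ) - (u j).2 * d) i) =
      D.submatrix e e * (A.submatrix e id).map Complex.ofReal := by
    rw [← Matrix.submatrix_map, Matrix.submatrix_mul_equiv]
    ext i j
    rw [Matrix.submatrix_apply, Matrix.mul_apply, Fintype.sum_sum_type, Fin.sum_univ_one]
    refine Fin.lastCases ?_ (fun i => ?_) i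
    · rw [elast, Matrix.of_apply, joinC_last]
      simp [D, A, PiLp.inner_apply, mul_comm]
      ring
    · rw [ecast, Matrix.of_apply, joinC_castSucc]
      simp [D, A, Matrix.one_apply, realIncl_apply]
      ring
  have hD : (D.submatrix e e).det = a ^ k * (-(a * d) - b * (‖v‖ ^ 2 : ℝ)) := by
    have hinv : (a⁻¹ • (1 : Matrix (Fin (k + 1)) (Fin (k + 1)) ℂ)) *
        (a • (1 : Matrix (Fin (k + 1)) (Fin (k + 1)) ℂ)) = 1 := by
      rw [smul_mul_smul_comm, inv_mul_cancel₀ ha, one_smul, one_mul]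
    let _ : Invertible (a • (1 : Matrix (Fin (k + 1)) (Fin (k + 1)) ℂ)) :=
      ⟨a⁻¹ • 1, hinv, mul_eq_one_comm.1 hinv⟩
    have hi : ⅟(a • (1 : Matrix (Fin (k + 1)) (Fin (k + 1)) ℂ)) = a⁻¹ • 1 := rfl
    rw [Matrix.det_submatrix_equiv_self, Matrix.det_fromBlocks₁₁, Matrix.det_smul, Matrix.det_one,
      hi, Fintype.card_fin, mul_one, Matrix.det_fin_one, Matrix.sub_apply, Matrix.mul_smul,
      Matrix.smul_mul, Matrix.mul_one, Matrix.smul_apply, Matrix.mul_apply,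
      EuclideanSpace.real_norm_sq_eq]
    simp only [Matrix.of_apply, smul_eq_mul]
    push_cast
    have : ∑ x, (v x : ℂ) * (b * (v x : ℂ)) = b * ∑ x, (v x : ℂ) ^ 2 := by
      rw [Finset.mul_sum]
      exact Finset.sum_congr rfl fun x _ => by ring
    rw [this, pow_succ]
    field_simp
  refine ⟨-(A.submatrix e id).det, ?_⟩
  have hA : ((A.submatrix e id).map Complex.ofReal).det = ((A.submatrix e id).det : ℂ) :=
    (RingHom.map_det Complex.ofRealHom (A.submatrix e id)).symm
  rw [holVolForm, hprod, Matrix.det_mul, hD, hA]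
  push_cast
  ring

theorem sphere_liouville_identity (hc : starRingEnd ℂ c * c = 1) (g g' : ℂ) (s i N b : ℝ) :
    (g * c * (starRingEnd ℂ (g * c) * i) + s * (g' * c) * (starRingEnd ℂ (g * c) * N) +
      starRingEnd ℂ (((1 / 2 * N - 1 / 2 * ‖g‖ ^ 2 : ℝ) : ℂ) + Complex.I * ((-b : ℝ) : ℂ)) *
        (i - s * (starRingEnd ℂ g * g'))).im =
    i * b + s * (1 / 2 * N * (starRingEnd ℂ g * g').im +
      (1 / 2 * ‖g‖ ^ 2 * (starRingEnd ℂ g * g').im - b * (starRingEnd ℂ g * g').re)) := by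
  have e : g * c * (starRingEnd ℂ (g * c) * i) + s * (g' * c) * (starRingEnd ℂ (g * c) * N) =
      starRingEnd ℂ g * g * i + starRingEnd ℂ g * g' * (s * N) := by
    rw [map_mul]
    linear_combination (starRingEnd ℂ g * g * i + starRingEnd ℂ g * g' * (s * N)) * hc
  rw [e, ← Complex.normSq_eq_norm_sq, Complex.normSq_apply]
  simp only [Complex.add_im, Complex.mul_im, Complex.mul_re, Complex.add_re, Complex.conj_re,
    Complex.conj_im, Complex.ofReal_re, Complex.ofReal_im, Complex.sub_re, Complex.sub_im,
    Complex.I_re, Complex.I_im]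
  ring

theorem isExactSpecialLagrangianMap_sphereAnsatz (hγ : IsProfileCurve k J γ) (α : ℝ)
    (h0 : ∀ x ∈ J, γ x ≠ 0) :
    IsExactSpecialLagrangianMap (univ ×ˢ J)
      (sphereAnsatz (k := k) (Complex.exp (α * Complex.I)) γ) := by
  set c := Complex.exp (α * Complex.I) with hcdef
  have hc : starRingEnd ℂ c * c = 1 := by
    rw [← Complex.normSq_eq_conj_mul_self, Complex.normSq_eq_norm_sq, hcdef,
      Complex.norm_exp_ofReal_mul_I]
    simp
  obtain ⟨θ, hθ⟩ := hγ.phase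
  refine .of_tangent ((isOpen_univ.prod hγ.isOpen).isSubmanifold (by simp))
    (contDiffOn_sphereAnsatz hγ) (f' := fun q => fderiv ℝ (sphereAnsatz c γ) q)
    (fun q hq => (hasFDerivAt_sphereAnsatz hγ hq.2).hasFDerivWithinAt)
    (contDiffOn_spherePotential hγ) (h' := fun q => fderiv ℝ (spherePotential γ) q)
    (fun q hq => ?_) ?_ ?_ ((k + 1) * α + θ) ?_
  · obtain ⟨L, hL, -⟩ := exists_hasFDerivAt_spherePotential (k := k) hγ hq.2
    exact hL.differentiableAt.hasFDerivAt.hasFDerivWithinAt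
  · intro q hq u w _ _
    rw [kahlerForm_eq_im_inner, inner_fderiv_sphereAnsatz hγ hc hq.2, Complex.ofReal_im]
  · intro q hq u _
    obtain ⟨L, hL, hLu⟩ := exists_hasFDerivAt_spherePotential (k := k) hγ hq.2
    rw [hL.fderiv, hLu, fderiv_sphereAnsatz hγ hq.2, liouvilleForm_eq_im_inner, sphereAnsatz,
      inner_joinC]
    simp only [inner_add_right, inner_smul_left, inner_smul_right, inner_realIncl,
      real_inner_self_eq_norm_sq]
    exact (sphere_liouville_identity hc (γ q.2) (deriv γ q.2) u.2 (inner ℝ q.1 u.1) (‖q.1‖ ^ 2)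
      (betaFun γ q.2)).symm
  · intro q hq u _
    obtain ⟨r, hr⟩ := holVolForm_sphereAnsatz (a := γ q.2 * c) (b := deriv γ q.2 * c)
      (d := starRingEnd ℂ (γ q.2) * deriv γ q.2)
      (mul_ne_zero (h0 _ hq.2) (Complex.exp_ne_zero _)) q.1 u
    obtain ⟨r', hr'⟩ := hθ _ hq.2
    have e : (fun j => fderiv ℝ (sphereAnsatz c γ) q (u j)) = fun j =>
        joinC ((γ q.2 * c) • realIncl (k + 1) (u j).1 +
          ((u j).2 * (deriv γ q.2 * c) : ℂ) • realIncl (k + 1) q.1)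
          ((inner ℝ q.1 (u j).1 : ℝ) - (u j).2 * (starRingEnd ℂ (γ q.2) * deriv γ q.2)) :=
      funext fun j => fderiv_sphereAnsatz hγ hq.2 (u j)
    -- Again γ^k γ' splits off with a nonnegative factor, now |γ|² + ‖v‖²; the rotation c
    -- contributes its (k+1)-st power.
    have hval : (γ q.2 * c) ^ k * (γ q.2 * c * (starRingEnd ℂ (γ q.2) * deriv γ q.2) +
        deriv γ q.2 * c * (‖q.1‖ ^ 2 : ℝ)) =
        (((Complex.normSq (γ q.2) + ‖q.1‖ ^ 2) * r' : ℝ) : ℂ) *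
          Complex.exp (((k + 1) * α + θ : ℝ) * Complex.I) := by
      have hexp : Complex.exp (((k + 1) * α + θ : ℝ) * Complex.I) =
          c ^ (k + 1) * Complex.exp (θ * Complex.I) := by
        rw [hcdef, ← Complex.exp_nat_mul, ← Complex.exp_add]
        push_cast
        ring_nf
      rw [hexp]
      push_cast
      rw [Complex.normSq_eq_conj_mul_self]
      linear_combination (c ^ (k + 1) * (starRingEnd ℂ (γ q.2) * γ q.2 + ‖q.1‖ ^ 2)) * hr'
    have hee : Complex.exp (-(((k + 1) * α + θ : ℝ) : ℂ) * Complex.I) *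
        Complex.exp (((k + 1) * α + θ : ℝ) * Complex.I) = 1 := by
      rw [← Complex.exp_add, ← add_mul, neg_add_cancel, zero_mul, Complex.exp_zero]
    rw [e, hr, hval, mul_left_comm, mul_left_comm (Complex.exp (-(((k + 1) * α + θ : ℝ) : ℂ) * Complex.I)), hee, mul_one, ← Complex.ofReal_mul, Complex.ofReal_im]

/-- β determines x, and v follows by linearity. The origin belongs to the domain, so upper bounds on
‖v‖ and |γ| suffice for properness. -/
theorem isSmoothEmbeddingOn_sphereAnsatz_lawlor {φ μ : ℝ} (hμ : 0 < μ)
    (hc : starRingEnd ℂ c * c = 1) :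
    IsSmoothEmbeddingOn (k + 1 + 1) (univ ×ˢ lawlorInterval (k + 1))
      (sphereAnsatz (k := k) c (lawlorCurve (k + 1) φ μ)) := by
  have hγ := isProfileCurve_lawlorCurve k φ μ
  have hc0 : c ≠ 0 := by rintro rfl; simp at hc
  have hc1 : ‖c‖ = 1 := by
    have h := congrArg Complex.re hc
    rw [← Complex.normSq_eq_conj_mul_self, Complex.normSq_eq_norm_sq, Complex.ofReal_re,
      Complex.one_re] at h
    exact (pow_eq_one_iff_of_nonneg (norm_nonneg _) two_ne_zero).1 h
  refine ⟨.of_tangent ((isOpen_univ.prod hγ.isOpen).isSubmanifold (by simp))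
    (contDiffOn_sphereAnsatz hγ)
    (fun q hq => (hasFDerivAt_sphereAnsatz hγ hq.2).hasFDerivWithinAt)
    fun q hq u w _ _ h => fderiv_sphereAnsatz_injective hγ hc hq.2 (lawlorCurve_ne_zero hμ hq.2)
      (deriv_lawlorCurve_ne_zero hμ hq.2) h,
    isEmbedding_domRestrict_of_locally_proper (contDiffOn_sphereAnsatz hγ).continuousOn ?_ ?_⟩
  · rintro ⟨v, x⟩ ⟨-, hx⟩ ⟨v', x'⟩ ⟨-, hx'⟩ h
    simp only at hx hx'
    rw [sphereAnsatz, sphereAnsatz, joinC_inj] at h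
    obtain ⟨h1, h2⟩ := h
    have him := congrArg Complex.im h2
    simp only [Complex.add_im, Complex.ofReal_im, Complex.im_mul_ofReal, Complex.I_im, one_mul,
      zero_add, neg_inj] at him
    obtain rfl := (strictMonoOn_betaFun_lawlorCurve (k := k) (φ := φ) hμ).injOn hx hx' him
    exact Prod.ext (realIncl_injective _ (smul_right_injective _
      (mul_ne_zero (lawlorCurve_ne_zero hμ hx) hc0) h1)) rfl
  · intro p _
    generalize sphereAnsatz c (lawlorCurve (k + 1) φ μ) p = w
    obtain ⟨R, hR⟩ : ∃ R, R = ‖w‖ + 1 := ⟨_, rfl⟩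
    have hR0 : 0 < R := by rw [hR]; positivity
    obtain ⟨A, hA⟩ : ∃ A, A = (R / μ) ^ 2 + 2 * R + 1 := ⟨_, rfl⟩
    obtain ⟨C, hC, hCc, hCm⟩ := exists_isCompact_norm_lawlorCurve_le (k := k) φ hμ A
    refine ⟨_, eventually_norm_lt w, Metric.closedBall 0 (R / μ) ×ˢ C,
      prod_mono (subset_univ _) hC, (isCompact_closedBall _ _).prod hCc, ?_⟩
    rintro q ⟨-, hq⟩ hqw
    rw [mem_ofPred_eq, ← hR] at hqw
    have h1 := (norm_fst_le_norm_joinC _ _).trans (le_of_lt hqw)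
    rw [norm_smul, norm_realIncl, norm_mul, hc1, mul_one] at h1
    have h2 := (Complex.abs_re_le_norm _).trans ((norm_snd_le_norm_joinC _ _).trans (le_of_lt hqw))
    simp only [Complex.add_re, Complex.ofReal_re, Complex.re_mul_ofReal, Complex.I_re, zero_mul,
      add_zero, halfNormSq] at h2
    have h3 := le_norm_lawlorCurve (φ := φ) hμ hq
    have hv : ‖q.1‖ ≤ R / μ := by
      rw [le_div_iff₀ hμ, mul_comm]
      exact (mul_le_mul_of_nonneg_right h3 (norm_nonneg _)).trans h1
    refine ⟨mem_closedBall_zero_iff.2 hv, hCm _ hq ?_⟩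
    have h4 : ‖q.1‖ ^ 2 ≤ (R / μ) ^ 2 := pow_le_pow_left₀ (norm_nonneg _) hv 2
    have h5 := neg_abs_le (1 / 2 * ‖q.1‖ ^ 2 - 1 / 2 * ‖lawlorCurve (k + 1) φ μ q.2‖ ^ 2)
    nlinarith [sq_nonneg (‖lawlorCurve (k + 1) φ μ q.2‖ - 1)]

/-- The substitution u = y w sends unit vectors and signed radii onto ℝⁿ, since SO(n) acts
transitively on lines. -/
theorem IsSO.image_ansatz_line {G : Subgroup (SUGroup (k + 1))} (hSO : IsSO G) {ψ : ℝ}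
    {v : EuclideanSpace ℝ (Fin (k + 1))} (hv : ‖v‖ = 1) (γ : ℝ → ℂ) (φ : ℝ) (I : Set ℝ) :
    ansatzQuotMap γ (lineCurve φ) '' (orbit G (Complex.exp (ψ * Complex.I) • realIncl (k + 1) v) ×ˢ
      I ×ˢ univ) = sphereAnsatz (Complex.exp ((φ + ψ : ℝ) * Complex.I)) γ '' (univ ×ˢ I) := by
  have horb : ∀ g : SUGroup (k + 1), ∀ A : Matrix (Fin (k + 1)) (Fin (k + 1)) ℝ,
      (g : Matrix (Fin (k + 1)) (Fin (k + 1)) ℂ) = A.map Complex.ofReal →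
      act g (Complex.exp (ψ * Complex.I) • realIncl (k + 1) v) =
        Complex.exp (ψ * Complex.I) • realIncl (k + 1) (WithLp.toLp 2 (A.mulVec v)) :=
    fun g A hgA => by rw [act_smul, ← map_mulVec_realIncl, act, hgA]
  have hnorm : ∀ A ∈ Matrix.specialOrthogonalGroup (Fin (k + 1)) ℝ,
      ‖(WithLp.toLp 2 (A.mulVec v) : EuclideanSpace ℝ (Fin (k + 1)))‖ = 1 := fun A hA => by
    obtain ⟨g, hg⟩ := exists_suGroup_of_mem_specialOrthogonalGroup hA
    have h := inner_act_act g (realIncl (k + 1) v) (realIncl (k + 1) v)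
    rw [act, hg, map_mulVec_realIncl, inner_realIncl, inner_realIncl, real_inner_self_eq_norm_sq,
      real_inner_self_eq_norm_sq, hv] at h
    have h' : ‖(WithLp.toLp 2 (A.mulVec v) : EuclideanSpace ℝ (Fin (k + 1)))‖ ^ 2 = 1 ^ 2 := by
      exact_mod_cast h
    exact (pow_left_inj₀ (norm_nonneg _) zero_le_one two_ne_zero).1 h'
  have hmap : ∀ w : EuclideanSpace ℝ (Fin (k + 1)), ‖w‖ = 1 → ∀ x y : ℝ,
      ansatzQuotMap γ (lineCurve φ) (Complex.exp (ψ * Complex.I) • realIncl (k + 1) w, x, y) =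
        sphereAnsatz (Complex.exp ((φ + ψ : ℝ) * Complex.I)) γ (y • w, x) := fun w hw x y => by
    rw [ansatzQuotMap, sphereAnsatz, joinC_inj]
    constructor
    · simp only [profileFst, lineCurve, map_smul]
      rw [← Complex.coe_smul, smul_smul, smul_smul, Complex.ofReal_add, add_mul, Complex.exp_add]
      congr 1
      ring
    · simp only [profileSnd, norm_lineCurve, betaFun_lineCurve, norm_smul, hw, halfNormSq,
        Real.norm_eq_abs, mul_one, zero_sub]
      rw [mul_sub]
  ext w
  constructor
  · rintro ⟨⟨p, x, y⟩, ⟨⟨g, hg, hp⟩, hx, -⟩, rfl⟩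
    obtain ⟨A, hA, hgA⟩ := (hSO g).1 hg
    simp only at hp hx
    rw [hp, horb g A hgA, hmap _ (hnorm A hA)]
    exact ⟨_, ⟨trivial, hx⟩, rfl⟩
  · rintro ⟨⟨u, x⟩, ⟨-, hx⟩, rfl⟩
    obtain ⟨A, hA, y, rfl⟩ := exists_specialOrthogonal_smul_eq hv u
    obtain ⟨g, hg⟩ := exists_suGroup_of_mem_specialOrthogonalGroup hA
    rw [← hmap _ (hnorm A hA), ← horb g A hg]
    exact ⟨_, ⟨⟨g, (hSO g).2 ⟨A, hA, hg⟩, rfl⟩, hx, trivial⟩, rfl⟩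

theorem IsSO.isEmbeddedExactSpecialLagrangian_ansatz_line {G : Subgroup (SUGroup (k + 1))}
    (hSO : IsSO G) (hG : IsCompact (G : Set (SUGroup (k + 1)))) {z : CSpace (k + 1)}
    (hz : momentMap G z = 0) (hz1 : ‖z‖ = 1) (φ₁ φ₂ : ℝ) {μ : ℝ} (hμ : 0 < μ) :
    IsEmbeddedExactSpecialLagrangian (ansatzQuotMap (lawlorCurve (k + 1) φ₁ μ) (lineCurve φ₂) ''
      (orbit G z ×ˢ lawlorInterval (k + 1) ×ˢ univ)) := by
  obtain ⟨ψ, v, rfl⟩ := hSO.exists_eq_exp_smul_realIncl hG hz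
  have hv : ‖v‖ = 1 := by
    rwa [norm_smul, Complex.norm_exp_ofReal_mul_I, one_mul, norm_realIncl] at hz1
  rw [hSO.image_ansatz_line hv]
  refine (isExactSpecialLagrangianMap_sphereAnsatz (isProfileCurve_lawlorCurve k φ₁ μ) _
    fun x hx => lawlorCurve_ne_zero hμ hx).image (isSmoothEmbeddingOn_sphereAnsatz_lawlor hμ ?_)
  rw [← Complex.normSq_eq_conj_mul_self, Complex.normSq_eq_norm_sq, Complex.norm_exp_ofReal_mul_I]
  simp

end SmoothNeck

/-! ### Assembly. -/

section MainTheorem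

open Set

variable {k : ℕ} {G : Subgroup (SUGroup (k + 1))} {z : CSpace (k + 1)}

theorem isSmoothEmbeddingOn_ansatz_lawlor_lawlor {Q : Set (CSpace (k + 1))}
    (hQ : IsSpecialLegendrian Q) {φ₁ φ₂ μ₁ μ₂ : ℝ} (hμ₁ : 0 < μ₁) (hμ₂ : 0 < μ₂)
    (hrot : ∀ t : ℝ, (k + 1 : ℕ) * |t| < 2 * Real.pi → ∀ p ∈ Q,
      Complex.exp (t * Complex.I) • p ∈ Q → t = 0) :
    IsSmoothEmbeddingOn (k + 1 + 1) (Q ×ˢ lawlorInterval (k + 1) ×ˢ lawlorInterval (k + 1))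
      (ansatzQuotMap (lawlorCurve (k + 1) φ₁ μ₁) (lawlorCurve (k + 1) φ₂ μ₂)) := by
  have hγ := isProfileCurve_lawlorCurve k φ₁ μ₁
  have hξ := isProfileCurve_lawlorCurve k φ₂ μ₂
  exact ⟨isImmersionOn_ansatz hQ hγ hξ hγ.isOpen hξ.isOpen subset_rfl subset_rfl
    (fun x hx => ⟨lawlorCurve_ne_zero hμ₁ hx, deriv_lawlorCurve_ne_zero hμ₁ hx⟩)
    (fun x hx => ⟨lawlorCurve_ne_zero hμ₂ hx, deriv_lawlorCurve_ne_zero hμ₂ hx⟩),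
    isEmbedding_ansatz_lawlor_lawlor hQ hμ₁ hμ₂ (injOn_ansatz_lawlor_lawlor hQ hμ₁ hμ₂ hrot)⟩

/-- If `C_k` is small, `G · V` is not mapped to itself by small rotations. -/
theorem eq_zero_of_exp_smul_mem_orbit {z' : CSpace (k + 1)} (hz' : z' ≠ 0) {c : ℂ} (hc : c ≠ 0)
    (hcard : ENat.card (CyclicQuotient G z') ≤ (k + 1 : ℕ)) {t : ℝ}
    (ht : (k + 1 : ℕ) * |t| < 2 * Real.pi) {p : CSpace (k + 1)} (hp : p ∈ orbit G (c • z'))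
    (hp' : Complex.exp (t * Complex.I) • p ∈ orbit G (c • z')) : t = 0 := by
  obtain ⟨g, hg, rfl⟩ := hp
  obtain ⟨h, hh, e⟩ := hp'
  have h1 : act (g⁻¹ * h) z' = Complex.exp (t * Complex.I) • z' := by
    refine smul_right_injective _ hc ?_
    simp only
    rw [← act_smul, act_mul, ← e, act_smul, act_inv_act, smul_comm]
  obtain ⟨j, hj0, hj, hpow⟩ := exists_pow_eq_one_of_card_le hz' hcard
    (G.mul_mem (G.inv_mem hg) hh) h1
  rw [← Complex.exp_nat_mul, Complex.exp_eq_one_iff] at hpow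
  obtain ⟨N, hN⟩ := hpow
  have hN' : (j : ℝ) * t = N * (2 * Real.pi) := by
    have h2 : (((j : ℝ) * t : ℝ) : ℂ) * Complex.I = ((N * (2 * Real.pi) : ℝ) : ℂ) * Complex.I := by
      push_cast
      linear_combination hN
    exact_mod_cast mul_right_cancel₀ Complex.I_ne_zero h2
  have hpi := Real.pi_pos
  -- As j ≤ n, the multiple j t of 2π is smaller than 2π in absolute value, so it is zero.
  have hlt : |(j : ℝ) * t| < 2 * Real.pi := by
    rw [abs_mul, Nat.abs_cast]
    refine lt_of_le_of_lt ?_ ht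
    have : (j : ℝ) ≤ (k + 1 : ℕ) := by exact_mod_cast hj
    gcongr
  have hN0 : N = 0 := by
    rw [hN', abs_mul, abs_of_pos (by positivity : 0 < 2 * Real.pi)] at hlt
    have h3 : |(N : ℝ)| < 1 := by
      by_contra! h
      exact absurd hlt (not_lt.2 (le_mul_of_one_le_left (by positivity) h))
    exact Int.abs_lt_one_iff.1 (by exact_mod_cast h3)
  rw [hN0, Int.cast_zero, zero_mul] at hN'
  exact (mul_eq_zero.1 hN').resolve_left (by exact_mod_cast hj0.ne')

theorem image_ansatz_line_zero {φ₁ φ₂ μ : ℝ} (hμ : 0 < μ) (hz : ∀ p ∈ orbit G z, p ≠ 0) :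
    ansatzQuotMap (lawlorCurve (k + 1) φ₁ μ) (lineCurve φ₂) ''
        (orbit G z ×ˢ lawlorInterval (k + 1) ×ˢ {0}) =
      ansatzQuotMap (lawlorCurve (k + 1) φ₁ μ) (lineCurve φ₂) ''
        (orbit G z ×ˢ lawlorInterval (k + 1) ×ˢ univ) ∩ singularAxis (k + 1) := by
  have hl : lineCurve φ₂ 0 = 0 := by simp [lineCurve]
  ext w
  constructor
  · rintro ⟨⟨p, x, y⟩, ⟨hp, hx, hy⟩, rfl⟩
    obtain rfl : y = 0 := hy
    refine ⟨⟨_, ⟨hp, hx, trivial⟩, rfl⟩, _, joinC_inj.2 ⟨?_, rfl⟩⟩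
    simp only [profileFst, hl, mul_zero, zero_smul]
  · rintro ⟨⟨⟨p, x, y⟩, ⟨hp, hx, -⟩, rfl⟩, c, hc⟩
    refine ⟨(p, x, y), ⟨hp, hx, ?_⟩, rfl⟩
    have h := (joinC_inj.1 hc).1
    have h1 := (smul_eq_zero.1 h).resolve_right (hz p hp)
    have h2 := (mul_eq_zero.1 h1).resolve_left (lawlorCurve_ne_zero hμ hx)
    rw [← norm_eq_zero, norm_lineCurve, abs_eq_zero] at h2
    exact h2

/-- At y = 0 the link point is multiplied by zero, so the locus is a curve in x alone. -/
theorem image_ansatz_line_zero_eq {φ₁ φ₂ μ : ℝ} :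
    ansatzQuotMap (lawlorCurve (k + 1) φ₁ μ) (lineCurve φ₂) ''
        (orbit G z ×ˢ lawlorInterval (k + 1) ×ˢ {0}) =
      (fun x : ℝ => ansatzQuotMap (lawlorCurve (k + 1) φ₁ μ) (lineCurve φ₂)
        ((0 : CSpace (k + 1)), x, (0 : ℝ))) '' lawlorInterval (k + 1) := by
  have hl : lineCurve φ₂ 0 = 0 := by simp [lineCurve]
  have e : ∀ (p : CSpace (k + 1)) (x : ℝ),
      ansatzQuotMap (lawlorCurve (k + 1) φ₁ μ) (lineCurve φ₂) (p, x, 0) =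
      ansatzQuotMap (lawlorCurve (k + 1) φ₁ μ) (lineCurve φ₂) (0, x, 0) := fun p x =>
    joinC_inj.2 ⟨by simp only [profileFst, hl, mul_zero, zero_smul], rfl⟩
  ext w
  constructor
  · rintro ⟨⟨p, x, y⟩, ⟨-, hx, hy⟩, rfl⟩
    obtain rfl : y = 0 := hy
    exact ⟨x, hx, (e p x).symm⟩
  · rintro ⟨x, hx, rfl⟩
    exact ⟨(z, x, 0), ⟨mem_orbit_self G z, hx, rfl⟩, e z x⟩

end MainTheorem

theorem mainTheorem6 (n : ℕ) (hn : 1 ≤ n)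
    (G : Subgroup (SUGroup n))
    (hGcompact : IsCompact (G : Set (SUGroup n)))
    (hGconnected : IsConnected (G : Set (SUGroup n)))
    (Z : Set (CSpace n)) (hZ : IsAdmissibleComponent G Z)
    (z' : CSpace n) (hz'Z : z' ∈ Z) (hz'0 : z' ≠ 0)
    (Φ : Submodule.span ℂ {z'} ≃ₗ[ℂ] ℂ) (hΦ : IsAngleAdapted G Φ) :
    -- (b): a Lawlor neck profile and a line
    (∀ φ μ : ℝ, 0 < μ →
      -- the map `F` (through which `L_(b)` is defined) is exact special Lagrangian on its
      -- whole domain, and an immersion away from `y = 0`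
      IsExactSpecialLagrangianMap (ansatzDomain G Φ (lawlorInterval n) Set.univ)
        (ansatzQuotMap (lawlorCurve n 0 μ) (lineCurve φ)) ∧
      IsImmersionOn (n + 1) (ansatzDomain G Φ (lawlorInterval n) {0}ᶜ)
        (ansatzQuotMap (lawlorCurve n 0 μ) (lineCurve φ)) ∧
      -- if `G = SO(m-1)`, then `L_(b)` is an embedded exact special Lagrangian
      (IsSO G → IsEmbeddedExactSpecialLagrangian
        (ansatzImage G Φ (lawlorCurve n 0 μ) (lineCurve φ) (lawlorInterval n) Set.univ)) ∧
      -- for every `G`, it is one away from the image of `{y = 0}`, ...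
      IsEmbeddedExactSpecialLagrangian
        (ansatzImage G Φ (lawlorCurve n 0 μ) (lineCurve φ) (lawlorInterval n) Set.univ \
          ansatzImage G Φ (lawlorCurve n 0 μ) (lineCurve φ) (lawlorInterval n) {0}) ∧
      -- ... which is the intersection with `{0} × ℂ` and is one-dimensional
      ansatzImage G Φ (lawlorCurve n 0 μ) (lineCurve φ) (lawlorInterval n) {0} =
        ansatzImage G Φ (lawlorCurve n 0 μ) (lineCurve φ) (lawlorInterval n) Set.univ ∩
          singularAxis n ∧
      IsSubmanifold 1
        (ansatzImage G Φ (lawlorCurve n 0 μ) (lineCurve φ) (lawlorInterval n) {0})) ∧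
    -- (c): two Lawlor neck profiles
    (∀ φ μ₁ μ₂ : ℝ, 0 < μ₁ → 0 < μ₂ →
      -- `L_(c)` is an immersed exact special Lagrangian
      IsExactSpecialLagrangianImmersion
        (ansatzDomain G Φ (lawlorInterval n) (lawlorInterval n))
        (ansatzQuotMap (lawlorCurve n φ μ₁) (lawlorCurve n 0 μ₂)) ∧
      -- and it is embedded when `C_k` has order at most `m - 1`
      (ENat.card (CyclicQuotient G z') ≤ n →
        IsSmoothEmbeddingOn (n + 1) (ansatzDomain G Φ (lawlorInterval n) (lawlorInterval n))
            (ansatzQuotMap (lawlorCurve n φ μ₁) (lawlorCurve n 0 μ₂)) ∧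
        IsEmbeddedExactSpecialLagrangian
          (ansatzImage G Φ (lawlorCurve n φ μ₁) (lawlorCurve n 0 μ₂)
            (lawlorInterval n) (lawlorInterval n)))) := by
  -- k = m - 2 is the dimension of the orbit and the exponent in the phase condition.
  obtain ⟨k, rfl⟩ : ∃ k, n = k + 1 := ⟨n - 1, by omega⟩
  obtain ⟨V, hV⟩ : ∃ V, V = (Φ.symm 1 : CSpace (k + 1)) := ⟨_, rfl⟩
  obtain ⟨c, hcV⟩ := Submodule.mem_span_singleton.1 (Φ.symm 1).2
  rw [← hV] at hcV
  have hV0 : V ≠ 0 := fun h => by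
    have h1 : Φ.symm 1 = 0 := Subtype.ext (hV ▸ h)
    exact one_ne_zero ((LinearEquiv.map_eq_zero_iff _).1 h1)
  have hc0 : c ≠ 0 := by
    rintro rfl
    exact hV0 (by rw [← hcV, zero_smul])
  have hmz' : momentMap G z' = 0 := by
    obtain ⟨w, -, hw⟩ := hZ.component
    have h : z' ∈ connectedComponentIn {w | momentMap G w = 0} w := hw ▸ hz'Z
    exact connectedComponentIn_subset {w | momentMap G w = 0} w h
  have hmV : momentMap G V = 0 := hcV ▸ momentMap_smul c z' hmz'
  obtain ⟨τ, hτ, hspan, ε, hε, hdet⟩ := hΦ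
  rw [holVolForm_snoc_eq] at hdet
  rw [← hV] at hdet hspan
  have hQ := isSpecialLegendrian_orbit hGcompact hmV hτ hspan hε hdet
  have hQ' := isSpecialLegendrian_orbit_union_neg hGcompact hmV hτ hspan hε hdet
  have horb : ∀ p ∈ orbit G V, p ≠ 0 := fun p hp => norm_ne_zero_iff.1 (by
    rw [hQ.norm_eq p hp]; exact one_ne_zero)
  simp only [ansatzImage_eq, ansatzDomain, ← hV]
  refine ⟨fun φ μ hμ => ?_, fun φ μ₁ μ₂ hμ₁ hμ₂ => ?_⟩
  · have hγ := isProfileCurve_lawlorCurve k 0 μ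
    have hξ := isProfileCurve_lineCurve k φ
    have hγ0 : ∀ x ∈ lawlorInterval (k + 1), lawlorCurve (k + 1) 0 μ x ≠ 0 ∧
        deriv (lawlorCurve (k + 1) 0 μ) x ≠ 0 := fun x hx =>
      ⟨lawlorCurve_ne_zero hμ hx, deriv_lawlorCurve_ne_zero hμ hx⟩
    have hξ0 : ∀ y : ℝ, y ≠ 0 → lineCurve φ y ≠ 0 ∧ deriv (lineCurve φ) y ≠ 0 := fun y hy => by
      refine ⟨norm_ne_zero_iff.1 ?_, ?_⟩
      · rw [norm_lineCurve]; exact abs_ne_zero.2 hy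
      · rw [deriv_lineCurve]; exact Complex.exp_ne_zero _
    refine ⟨isExactSpecialLagrangianMap_ansatz hQ hγ hξ hγ.isOpen isOpen_univ subset_rfl subset_rfl,
      isImmersionOn_ansatz hQ hγ hξ hγ.isOpen isOpen_compl_singleton subset_rfl
        (Set.subset_univ _) hγ0 hξ0,
      fun hSO => hSO.isEmbeddedExactSpecialLagrangian_ansatz_line hGcompact hmV
        (hQ.norm_eq V (mem_orbit_self G V)) 0 φ hμ, ?_, image_ansatz_line_zero hμ horb, ?_⟩
    -- Folding y < 0 onto y > 0 replaces the orbit by its union with its negative, where the map is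
    -- an embedding.
    · rw [image_ansatz_line_diff hV0 hμ]
      exact (isExactSpecialLagrangianMap_ansatz hQ' hγ hξ hγ.isOpen isOpen_Ioi subset_rfl
        (Set.subset_univ _)).image ⟨isImmersionOn_ansatz hQ' hγ hξ hγ.isOpen isOpen_Ioi subset_rfl
          (Set.subset_univ _) hγ0 fun y hy => hξ0 y (ne_of_gt hy),
          isEmbedding_ansatz_lawlor_line hQ' hμ⟩
    · rw [image_ansatz_line_zero_eq]
      exact isSubmanifold_singular_curve hμ
  · have hγ := isProfileCurve_lawlorCurve k φ μ₁
    have hξ := isProfileCurve_lawlorCurve k 0 μ₂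
    have hmap := isExactSpecialLagrangianMap_ansatz hQ hγ hξ hγ.isOpen hξ.isOpen subset_rfl
      subset_rfl
    refine ⟨⟨isImmersionOn_ansatz hQ hγ hξ hγ.isOpen hξ.isOpen subset_rfl subset_rfl
      (fun x hx => ⟨lawlorCurve_ne_zero hμ₁ hx, deriv_lawlorCurve_ne_zero hμ₁ hx⟩)
      (fun x hx => ⟨lawlorCurve_ne_zero hμ₂ hx, deriv_lawlorCurve_ne_zero hμ₂ hx⟩), hmap⟩,
      fun hcard => ?_⟩
    have hemb := isSmoothEmbeddingOn_ansatz_lawlor_lawlor hQ (φ₁ := φ) (φ₂ := 0) hμ₁ hμ₂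
      fun t ht p hp hp' => eq_zero_of_exp_smul_mem_orbit hz'0 hc0 hcard ht (hcV ▸ hp) (hcV ▸ hp')
    exact ⟨hemb, hmap.image hemb⟩
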